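/- Fix as category of spaces $\mathcal T$ either the category of all $\Delta$-generated spaces or its full subcategory of $\Delta$-Hausdorff spaces (those in which the image of every continuous path $[0,1]\to X$ is closed); all colimits and products of spaces are formed in $\mathcal T$. **Precubical sets and flows.** Let $\square$ be the category with objects $[n]=\{0,1\}^n$ ($n\ge 0$) whose morphisms are the composites of the coface maps inserting a coordinate $\varepsilon\in\{0,1\}$ in position $i$. A precubical set is a presheaf of sets on $\square$; $\square[n]=\square(-,[n])$, and $K_0$ is the set of vertices of $K$. A flow $X$ consists of a set $X^0$ of states, a space $\mathbb P X$ of $\mathcal T$ (the execution paths), locally constant maps $s,t:\mathbb P X\to X^0$, and a continuous associative composition $*:\{(x,y)\in\mathbb P X\times\mathbb P X : t(x)=s(y)\}\to \mathbb P X$ with $s(x*y)=s(x)$ and $t(x*y)=t(y)$. A morphism of flows is a map on states together with a continuous map on execution paths, compatible with $s$, $t$ and $*$. Write $\mathbb P_{\alpha,\beta}X=\{x\in\mathbb P X : s(x)=\alpha,\ t(x)=\beta\}$. **Natural realization.** For $n\ge1$ let $N_n$ be the space, with the compact-open topology, of continuous maps $\gamma=(\gamma_1,\dots,\gamma_n):[0,n]\to[0,1]^n$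 with all $\gamma_i$ nondecreasing, $\gamma(0)=(0,\dots,0)$, $\gamma(n)=(1,\dots,1)$ and $\gamma_1(t)+\dots+\gamma_n(t)=t$ for all $t$. The flow $|\square[n]|_{nat}$ has $\{0,1\}^n$ as set of states; if $\alpha<\beta$ in the product order and $m$ is the number of coordinates in which $\alpha$ and $\beta$ differ, $\mathbb P_{\alpha,\beta}|\square[n]|_{nat}$ is the copy of $N_m$ in the $m$-dimensional face of $[0,1]^n$ from $\alpha$ to $\beta$, and it is empty otherwise; the composition is the Moore composition of paths. These flows form a functor $\square\to\mathrm{Flow}$, and for a precubical set $K$ one puts $$|K|_{nat}=\varinjlim_{\square[n]\to K}|\square[n]|_{nat}\quad\text{(a colimit of flows)}.$$ **Realization by cube chains.** For positive integers $n_1,\dots,n_p$ let $\square[\underline n]=\square[n_1]*\dots*\square[n_p]$ be the precubical set obtained by identifying the final vertex of each $\square[n_i]$ with the initial vertex of $\square[n_{i+1}]$. For a partition $A\sqcup B=\{1,\dots,m_1+m_2\}$ with $|A|=m_1>0$ and $|B|=m_2>0$, let $\phi_{A,B}:\square[m_1]*\square[m_2]\to\square[m_1+m_2]$ be the map of precubical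 sets which sends $\square[m_1]$ to the face of $\square[m_1+m_2]$ on which the coordinates in $B$ are $0$, and $\square[m_2]$ to the face on which the coordinates in $A$ are $1$. For $\alpha,\beta\in K_0$ and $n\geq 1$, the objects of the category $\mathrm{Ch}_{\alpha,\beta}(K,n)$ are the maps $\square[n_1]*\dots*\square[n_p]\to K$ with $n_1+\dots+n_p=n$ that send the initial vertex to $\alpha$ and the final vertex to $\beta$; a morphism from $a:\square[\underline n_a]\to K$ to $b:\square[\underline n_b]\to K$ is a map $f:\square[\underline n_a]\to\square[\underline n_b]$ with $b\circ f=a$ which is a composite of maps of the form $\mathrm{id}*\dots*\mathrm{id}*\phi_{A,B}*\mathrm{id}*\dots*\mathrm{id}$. Let $\mathcal D_{\alpha,\beta}(K,n):\mathrm{Ch}_{\alpha,\beta}(K,n)\to\mathcal T$ be the functor which sends $\square[n_1]*\dots*\square[n_p]\to K$ to $N_{n_1}\times\dots\times N_{n_p}$, and in which $\phi_{A,B}$ acts by the map $N_{m_1}\times N_{m_2}\to N_{m_1+m_2}$ that views the two paths in the two faces above and takes their Moore composition. The flow $||K||$ has $K_0$ as set of states and $$\mathbb P_{\alpha,\beta}||K||=\coprod_{n\ge1}\varinjlim\mathcal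 D_{\alpha,\beta}(K,n)$$ as spaces of execution paths; its composition is induced by the concatenation of tuples $(N_{n_1}\times\dots\times N_{n_p})\times(N_{n'_1}\times\dots\times N_{n'_q})\to N_{n_1}\times\dots\times N_{n_p}\times N_{n'_1}\times\dots\times N_{n'_q}$ over the concatenation of cube chains. A map $K\to L$ of precubical sets acts on $||-||$ by composition of cube chains with it. **Theorem.** There is an isomorphism of flows $||K||\cong|K|_{nat}$ which is natural with respect to the precubical set $K$; that is, the functors $||-||$ and $|-|_{nat}$ from precubical sets to flows are isomorphic. -/

import Mathlib

open CategoryTheory Limits Opposite Topology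

set_option linter.unusedVariables false

namespace PrecubicalFlow

/-- Continuity on all Euclidean plots: for a map `g : Y → Z` this is continuity of `g` for the
`Δ`-kelleyfications of the topologies of `Y` and `Z`. -/
abbrev DeltaContinuous {Y Z : Type*} [TopologicalSpace Y] [TopologicalSpace Z] (g : Y → Z) : Prop :=
  ContinuousGeneratedBy (fun n : ℕ ↦ Fin n → ℝ) g

/-- `Δ`-Hausdorff: the image of every path is closed. -/
def DeltaHausdorff (X : Type*) [TopologicalSpace X] : Prop :=
  ∀ f : C(unitInterval, X), IsClosed (Set.range f)

/-- The two possible meanings of the convenient category of spaces. -/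
inductive SpaceKind
  | deltaGenerated
  | deltaHausdorff

/-- The spaces of the convenient category: all `Δ`-generated spaces, or the `Δ`-Hausdorff
`Δ`-generated spaces. -/
def IsSpace (c : SpaceKind) (X : Type*) [TopologicalSpace X] : Prop :=
  DeltaGeneratedSpace X ∧ (c = SpaceKind.deltaHausdorff → DeltaHausdorff X)

/-! ### Topological preliminaries -/

/-- A summable sequence of displacements inside a convex set is interpolated by a path. -/
theorem exists_path_through {E : Type*} [NormedAddCommGroup E] [NormedSpace ℝ E]
    [CompleteSpace E] {C : Set E}
    (hC : Convex ℝ C) (x : ℕ → E) (a : E) (hx : ∀ k, x k ∈ C) (ha : a ∈ C)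
    (hs : ∀ k, ‖x k - a‖ ≤ (1 / 2) ^ k) :
    ∃ γ : C(ℝ, E), (∀ t, γ t ∈ C) ∧ γ 0 = a ∧ ∀ k : ℕ, γ ((1 / 2) ^ k) = x k := by
  classical
  let tent : ℕ → ℝ → ℝ := fun k t ↦ max 0 (1 - 3 * |2 ^ k * t - 1|)
  have tent_nonneg : ∀ k t, 0 ≤ tent k t := fun k t ↦ le_max_left _ _
  have tent_le : ∀ k t, tent k t ≤ 1 := fun k t ↦
    max_le zero_le_one (by linarith [abs_nonneg ((2 : ℝ) ^ k * t - 1)])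
  have tent_lt : ∀ k t, tent k t ≠ 0 → (2 / 3 : ℝ) < 2 ^ k * t ∧ 2 ^ k * t < (4 / 3 : ℝ) := by
    intro k t h
    by_contra hcon
    apply h
    apply max_eq_left
    by_contra h2
    push Not at h2
    have : |(2 : ℝ) ^ k * t - 1| < 1 / 3 := by linarith
    rw [abs_lt] at this
    exact hcon ⟨by linarith [this.1], by linarith [this.2]⟩
  have tent_disj' : ∀ k l t, k < l → tent k t ≠ 0 → tent l t = 0 := by
    intro k l t hkl hk
    by_contra hl
    have h1 := tent_lt k t hk
    have h2 := tent_lt l t hl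
    obtain ⟨d, rfl⟩ := Nat.exists_eq_add_of_lt hkl
    have hd : (1 : ℝ) ≤ 2 ^ d := one_le_pow₀ (by norm_num)
    have : (2 : ℝ) ^ (k + d + 1) * t = 2 * (2 ^ d * (2 ^ k * t)) := by ring
    rw [this] at h2
    nlinarith [h1.1, h2.2]
  have tent_disj : ∀ k l t, k ≠ l → tent k t ≠ 0 → tent l t = 0 := by
    intro k l t hkl hk
    rcases lt_or_gt_of_ne hkl with h | h
    · exact tent_disj' k l t h hk
    · by_contra hl
      exact hk (tent_disj' l k t h hl)
  have hcont : Continuous (fun t : ℝ ↦ a + ∑' k, tent k t • (x k - a)) := by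
    refine continuous_const.add (continuous_tsum (u := fun k ↦ (1 / 2 : ℝ) ^ k) ?_ ?_ ?_)
    · intro k
      simp only [tent]
      fun_prop
    · exact summable_geometric_of_lt_one (by norm_num) (by norm_num)
    · intro k t
      rw [norm_smul, Real.norm_of_nonneg (tent_nonneg k t)]
      calc tent k t * ‖x k - a‖ ≤ 1 * ‖x k - a‖ :=
            mul_le_mul_of_nonneg_right (tent_le k t) (norm_nonneg _)
        _ ≤ _ := by rw [one_mul]; exact hs k
  have hval : ∀ k t, tent k t ≠ 0 → (∑' k, tent k t • (x k - a)) = tent k t • (x k - a) := by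
    intro k t h
    refine tsum_eq_single k ?_
    intro l hl
    rw [tent_disj k l t hl.symm h, zero_smul]
  have hval0 : ∀ t, (∀ k, tent k t = 0) → (∑' k, tent k t • (x k - a)) = 0 := by
    intro t h
    simp [h]
  refine ⟨⟨_, hcont⟩, ?_, ?_, ?_⟩
  · intro t
    simp only [ContinuousMap.coe_mk]
    by_cases h : ∃ k, tent k t ≠ 0
    · obtain ⟨k, hk⟩ := h
      rw [hval k t hk]
      exact hC.add_smul_sub_mem ha (hx k) ⟨tent_nonneg k t, tent_le k t⟩
    · push Not at h
      rw [hval0 t h, add_zero]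
      exact ha
  · simp only [ContinuousMap.coe_mk]
    rw [hval0 0, add_zero]
    intro k
    simp only [tent]
    apply max_eq_left
    norm_num
  · intro k
    have h1 : tent k ((1 / 2) ^ k) = 1 := by
      simp only [tent]
      rw [← mul_pow]
      norm_num
    simp only [ContinuousMap.coe_mk]
    rw [hval k _ (by rw [h1]; exact one_ne_zero), h1, one_smul, add_sub_cancel]

/-- A closed set of real parameters that contains all `2⁻ᵏ` contains `0`. -/
theorem zero_mem_of_pow_mem {S : Set ℝ} (hS : IsClosed S) (h : ∀ k : ℕ, ((1 / 2 : ℝ) ^ k) ∈ S) :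
    (0 : ℝ) ∈ S :=
  hS.mem_of_tendsto (tendsto_pow_atTop_nhds_zero_of_lt_one (by norm_num) (by norm_num))
    (Filter.Eventually.of_forall h)

theorem exists_fast_subseq {E : Type*} [NormedAddCommGroup E] {x : ℕ → E} {a : E}
    (h : Filter.Tendsto x Filter.atTop (𝓝 a)) :
    ∃ φ : ℕ → ℕ, ∀ k, ‖x (φ k) - a‖ ≤ (1 / 2) ^ k := by
  have : ∀ k : ℕ, ∃ N, ‖x N - a‖ ≤ (1 / 2) ^ k := by
    intro k
    have hpos : (0 : ℝ) < (1 / 2) ^ k := by positivity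
    obtain ⟨N, hN⟩ := (Metric.tendsto_atTop.1 h) _ hpos
    exact ⟨N, by rw [← dist_eq_norm]; exact (hN N le_rfl).le⟩
  exact ⟨fun k ↦ (this k).choose, fun k ↦ (this k).choose_spec⟩

/-- A convex subset of a Banach space is `Δ`-generated. -/
theorem deltaGeneratedSpace_of_convex {E : Type*} [NormedAddCommGroup E] [NormedSpace ℝ E]
    [CompleteSpace E] {C : Set E} (hC : Convex ℝ C) : DeltaGeneratedSpace C := by
  constructor
  rw [continuous_iff_isClosed]
  intro S hS
  rw [WithGeneratedByTopology.isClosed_iff] at hS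
  apply IsSeqClosed.isClosed
  intro x a hx hxa
  have hxa' : Filter.Tendsto (fun k ↦ (x k : E)) Filter.atTop (𝓝 (a : E)) :=
    (continuous_subtype_val.tendsto a).comp hxa
  obtain ⟨φ, hφ⟩ := exists_fast_subseq hxa'
  obtain ⟨γ, hγ, h0, hk⟩ := exists_path_through hC (fun k ↦ (x (φ k) : E)) a
    (fun k ↦ (x (φ k)).2) a.2 hφ
  let p : C(Fin 1 → ℝ, C) := ⟨fun v ↦ ⟨γ (v 0), hγ _⟩, by fun_prop⟩
  have hcl : IsClosed {t : ℝ | (⟨γ t, hγ t⟩ : C) ∈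
      (WithGeneratedByTopology.equiv (X := fun n : ℕ ↦ Fin n → ℝ)).symm ⁻¹' S} :=
    (hS p).preimage (f := fun t : ℝ ↦ fun _ : Fin 1 ↦ t) (by fun_prop)
  have := zero_mem_of_pow_mem hcl (fun k ↦ by
    have e : (⟨γ ((1 / 2) ^ k), hγ _⟩ : C) = x (φ k) := Subtype.ext (hk k)
    simp only [Set.mem_ofPred_eq]
    rw [e]
    exact hx (φ k))
  simp only [Set.mem_ofPred_eq] at this
  have e : (⟨γ 0, hγ _⟩ : C) = a := Subtype.ext h0
  rw [e] at this
  exact this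

instance deltaGeneratedSpace_prod (m n : ℕ) : DeltaGeneratedSpace ((Fin m → ℝ) × (Fin n → ℝ)) := by
  have : DeltaGeneratedSpace (Set.univ : Set ((Fin m → ℝ) × (Fin n → ℝ))) :=
    deltaGeneratedSpace_of_convex convex_univ
  exact (Homeomorph.Set.univ _).isQuotientMap.isGeneratedBy

/-- In a `Δ`-Hausdorff space two paths agree on a closed set of parameters. -/
theorem DeltaHausdorff.isClosed_eq_path {X : Type*} [TopologicalSpace X] (hX : DeltaHausdorff X)
    (f g : C(unitInterval, X)) : IsClosed {t | f t = g t} := by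
  have hpt : ∀ x : X, IsClosed ({x} : Set X) := by
    intro x
    have h := hX (ContinuousMap.const _ x)
    have e : Set.range (ContinuousMap.const unitInterval x) = {x} := Set.range_const
    rwa [e] at h
  rw [← isOpen_compl_iff, isOpen_iff_mem_nhds]
  intro t₀ ht₀
  have hU : IsOpen {t | f t ≠ g t₀} := (hpt (g t₀)).isOpen_compl.preimage f.continuous
  obtain ⟨ε, hε, hball⟩ := Metric.isOpen_iff.1 hU t₀ ht₀
  let r : C(unitInterval, unitInterval) :=
    ⟨fun t ↦ ⟨max ((t₀ : ℝ) - ε / 2) (min ((t₀ : ℝ) + ε / 2) t), by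
      constructor
      · exact le_max_of_le_right (le_min (by linarith [t₀.2.1]) t.2.1)
      · exact max_le (by linarith [t₀.2.2]) ((min_le_right _ _).trans t.2.2)⟩, by fun_prop⟩
  have hr : ∀ t, r t ∈ Metric.ball t₀ ε := by
    intro t
    rw [Metric.mem_ball, Subtype.dist_eq, Real.dist_eq, abs_lt]
    simp only [r, ContinuousMap.coe_mk]
    constructor
    · linarith [le_max_left ((t₀ : ℝ) - ε / 2) (min ((t₀ : ℝ) + ε / 2) t)]
    · have : max ((t₀ : ℝ) - ε / 2) (min ((t₀ : ℝ) + ε / 2) t) ≤ (t₀ : ℝ) + ε / 2 :=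
        max_le (by linarith) (min_le_left _ _)
      linarith
  have hcl := hX (f.comp r)
  have hV : IsOpen {t | g t ∉ Set.range (f.comp r)} := hcl.isOpen_compl.preimage g.continuous
  have h0 : g t₀ ∉ Set.range (f.comp r) := by
    rintro ⟨t, ht⟩
    exact hball (hr t) ht
  filter_upwards [hV.mem_nhds h0, Metric.ball_mem_nhds t₀ (half_pos hε)] with t ht1 ht2 ht3
  apply ht1
  refine ⟨t, ?_⟩
  have : r t = t := by
    rw [Metric.mem_ball, Subtype.dist_eq, Real.dist_eq, abs_lt] at ht2
    apply Subtype.ext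
    simp only [r, ContinuousMap.coe_mk]
    rw [min_eq_right (by linarith [ht2.2]), max_eq_right (by linarith [ht2.1])]
  simp only [ContinuousMap.comp_apply, this]
  exact ht3

theorem DeltaHausdorff.isClosed_eq_plot {X : Type*} [TopologicalSpace X] (hX : DeltaHausdorff X)
    {n : ℕ} (f g : C(Fin n → ℝ, X)) : IsClosed {t | f t = g t} := by
  apply IsSeqClosed.isClosed
  intro x a hx hxa
  obtain ⟨φ, hφ⟩ := exists_fast_subseq hxa
  obtain ⟨γ, -, h0, hk⟩ := exists_path_through convex_univ (fun k ↦ x (φ k)) a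
    (fun k ↦ trivial) trivial hφ
  let i : C(unitInterval, ℝ) := ⟨Subtype.val, continuous_subtype_val⟩
  have h1 := hX.isClosed_eq_path ((f.comp γ).comp i) ((g.comp γ).comp i)
  have h2 : IsClosed (Subtype.val '' {t | ((f.comp γ).comp i) t = ((g.comp γ).comp i) t}) :=
    (isClosed_Icc.isClosedEmbedding_subtypeVal).isClosedMap _ h1
  have := zero_mem_of_pow_mem h2 (fun k ↦ ⟨⟨(1 / 2) ^ k, by positivity,
    pow_le_one₀ (by norm_num) (by norm_num)⟩, by
      simp only [Set.mem_ofPred_eq, ContinuousMap.comp_apply, i, ContinuousMap.coe_mk, hk]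
      exact hx (φ k), rfl⟩)
  obtain ⟨t, ht, ht0⟩ := this
  simp only [Set.mem_ofPred_eq, ContinuousMap.comp_apply, i, ContinuousMap.coe_mk, ht0, h0] at ht
  exact ht

/-- A `Δ`-generated space is `Δ`-Hausdorff as soon as plots agree on closed sets. -/
theorem deltaHausdorff_of_isClosed_eq {X : Type*} [TopologicalSpace X] [DeltaGeneratedSpace X]
    (h : ∀ (n : ℕ) (f g : C(Fin n → ℝ, X)), IsClosed {t | f t = g t}) : DeltaHausdorff X := by
  intro f
  rw [IsGeneratedBy.isClosed_iff (X := fun n : ℕ ↦ Fin n → ℝ)]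
  intro n p
  let F : C((Fin n → ℝ) × (Fin 1 → ℝ), X) := ⟨fun v ↦ p v.1, by fun_prop⟩
  let G : C((Fin n → ℝ) × (Fin 1 → ℝ), X) :=
    ⟨fun v ↦ f (Set.projIcc 0 1 zero_le_one (v.2 0)), by fun_prop⟩
  have hcl : IsClosed {v | F v = G v} := by
    rw [IsGeneratedBy.isClosed_iff (X := fun n : ℕ ↦ Fin n → ℝ)]
    intro k q
    exact h k (F.comp q) (G.comp q)
  have hcl' : IsClosed {v : (Fin n → ℝ) × unitInterval | p v.1 = f v.2} := by
    have := hcl.preimage (f := fun v : (Fin n → ℝ) × unitInterval ↦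
      ((v.1, fun _ : Fin 1 ↦ (v.2 : ℝ)) : (Fin n → ℝ) × (Fin 1 → ℝ))) (by fun_prop)
    simpa [F, G, Set.preimage] using this
  have := isClosedMap_fst_of_compactSpace (X := Fin n → ℝ) (Y := unitInterval) _ hcl'
  convert this using 1
  ext v
  simp only [Set.mem_preimage, Set.mem_range, Set.mem_image, Set.mem_ofPred_eq, Prod.exists,
    exists_and_right, exists_eq_right]
  exact exists_congr fun t ↦ eq_comm

theorem isSpace_of_isClosed_eq {c : SpaceKind} {X : Type*} [TopologicalSpace X]
    [h : DeltaGeneratedSpace X]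
    (h' : c = SpaceKind.deltaHausdorff →
      ∀ (n : ℕ) (f g : C(Fin n → ℝ, X)), IsClosed {t | f t = g t}) : IsSpace c X :=
  ⟨h, fun hc ↦ deltaHausdorff_of_isClosed_eq (h' hc)⟩

theorem isSpace_of_t2 (c : SpaceKind) {X : Type*} [TopologicalSpace X] [h : DeltaGeneratedSpace X]
    [T2Space X] : IsSpace c X :=
  isSpace_of_isClosed_eq fun _ _ f g ↦ isClosed_eq f.continuous g.continuous

theorem isSpace_discrete (c : SpaceKind) {X : Type*} [TopologicalSpace X] [DiscreteTopology X] :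
    IsSpace c X :=
  have : DeltaGeneratedSpace X := IsGeneratedBy.iff_le_generatedBy.2 (by
    rw [DiscreteTopology.eq_bot (α := X)]; exact bot_le)
  isSpace_of_t2 c

theorem isSpace_sigma {c : SpaceKind} {ι : Type*} {X : ι → Type*} [∀ i, TopologicalSpace (X i)]
    (h : ∀ i, IsSpace c (X i)) : IsSpace c (Σ i, X i) := by
  have : ∀ i, DeltaGeneratedSpace (X i) := fun i ↦ (h i).1
  refine isSpace_of_isClosed_eq fun hc n f g ↦ ?_
  obtain ⟨i, f', rfl⟩ := f.exists_lift_sigma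
  obtain ⟨j, g', rfl⟩ := g.exists_lift_sigma
  by_cases hij : i = j
  · subst hij
    have := ((h i).2 hc).isClosed_eq_plot f' g'
    simpa [ContinuousMap.sigmaMk] using this
  · have : {t | ((ContinuousMap.sigmaMk i).comp f') t = ((ContinuousMap.sigmaMk j).comp g') t} = ∅ := by
      ext t
      simp [ContinuousMap.sigmaMk, hij]
    rw [this]
    exact isClosed_empty

/-- The set `P` with the coarsest `Δ`-generated topology for which all the maps `d k` are
continuous. -/
def InitSpace {P : Type*} {K : Type*} {Z : K → Type*} [∀ k, TopologicalSpace (Z k)]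
    (_d : ∀ k, P → Z k) : Type _ := P

namespace InitSpace

variable {P : Type*} {K : Type*} {Z : K → Type*} [tZ : ∀ k, TopologicalSpace (Z k)]
  {d : ∀ k, P → Z k}

instance : TopologicalSpace (InitSpace d) :=
  TopologicalSpace.generatedBy (Y := P) (tY := ⨅ k, TopologicalSpace.induced (d k) (tZ k))
    (fun n : ℕ ↦ Fin n → ℝ)

instance : DeltaGeneratedSpace (InitSpace d) :=
  let _ : TopologicalSpace P := ⨅ k, TopologicalSpace.induced (d k) (tZ k)
  inferInstanceAs (IsGeneratedBy (fun n : ℕ ↦ Fin n → ℝ)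
    (WithGeneratedByTopology (fun n : ℕ ↦ Fin n → ℝ) P))

theorem continuous_proj (k : K) : Continuous (fun x : InitSpace d ↦ d k x) := by
  let _ : TopologicalSpace P := ⨅ k, TopologicalSpace.induced (d k) (tZ k)
  have h1 : Continuous (d k) := continuous_iff_le_induced.2 (iInf_le _ k)
  exact h1.comp (WithGeneratedByTopology.continuous_equiv
    (X := fun n : ℕ ↦ Fin n → ℝ) (Y := P))

theorem continuous_iff {A : Type*} [TopologicalSpace A] [DeltaGeneratedSpace A]
    {g : A → InitSpace d} : Continuous g ↔ ∀ k, Continuous (fun a ↦ d k (g a)) := by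
  refine ⟨fun h k ↦ (continuous_proj k).comp h, fun h ↦ ?_⟩
  let _ : TopologicalSpace P := ⨅ k, TopologicalSpace.induced (d k) (tZ k)
  have h1 : Continuous (Y := P) g :=
    continuous_iInf_rng.2 fun k ↦ continuous_induced_rng.2 (h k)
  exact (IsGeneratedBy.equiv_symm_comp_continuous_iff (X := fun n : ℕ ↦ Fin n → ℝ) (Z := P) g).2 h1

theorem deltaContinuous_iff {A : Type*} [TopologicalSpace A]
    {g : A → InitSpace d} : DeltaContinuous g ↔ ∀ k, DeltaContinuous (fun a ↦ d k (g a)) := by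
  refine ⟨fun h k n f ↦ continuous_iff.1 (h f) k, fun h n f ↦ continuous_iff.2 fun k ↦ h k f⟩

theorem isSpace {c : SpaceKind} (h : ∀ k, IsSpace c (Z k))
    (hd : ∀ x y : P, (∀ k, d k x = d k y) → x = y) : IsSpace c (InitSpace d) := by
  refine isSpace_of_isClosed_eq fun hc n f g ↦ ?_
  have : {t | f t = g t} = ⋂ k, {t | d k (f t) = d k (g t)} := by
    ext t
    simp only [Set.mem_ofPred_eq, Set.mem_iInter]
    exact ⟨fun e k ↦ by rw [e], fun e ↦ hd _ _ e⟩
  rw [this]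
  exact isClosed_iInter fun k ↦ ((h k).2 hc).isClosed_eq_plot
    ⟨fun t ↦ d k (f t), continuous_iff.1 f.continuous k⟩
    ⟨fun t ↦ d k (g t), continuous_iff.1 g.continuous k⟩

end InitSpace

theorem DeltaContinuous.continuous {Y Z : Type*} [TopologicalSpace Y] [TopologicalSpace Z]
    [DeltaGeneratedSpace Y] {g : Y → Z} (hg : DeltaContinuous g) : Continuous g :=
  (IsGeneratedBy.continuous_iff (X := fun n : ℕ ↦ Fin n → ℝ) g).2 hg

/-! ### The convenient category of spaces -/

/-- The convenient category of spaces, a full subcategory of the category of topological spaces. -/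
abbrev Space (c : SpaceKind) := ObjectProperty.FullSubcategory
  (C := TopCat.{0}) (fun X ↦ IsSpace c X)

namespace Space

variable {c : SpaceKind}

instance : CoeSort (Space c) Type where
  coe X := (X.obj : Type)

instance (X : Space c) : DeltaGeneratedSpace X := X.property.1

/-- A space of the convenient category, from its underlying type. -/
abbrev of (X : Type) [TopologicalSpace X] (h : IsSpace c X) : Space c := ⟨TopCat.of X, h⟩

/-- The underlying function of a morphism. -/
abbrev fn {X Y : Space c} (f : X ⟶ Y) : X → Y := fun x ↦ f.hom.hom x

theorem continuous_fn {X Y : Space c} (f : X ⟶ Y) : Continuous (fn f) := f.hom.hom.continuous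

/-- A continuous function as a morphism. -/
abbrev mkHom {X Y : Space c} (f : X → Y) (hf : Continuous f) : X ⟶ Y :=
  ObjectProperty.homMk (TopCat.ofHom ⟨f, hf⟩)

theorem hom_ext {X Y : Space c} {f g : X ⟶ Y} (h : ∀ x, fn f x = fn g x) : f = g := by
  ext x
  exact h x

theorem fn_comp {X Y Z : Space c} (f : X ⟶ Y) (g : Y ⟶ Z) (x : X) :
    fn (f ≫ g) x = fn g (fn f x) := rfl

theorem fn_id {X : Space c} (x : X) : fn (𝟙 X) x = x := rfl

section Colimits

variable {J : Type} [SmallCategory J] (F : J ⥤ Space c)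

/-- Identify the points of the spaces of a diagram that have the same image in all cocones. -/
def colimSetoid : Setoid (Σ j, F.obj j) where
  r x y := ∀ s : Cocone F, fn (s.ι.app x.1) x.2 = fn (s.ι.app y.1) y.2
  iseqv := ⟨fun _ _ ↦ rfl, fun h s ↦ (h s).symm, fun h h' s ↦ (h s).trans (h' s)⟩

/-- The map induced by a cocone. -/
def colimDesc (s : Cocone F) : Quotient (colimSetoid F) → s.pt :=
  Quotient.lift (fun x ↦ fn (s.ι.app x.1) x.2) (fun _ _ h ↦ h s)

/-- A colimit cocone. -/
def colimCocone : Cocone F where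
  pt := of (InitSpace (colimDesc F)) (InitSpace.isSpace (fun s ↦ s.pt.property) (by
    rintro ⟨x⟩ ⟨y⟩ h
    exact Quotient.sound h))
  ι :=
    { app := fun j ↦ mkHom (fun x ↦ (Quotient.mk (colimSetoid F) ⟨j, x⟩ :))
        (InitSpace.continuous_iff.2 fun s ↦ continuous_fn (s.ι.app j))
      naturality := fun i j f ↦ hom_ext fun x ↦ Quotient.sound fun s ↦
        congrArg (fun g ↦ fn g x) (s.w f) }

/-- The cocone `colimCocone` is a colimit. -/
def colimCoconeIsColimit : IsColimit (colimCocone F) where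
  desc s := mkHom (colimDesc F s) (InitSpace.continuous_proj s)
  fac s j := rfl
  uniq s m h := hom_ext (by
    rintro ⟨x⟩
    exact congrArg (fun f ↦ fn f x.2) (h x.1))

instance : HasColimitsOfSize.{0, 0} (Space c) :=
  ⟨fun _ _ ↦ ⟨fun F ↦ ⟨⟨⟨_, colimCoconeIsColimit F⟩⟩⟩⟩⟩

theorem exists_rep (u : (colimit F : Space c)) : ∃ j x, fn (colimit.ι F j) x = u := by
  let e := (colimit.isColimit F).coconePointUniqueUpToIso (colimCoconeIsColimit F)
  obtain ⟨⟨j, x⟩, hx⟩ := Quotient.exists_rep (s := colimSetoid F) (fn e.hom u)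
  refine ⟨j, x, ?_⟩
  have h1 : fn e.inv (fn ((colimCocone F).ι.app j) x) = fn e.inv (fn e.hom u) :=
    congrArg _ hx
  rw [← fn_comp, ← fn_comp, e.hom_inv_id, fn_id] at h1
  rw [← h1]
  have h2 := (colimit.isColimit F).comp_coconePointUniqueUpToIso_inv (colimCoconeIsColimit F) j
  rw [h2]
  rfl

theorem fn_colimit_w {i j : J} (f : i ⟶ j) (x : F.obj i) :
    fn (colimit.ι F j) (fn (F.map f) x) = fn (colimit.ι F i) x := by
  rw [← fn_comp, colimit.w]

theorem fn_colimit_desc (s : Cocone F) (j : J) (x : F.obj j) :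
    fn (colimit.desc F s) (fn (colimit.ι F j) x) = fn (s.ι.app j) x := by
  rw [← fn_comp, colimit.ι_desc]

end Colimits

/-- The product of two spaces in the convenient category: the `Δ`-kelleyfication of the product
topology. -/
def prod (X Y : Space c) : Space c :=
  of (WithGeneratedByTopology (fun n : ℕ ↦ Fin n → ℝ) (X × Y))
    (isSpace_of_isClosed_eq fun hc _ f g ↦ by
      have hp := WithGeneratedByTopology.continuous_equiv
        (X := fun n : ℕ ↦ Fin n → ℝ) (Y := X × Y)
      have h1 := (X.property.2 hc).isClosed_eq_plot
        ⟨fun t ↦ (WithGeneratedByTopology.equiv (f t)).1, (hp.comp f.continuous).fst⟩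
        ⟨fun t ↦ (WithGeneratedByTopology.equiv (g t)).1, (hp.comp g.continuous).fst⟩
      have h2 := (Y.property.2 hc).isClosed_eq_plot
        ⟨fun t ↦ (WithGeneratedByTopology.equiv (f t)).2, (hp.comp f.continuous).snd⟩
        ⟨fun t ↦ (WithGeneratedByTopology.equiv (g t)).2, (hp.comp g.continuous).snd⟩
      convert h1.inter h2 using 1
      ext t
      exact Prod.ext_iff)

/-- The pair of two points, as a point of the product. -/
def pair {X Y : Space c} (x : X) (y : Y) : prod X Y := (x, y)

/-- The first projection. -/
def fst {X Y : Space c} (p : prod X Y) : X := Prod.fst p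

/-- The second projection. -/
def snd {X Y : Space c} (p : prod X Y) : Y := Prod.snd p

theorem continuous_fst {X Y : Space c} : Continuous (fst : prod X Y → X) :=
  Continuous.comp (Y := X × Y) _root_.continuous_fst
    (WithGeneratedByTopology.continuous_equiv (X := fun n : ℕ ↦ Fin n → ℝ) (Y := X × Y))

theorem continuous_snd {X Y : Space c} : Continuous (snd : prod X Y → Y) :=
  Continuous.comp (Y := X × Y) _root_.continuous_snd
    (WithGeneratedByTopology.continuous_equiv (X := fun n : ℕ ↦ Fin n → ℝ) (Y := X × Y))

theorem continuous_pair {A : Type*} [TopologicalSpace A] [DeltaGeneratedSpace A] {X Y : Space c}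
    {f : A → X} {g : A → Y} (hf : Continuous f) (hg : Continuous g) :
    Continuous (fun a ↦ pair (f a) (g a)) :=
  (IsGeneratedBy.equiv_symm_comp_continuous_iff (X := fun n : ℕ ↦ Fin n → ℝ) (Z := X × Y)
    (fun a ↦ (f a, g a))).2 (hf.prodMk hg)

theorem deltaContinuous_pair {X Y : Space c} :
    DeltaContinuous (fun p : X × Y ↦ (pair p.1 p.2 : prod X Y)) := fun _ f ↦
  continuous_pair (_root_.continuous_fst.comp f.continuous)
    (_root_.continuous_snd.comp f.continuous)

/-- The space of `Δ`-continuous maps. -/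
def homSpace (A : Type) [TopologicalSpace A] (Z : Space c) : Space c :=
  of (WithGeneratedByTopology (fun n : ℕ ↦ Fin n → ℝ)
      (ContinuousMapGeneratedBy (fun n : ℕ ↦ Fin n → ℝ) A Z))
    (isSpace_of_isClosed_eq fun hc n f g ↦ by
      have key : ∀ (f : C(Fin n → ℝ, WithGeneratedByTopology (fun n : ℕ ↦ Fin n → ℝ)
          (ContinuousMapGeneratedBy (fun n : ℕ ↦ Fin n → ℝ) A Z))) (a : A),
          Continuous (fun t ↦ WithGeneratedByTopology.equiv (f t) a) := by
        intro f a
        have h := ((WithGeneratedByTopology.continuous_equiv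
          (X := fun n : ℕ ↦ Fin n → ℝ)).comp f.continuous).continuousGeneratedBy
          (X := fun n : ℕ ↦ Fin n → ℝ)
        have h2 := (ContinuousMapGeneratedBy.curryEquiv.symm ⟨_, h⟩).prop
        have h3 := h2.comp (Continuous.prodMk_right a).continuousGeneratedBy
        exact DeltaContinuous.continuous h3
      have e : {t | f t = g t} = ⋂ a : A, {t | WithGeneratedByTopology.equiv (f t) a =
          WithGeneratedByTopology.equiv (g t) a} := by
        ext t
        simp only [Set.mem_ofPred_eq, Set.mem_iInter]
        refine ⟨fun e a ↦ by rw [e], fun e ↦ ?_⟩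
        apply WithGeneratedByTopology.equiv.injective
        exact DFunLike.ext _ _ e
      rw [e]
      exact isClosed_iInter fun a ↦ (Z.property.2 hc).isClosed_eq_plot
        ⟨_, key f a⟩ ⟨_, key g a⟩)

/-- Products with a fixed space preserve colimits, on the level of maps. -/
theorem exists_extension {J : Type} [SmallCategory J] (G : J ⥤ Space c)
    (A : Type) [TopologicalSpace A] (Z : Space c) (h : ∀ j, A → G.obj j → Z)
    (hc : ∀ j, DeltaContinuous (fun p : A × G.obj j ↦ h j p.1 p.2))
    (hw : ∀ {i j} (f : i ⟶ j) a y, h j a (fn (G.map f) y) = h i a y) :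
    ∃ k : A → (colimit G).obj → Z,
      DeltaContinuous (fun p : A × (colimit G).obj ↦ k p.1 p.2) ∧
      ∀ j a y, k a (fn (colimit.ι G j) y) = h j a y := by
  let φ : ∀ j, ContinuousMapGeneratedBy (fun n : ℕ ↦ Fin n → ℝ) (G.obj j)
      (ContinuousMapGeneratedBy (fun n : ℕ ↦ Fin n → ℝ) A Z) := fun j ↦
    ContinuousMapGeneratedBy.curryEquiv ⟨fun p : A × G.obj j ↦ h j p.1 p.2, hc j⟩
  let s : Cocone G :=
    { pt := homSpace A Z
      ι :=
        { app := fun j ↦ mkHom (fun y ↦ (WithGeneratedByTopology.equiv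
              (X := fun n : ℕ ↦ Fin n → ℝ)).symm (φ j y))
            ((IsGeneratedBy.equiv_symm_comp_continuous_iff (X := fun n : ℕ ↦ Fin n → ℝ) (φ j)).2
              (DeltaContinuous.continuous (φ j).prop))
          naturality := fun i j f ↦ hom_ext fun y ↦ by
            refine ContinuousMapGeneratedBy.ext (funext fun a ↦ ?_)
            exact hw f a y } }
  let m : (colimit G).obj → ContinuousMapGeneratedBy (fun n : ℕ ↦ Fin n → ℝ) A Z :=
    fun v ↦ WithGeneratedByTopology.equiv (X := fun n : ℕ ↦ Fin n → ℝ)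
      (Y := ContinuousMapGeneratedBy (fun n : ℕ ↦ Fin n → ℝ) A Z) (fn (colimit.desc G s) v)
  have hm : DeltaContinuous m := ((WithGeneratedByTopology.continuous_equiv
    (X := fun n : ℕ ↦ Fin n → ℝ)
    (Y := ContinuousMapGeneratedBy (fun n : ℕ ↦ Fin n → ℝ) A Z)).comp
    (continuous_fn (colimit.desc G s))).continuousGeneratedBy
  refine ⟨fun a v ↦ m v a, (ContinuousMapGeneratedBy.curryEquiv.symm ⟨m, hm⟩).prop, ?_⟩
  intro j a y
  simp only [m]
  rw [fn_colimit_desc]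
  rfl

/-- A compatible family of `Δ`-continuous maps of two variables extends to the colimits. -/
theorem exists_extension₂ {J₁ J₂ : Type} [SmallCategory J₁] [SmallCategory J₂]
    (F : J₁ ⥤ Space c) (G : J₂ ⥤ Space c) (Z : Space c) (h : ∀ i j, F.obj i → G.obj j → Z)
    (hc : ∀ i j, DeltaContinuous (fun p : F.obj i × G.obj j ↦ h i j p.1 p.2))
    (h₁ : ∀ {i i'} (f : i ⟶ i') j x y, h i' j (fn (F.map f) x) y = h i j x y)
    (h₂ : ∀ i {j j'} (f : j ⟶ j') x y, h i j' x (fn (G.map f) y) = h i j x y) :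
    ∃ m : (colimit F).obj → (colimit G).obj → Z,
      DeltaContinuous (fun p : (colimit F).obj × (colimit G).obj ↦ m p.1 p.2) ∧
      ∀ i j x y, m (fn (colimit.ι F i) x) (fn (colimit.ι G j) y) = h i j x y := by
  choose k hk hk' using fun i ↦ exists_extension G (F.obj i) Z (h i) (hc i) (h₂ i)
  obtain ⟨m, hm, hm'⟩ := exists_extension F ((colimit G).obj) Z (fun i v x ↦ k i x v)
    (fun i ↦ (hk i).comp (Continuous.continuousGeneratedBy continuous_swap)) (by
      intro i i' f v x
      obtain ⟨j, y, rfl⟩ := exists_rep G v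
      rw [hk', hk', h₁])
  refine ⟨fun u v ↦ m v u, hm.comp (Continuous.continuousGeneratedBy continuous_swap), ?_⟩
  exact fun i j x y ↦ (hm' i _ x).trans (hk' i j x y)

end Space

/-! ### Flows -/

/-- A flow: a set of states, a space of execution paths with locally constant source and target
maps, and an associative composition `x * y` of the pairs with `tgt x = src y`, which is continuous
on the fibre product formed in the convenient category of spaces. -/
structure Flow (c : SpaceKind) where
  State : Type
  Path : Space c
  src : Path → State
  tgt : Path → State
  src_loc : IsLocallyConstant src
  tgt_loc : IsLocallyConstant tgt
  comp : ∀ x y : Path, tgt x = src y → Path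
  comp_cont : DeltaContinuous
    (fun p : {p : Path × Path // tgt p.1 = src p.2} ↦ comp p.1.1 p.1.2 p.2)
  src_comp : ∀ x y h, src (comp x y h) = src x
  tgt_comp : ∀ x y h, tgt (comp x y h) = tgt y
  assoc : ∀ x y z hxy hyz, comp (comp x y hxy) z ((tgt_comp x y hxy).trans hyz) =
    comp x (comp y z hyz) (hxy.trans (src_comp y z hyz).symm)

namespace Flow

variable {c : SpaceKind}

/-- A morphism of flows. -/
@[ext]
structure Hom (X Y : Flow c) where
  state : X.State → Y.State
  path : X.Path → Y.Path
  path_cont : Continuous path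
  src_path : ∀ x, Y.src (path x) = state (X.src x)
  tgt_path : ∀ x, Y.tgt (path x) = state (X.tgt x)
  path_comp : ∀ x y h, path (X.comp x y h) =
    Y.comp (path x) (path y) ((tgt_path x).trans ((congrArg state h).trans (src_path y).symm))

attribute [simp] Hom.src_path Hom.tgt_path

instance : Category (Flow c) where
  Hom := Hom
  id X :=
    { state := id
      path := id
      path_cont := continuous_id
      src_path := fun _ ↦ rfl
      tgt_path := fun _ ↦ rfl
      path_comp := fun _ _ _ ↦ rfl }
  comp f g :=
    { state := g.state ∘ f.state
      path := g.path ∘ f.path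
      path_cont := g.path_cont.comp f.path_cont
      src_path := fun x ↦ by simp
      tgt_path := fun x ↦ by simp
      path_comp := fun x y h ↦ by simp [f.path_comp, g.path_comp] }

theorem hom_ext {X Y : Flow c} {f g : X ⟶ Y} (h₁ : ∀ a, Hom.state f a = Hom.state g a)
    (h₂ : ∀ x, Hom.path f x = Hom.path g x) : f = g :=
  Hom.ext (funext h₁) (funext h₂)

@[simp] theorem comp_state {X Y Z : Flow c} (f : X ⟶ Y) (g : Y ⟶ Z) (a : X.State) :
    Hom.state (f ≫ g) a = Hom.state g (Hom.state f a) := rfl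

@[simp] theorem comp_path {X Y Z : Flow c} (f : X ⟶ Y) (g : Y ⟶ Z) (x : X.Path) :
    Hom.path (f ≫ g) x = Hom.path g (Hom.path f x) := rfl

@[simp] theorem id_state {X : Flow c} (a : X.State) : Hom.state (𝟙 X) a = a := rfl

@[simp] theorem id_path {X : Flow c} (x : X.Path) : Hom.path (𝟙 X) x = x := rfl

/-! #### Colimits of flows -/

section Colimits

variable {J : Type} [SmallCategory J] (F : J ⥤ Flow c)

/-- Identify the states with the same image in all cocones. -/
def stateSetoid : Setoid (Σ j, (F.obj j).State) where
  r x y := ∀ s : Cocone F, Hom.state (s.ι.app x.1) x.2 = Hom.state (s.ι.app y.1) y.2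
  iseqv := ⟨fun _ _ ↦ rfl, fun h s ↦ (h s).symm, fun h h' s ↦ (h s).trans (h' s)⟩

/-- The states of the colimit. -/
abbrev ColimState := Quotient (stateSetoid F)

/-- The class of a state. -/
abbrev toState (j : J) (a : (F.obj j).State) : ColimState F :=
  Quotient.mk (stateSetoid F) ⟨j, a⟩

/-- The map on states induced by a cocone. -/
def descState (s : Cocone F) : ColimState F → s.pt.State :=
  Quotient.lift (fun x ↦ Hom.state (s.ι.app x.1) x.2) (fun _ _ h ↦ h s)

/-- Formal composites of the execution paths of the diagram. -/
inductive Word : ColimState F → ColimState F → Type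
  | letter (j : J) (x : (F.obj j).Path) :
      Word (toState F j ((F.obj j).src x)) (toState F j ((F.obj j).tgt x))
  | mul {a b b' d : ColimState F} (u : Word a b) (v : Word b' d) (h : b = b') : Word a d

/-- The value of a formal composite in a cocone. -/
def evalWord (s : Cocone F) : ∀ {a b : ColimState F}, Word F a b →
    {p : s.pt.Path // s.pt.src p = descState F s a ∧ s.pt.tgt p = descState F s b}
  | _, _, .letter j x => ⟨Hom.path (s.ι.app j) x, Hom.src_path _ _, Hom.tgt_path _ _⟩
  | _, _, .mul u v h =>
      ⟨s.pt.comp (evalWord s u).1 (evalWord s v).1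
        (by rw [(evalWord s u).2.2, (evalWord s v).2.1, h]),
        by rw [s.pt.src_comp, (evalWord s u).2.1], by rw [s.pt.tgt_comp, (evalWord s v).2.2]⟩

/-- Formal composites with their end points. -/
abbrev TotalWord := Σ p : ColimState F × ColimState F, Word F p.1 p.2

/-- Identify the formal composites with the same end points and the same image in all cocones. -/
def pathSetoid : Setoid (TotalWord F) where
  r u v := u.1 = v.1 ∧ ∀ s : Cocone F, (evalWord F s u.2).1 = (evalWord F s v.2).1
  iseqv := ⟨fun _ ↦ ⟨rfl, fun _ ↦ rfl⟩, fun h ↦ ⟨h.1.symm, fun s ↦ (h.2 s).symm⟩,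
    fun h h' ↦ ⟨h.1.trans h'.1, fun s ↦ (h.2 s).trans (h'.2 s)⟩⟩

/-- The execution paths of the colimit, as a set. -/
abbrev ColimPath := Quotient (pathSetoid F)

/-- The source and the target of a path. -/
def ends : ColimPath F → ColimState F × ColimState F :=
  Quotient.lift (fun u ↦ u.1) (fun _ _ h ↦ h.1)

/-- The map on paths induced by a cocone. -/
def descPath (s : Cocone F) : ColimPath F → s.pt.Path :=
  Quotient.lift (fun u ↦ (evalWord F s u.2).1) (fun _ _ h ↦ h.2 s)

theorem src_descPath (s : Cocone F) (x : ColimPath F) :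
    s.pt.src (descPath F s x) = descState F s (ends F x).1 := by
  obtain ⟨u, rfl⟩ := Quotient.exists_rep x
  exact (evalWord F s u.2).2.1

theorem tgt_descPath (s : Cocone F) (x : ColimPath F) :
    s.pt.tgt (descPath F s x) = descState F s (ends F x).2 := by
  obtain ⟨u, rfl⟩ := Quotient.exists_rep x
  exact (evalWord F s u.2).2.2

theorem colimPath_ext {x y : ColimPath F} (h : ends F x = ends F y)
    (h' : ∀ s, descPath F s x = descPath F s y) : x = y := by
  obtain ⟨u, rfl⟩ := Quotient.exists_rep x
  obtain ⟨v, rfl⟩ := Quotient.exists_rep y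
  exact Quotient.sound ⟨h, h'⟩

/-- The discrete space of pairs of states. -/
def endSpace (c : SpaceKind) (S : Type) : Space c :=
  letI : TopologicalSpace (S × S) := ⊥
  haveI : DiscreteTopology (S × S) := ⟨rfl⟩
  Space.of (S × S) (isSpace_discrete c)

instance (S : Type) : DiscreteTopology (endSpace c S) := ⟨rfl⟩

/-- The spaces that detect the topology of the colimit. -/
def testSpace : Option (Cocone F) → Space c
  | none => endSpace c (ColimState F)
  | some s => s.pt.Path

/-- The maps that detect the topology of the colimit. -/
def testMap : ∀ k : Option (Cocone F), ColimPath F → testSpace F k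
  | none => ends F
  | some s => descPath F s

/-- The space of execution paths of the colimit. -/
def colimPathSpace : Space c :=
  Space.of (InitSpace (testMap F)) (InitSpace.isSpace (fun k ↦ (testSpace F k).property)
    (fun _ _ h ↦ colimPath_ext F (h none) (fun s ↦ h (some s))))

theorem ends_out (x : ColimPath F) : x.out.1 = ends F x := congrArg (ends F) (Quotient.out_eq x)

theorem eval_out (s : Cocone F) (x : ColimPath F) :
    (evalWord F s x.out.2).1 = descPath F s x := congrArg (descPath F s) (Quotient.out_eq x)

/-- Composition in the colimit. -/
noncomputable def colimComp (x y : ColimPath F) (h : (ends F x).2 = (ends F y).1) : ColimPath F :=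
  Quotient.mk (pathSetoid F) ⟨(x.out.1.1, y.out.1.2), .mul x.out.2 y.out.2 (by
    rw [ends_out, ends_out, h])⟩

theorem ends_colimComp (x y : ColimPath F) (h : (ends F x).2 = (ends F y).1) :
    ends F (colimComp F x y h) = ((ends F x).1, (ends F y).2) := by
  rw [← ends_out F x, ← ends_out F y]
  rfl

theorem descPath_colimComp (s : Cocone F) (x y : ColimPath F) (h : (ends F x).2 = (ends F y).1) :
    descPath F s (colimComp F x y h) = s.pt.comp (descPath F s x) (descPath F s y)
      (by rw [tgt_descPath, src_descPath, h]) := by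
  simp only [← eval_out F s x, ← eval_out F s y]
  rfl

theorem continuous_ends : Continuous (Y := endSpace c (ColimState F))
    (fun x : colimPathSpace F ↦ ends F x) :=
  InitSpace.continuous_proj (d := testMap F) none

theorem isLocallyConstant_ends {A : Type} [TopologicalSpace A] {g : A → colimPathSpace F}
    (hg : Continuous g) : IsLocallyConstant (fun a ↦ ends F (g a)) := fun s ↦
  (isOpen_discrete (α := endSpace c (ColimState F)) s).preimage ((continuous_ends F).comp hg)

theorem continuous_descPath (s : Cocone F) : Continuous
    (fun x : colimPathSpace F ↦ descPath F s x) :=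
  InitSpace.continuous_proj (d := testMap F) (some s)

theorem continuous_to_colimPath {A : Type} [TopologicalSpace A] [DeltaGeneratedSpace A]
    {g : A → colimPathSpace F} (h : IsLocallyConstant (fun a ↦ ends F (g a)))
    (h' : ∀ s, Continuous (fun a ↦ descPath F s (g a))) : Continuous g :=
  InitSpace.continuous_iff.2 fun k ↦ match k with
    | none => continuous_def.2 fun _ _ ↦ h _
    | some s => h' s

theorem comp_congr {X : Flow c} {x x' y y' : X.Path} (hx : x = x') (hy : y = y')
    (h : X.tgt x = X.src y) : X.comp x y h = X.comp x' y' (by rw [← hx, ← hy, h]) := by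
  subst hx hy
  rfl

theorem colimComp_assoc (x y z : ColimPath F) (hxy : (ends F x).2 = (ends F y).1)
    (hyz : (ends F y).2 = (ends F z).1) :
    colimComp F (colimComp F x y hxy) z (by rw [ends_colimComp, hyz]) =
      colimComp F x (colimComp F y z hyz) (by rw [ends_colimComp, hxy]) := by
  apply colimPath_ext
  · simp only [ends_colimComp]
  · intro s
    refine (descPath_colimComp F s _ z _).trans ((comp_congr
      (descPath_colimComp F s x y hxy) rfl _).trans ?_)
    refine Eq.trans ?_ ((descPath_colimComp F s x _ _).trans (comp_congr rfl
      (descPath_colimComp F s y z hyz) _)).symm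
    exact s.pt.assoc _ _ _ _ _

/-- The colimit of a diagram of flows. -/
noncomputable def colimFlow : Flow c where
  State := ColimState F
  Path := colimPathSpace F
  src x := (ends F x).1
  tgt x := (ends F x).2
  src_loc := (isLocallyConstant_ends F continuous_id).comp Prod.fst
  tgt_loc := (isLocallyConstant_ends F continuous_id).comp Prod.snd
  comp x y h := colimComp F x y h
  comp_cont := fun n f ↦ by
    refine continuous_to_colimPath F ?_ ?_
    · have h5 := ((isLocallyConstant_ends F (g := fun t ↦ (f t).1.1) (by fun_prop)).prodMk
        (isLocallyConstant_ends F (g := fun t ↦ (f t).1.2) (by fun_prop))).comp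
        (fun p ↦ (p.1.1, p.2.2))
      convert h5 using 2 with t
      exact ends_colimComp F _ _ (f t).2
    · intro s
      have h1 : Continuous (fun t ↦ descPath F s (f t).1.1) :=
        (continuous_descPath F s).comp (by fun_prop)
      have h2 : Continuous (fun t ↦ descPath F s (f t).1.2) :=
        (continuous_descPath F s).comp (by fun_prop)
      have h3 := s.pt.comp_cont ⟨fun t ↦ ⟨(descPath F s (f t).1.1, descPath F s (f t).1.2), by
        exact (tgt_descPath F s _).trans ((congrArg (descState F s) (f t).2).trans
          (src_descPath F s _).symm)⟩, by fun_prop⟩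
      convert h3 using 2 with t
      exact descPath_colimComp F s _ _ (f t).2
  src_comp x y h := (Prod.ext_iff.1 (ends_colimComp F x y h)).1
  tgt_comp x y h := (Prod.ext_iff.1 (ends_colimComp F x y h)).2
  assoc x y z hxy hyz := colimComp_assoc F x y z hxy hyz

/-- The colimit cocone of a diagram of flows. -/
noncomputable def colimCocone : Cocone F where
  pt := colimFlow F
  ι :=
    { app := fun j ↦
        { state := fun a ↦ toState F j a
          path := fun x ↦ Quotient.mk (pathSetoid F) ⟨(_, _), .letter j x⟩
          path_cont := continuous_to_colimPath F
            (((F.obj j).src_loc.prodMk (F.obj j).tgt_loc).comp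
              (fun p ↦ (toState F j p.1, toState F j p.2)))
            (fun s ↦ Hom.path_cont (s.ι.app j))
          src_path := fun _ ↦ rfl
          tgt_path := fun _ ↦ rfl
          path_comp := fun x y h ↦ by
            let x' : ColimPath F := Quotient.mk (pathSetoid F) ⟨(_, _), .letter j x⟩
            let y' : ColimPath F := Quotient.mk (pathSetoid F) ⟨(_, _), .letter j y⟩
            have h' : (ends F x').2 = (ends F y').1 := congrArg (toState F j) h
            apply colimPath_ext
            · refine Eq.trans ?_ (ends_colimComp F x' y' h').symm
              exact Prod.ext (congrArg (toState F j) ((F.obj j).src_comp x y h))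
                (congrArg (toState F j) ((F.obj j).tgt_comp x y h))
            · intro s
              refine Eq.trans ?_ (descPath_colimComp F s x' y' h').symm
              exact Hom.path_comp (s.ι.app j) x y h }
      naturality := fun i j f ↦ by
        have hst : ∀ a, toState F j (Hom.state (F.map f) a) = toState F i a := fun a ↦
          Quotient.sound fun s ↦ congrArg (fun g ↦ Hom.state g a) (s.w f)
        refine hom_ext hst fun x ↦ colimPath_ext F ?_ fun s ↦ ?_
        · exact Prod.ext ((congrArg (toState F j) (Hom.src_path (F.map f) x)).trans (hst _))
            ((congrArg (toState F j) (Hom.tgt_path (F.map f) x)).trans (hst _))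
        · exact congrArg (fun g ↦ Hom.path g x) (s.w f) }

/-- The universal property of the colimit. -/
noncomputable def colimCoconeIsColimit : IsColimit (colimCocone F) where
  desc s :=
    { state := descState F s
      path := descPath F s
      path_cont := continuous_descPath F s
      src_path := src_descPath F s
      tgt_path := tgt_descPath F s
      path_comp := descPath_colimComp F s }
  fac s j := rfl
  uniq s m h := by
    have hst : ∀ a, Hom.state m a = descState F s a := by
      rintro ⟨j, a⟩
      exact congrArg (fun f ↦ Hom.state f a) (h j)
    have hw : ∀ {a b : ColimState F} (w : Word F a b),
        Hom.path m (Quotient.mk (pathSetoid F) ⟨(a, b), w⟩) = (evalWord F s w).1 := by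
      intro a b w
      induction w with
      | letter j x => exact congrArg (fun f ↦ Hom.path f x) (h j)
      | mul u v hb ihu ihv =>
        let x : ColimPath F := Quotient.mk (pathSetoid F) ⟨(_, _), u⟩
        let y : ColimPath F := Quotient.mk (pathSetoid F) ⟨(_, _), v⟩
        have hxy : (ends F x).2 = (ends F y).1 := hb
        have e : (Quotient.mk (pathSetoid F) ⟨(_, _), .mul u v hb⟩ : ColimPath F) =
            colimComp F x y hxy := by
          apply colimPath_ext
          · exact (ends_colimComp F x y hxy).symm
          · intro t
            exact (descPath_colimComp F t x y hxy).symm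
        rw [e]
        refine (Hom.path_comp m x y hxy).trans ?_
        exact comp_congr ihu ihv _
    refine hom_ext hst ?_
    rintro ⟨⟨⟨a, b⟩, w⟩⟩
    exact hw w

instance : HasColimitsOfSize.{0, 0} (Flow c) :=
  ⟨fun _ _ ↦ ⟨fun F ↦ ⟨⟨⟨_, colimCoconeIsColimit F⟩⟩⟩⟩⟩

end Colimits

end Flow

/-! ### Precubical sets -/

/-- The maps `{0,1}ᵐ → {0,1}ⁿ` that are composites of coface maps, the coface map `δᵢᵋ` being
the insertion of the coordinate `ε` in position `i`. -/
inductive IsBoxMap : ∀ {m n : ℕ}, ((Fin m → Bool) → (Fin n → Bool)) → Prop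
  | id (n : ℕ) : IsBoxMap (fun v : Fin n → Bool ↦ v)
  | coface {n : ℕ} (i : Fin (n + 1)) (ε : Bool) :
      IsBoxMap (fun v : Fin n → Bool ↦ (i.insertNth ε v : Fin (n + 1) → Bool))
  | comp {l m n : ℕ} {f : (Fin l → Bool) → (Fin m → Bool)} {g : (Fin m → Bool) → (Fin n → Bool)} :
      IsBoxMap f → IsBoxMap g → IsBoxMap (fun v ↦ g (f v))

/-- The objects `[n] = {0,1}ⁿ` of the box category. -/
structure Box where
  dim : ℕ

namespace Box

/-- The vertices of `[n]`. -/
abbrev Vertex (X : Box) := Fin X.dim → Bool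

/-- The morphisms of the box category. -/
@[ext]
structure Hom (X Y : Box) where
  toFun : X.Vertex → Y.Vertex
  isBoxMap : IsBoxMap toFun

instance : SmallCategory Box where
  Hom := Hom
  id X := ⟨fun v ↦ v, .id X.dim⟩
  comp f g := ⟨fun v ↦ g.toFun (f.toFun v), .comp f.isBoxMap g.isBoxMap⟩

/-- The map of vertices underlying a morphism of the box category. -/
def app {X Y : Box} (f : X ⟶ Y) : X.Vertex → Y.Vertex := Hom.toFun f

theorem app_isBoxMap {X Y : Box} (f : X ⟶ Y) : IsBoxMap (app f) := Hom.isBoxMap f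

theorem hom_ext {X Y : Box} {f g : X ⟶ Y} (h : ∀ v, app f v = app g v) : f = g :=
  Hom.ext (funext h)

@[simp] theorem app_id {X : Box} (v : X.Vertex) : app (𝟙 X) v = v := rfl

@[simp] theorem app_comp {X Y Z : Box} (f : X ⟶ Y) (g : Y ⟶ Z) (v : X.Vertex) :
    app (f ≫ g) v = app g (app f v) := rfl

end Box

/-- Each coordinate of a box map is constant or a coordinate of the source. -/
theorem IsBoxMap.coord {m n : ℕ} {f : (Fin m → Bool) → (Fin n → Bool)} (hf : IsBoxMap f)
    (j : Fin n) : (∃ ε, ∀ v, f v j = ε) ∨ ∃ i, ∀ v, f v j = v i := by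
  induction hf with
  | id n => exact Or.inr ⟨j, fun v ↦ rfl⟩
  | coface i ε =>
    rcases eq_or_ne j i with rfl | h
    · exact Or.inl ⟨ε, fun v ↦ by simp⟩
    · obtain ⟨k, rfl⟩ := Fin.exists_succAbove_eq h
      exact Or.inr ⟨k, fun v ↦ by simp⟩
  | comp _ _ ihf ihg =>
    rcases ihg j with ⟨ε, h⟩ | ⟨i, h⟩
    · exact Or.inl ⟨ε, fun v ↦ h _⟩
    · rcases ihf i with ⟨ε, h'⟩ | ⟨k, h'⟩
      · exact Or.inl ⟨ε, fun v ↦ (h _).trans (h' v)⟩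
      · exact Or.inr ⟨k, fun v ↦ (h _).trans (h' v)⟩

/-- A vertex of the cube, as a point of `ℝⁿ`. -/
def realVertex {n : ℕ} (v : Fin n → Bool) : Fin n → ℝ := fun i ↦ if v i then 1 else 0

open Classical in
/-- The extension of a box map to real coordinates: constant coordinates stay constant and
coordinates of the source stay coordinates of the source. -/
noncomputable def realMap {m n : ℕ} (f : (Fin m → Bool) → (Fin n → Bool)) (x : Fin m → ℝ) :
    Fin n → ℝ := fun j ↦
  if h : ∃ i, ∀ v, f v j = v i then x h.choose else realVertex (f fun _ ↦ false) j

theorem realMap_of_proj {m n : ℕ} {f : (Fin m → Bool) → (Fin n → Bool)} {j : Fin n} {i : Fin m}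
    (h : ∀ v, f v j = v i) (x : Fin m → ℝ) : realMap f x j = x i := by
  have h' : ∃ i, ∀ v, f v j = v i := ⟨i, h⟩
  have h2 := h'.choose_spec
  have : h'.choose = i := by
    by_contra hne
    have e := (h2 fun k ↦ decide (k = i)).symm.trans (h fun k ↦ decide (k = i))
    simp [hne] at e
  rw [realMap, dif_pos h', this]

theorem realMap_of_const {m n : ℕ} {f : (Fin m → Bool) → (Fin n → Bool)} {j : Fin n} {ε : Bool}
    (h : ∀ v, f v j = ε) (x : Fin m → ℝ) : realMap f x j = if ε then 1 else 0 := by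
  have h' : ¬ ∃ i, ∀ v, f v j = v i := by
    rintro ⟨i, hi⟩
    have e := (hi fun _ ↦ !ε).symm.trans (h _)
    simp at e
  rw [realMap, dif_neg h', realVertex, h]

theorem realMap_id {n : ℕ} (x : Fin n → ℝ) : realMap (fun v : Fin n → Bool ↦ v) x = x :=
  funext fun j ↦ realMap_of_proj (i := j) (fun _ ↦ rfl) x

theorem realMap_comp {l m n : ℕ} {f : (Fin l → Bool) → (Fin m → Bool)}
    {g : (Fin m → Bool) → (Fin n → Bool)} (hf : IsBoxMap f) (hg : IsBoxMap g) (x : Fin l → ℝ) :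
    realMap (fun v ↦ g (f v)) x = realMap g (realMap f x) := by
  funext j
  rcases hg.coord j with ⟨ε, h⟩ | ⟨i, h⟩
  · rw [realMap_of_const h, realMap_of_const (fun v ↦ h (f v))]
  · rw [realMap_of_proj h]
    rcases hf.coord i with ⟨ε, h'⟩ | ⟨k, h'⟩
    · rw [realMap_of_const h', realMap_of_const (fun v ↦ (h (f v)).trans (h' v))]
    · rw [realMap_of_proj h', realMap_of_proj (fun v ↦ (h (f v)).trans (h' v))]

/-- On real coordinates the coface maps are again insertions of a coordinate. -/
theorem realMap_coface {n : ℕ} (i : Fin (n + 1)) (ε : Bool) (x : Fin n → ℝ) :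
    realMap (fun v : Fin n → Bool ↦ (i.insertNth ε v : Fin (n + 1) → Bool)) x =
      i.insertNth (if ε then (1 : ℝ) else 0) x := by
  funext j
  rcases eq_or_ne j i with rfl | h
  · rw [realMap_of_const (ε := ε) (fun v ↦ by simp)]
    simp
  · obtain ⟨k, rfl⟩ := Fin.exists_succAbove_eq h
    rw [realMap_of_proj (i := k) (fun v ↦ by simp)]
    simp

theorem realMap_realVertex {m n : ℕ} {f : (Fin m → Bool) → (Fin n → Bool)} (hf : IsBoxMap f)
    (v : Fin m → Bool) : realMap f (realVertex v) = realVertex (f v) := by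
  funext j
  rcases hf.coord j with ⟨ε, h⟩ | ⟨i, h⟩
  · rw [realMap_of_const h, realVertex, h]
  · rw [realMap_of_proj h, realVertex, realVertex, h]

theorem continuous_realMap {m n : ℕ} {f : (Fin m → Bool) → (Fin n → Bool)} (hf : IsBoxMap f) :
    Continuous (realMap f) := by
  refine continuous_pi fun j ↦ ?_
  rcases hf.coord j with ⟨ε, h⟩ | ⟨i, h⟩
  · simp only [realMap_of_const h]
    exact continuous_const
  · simp only [realMap_of_proj h]
    exact continuous_apply i

theorem monotone_realMap {m n : ℕ} {f : (Fin m → Bool) → (Fin n → Bool)} (hf : IsBoxMap f) :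
    Monotone (realMap f) := by
  intro x y hxy j
  rcases hf.coord j with ⟨ε, h⟩ | ⟨i, h⟩
  · rw [realMap_of_const h, realMap_of_const h]
  · rw [realMap_of_proj h, realMap_of_proj h]
    exact hxy i

theorem realMap_mem_Icc {m n : ℕ} {f : (Fin m → Bool) → (Fin n → Bool)} (hf : IsBoxMap f)
    {x : Fin m → ℝ} (hx : x ∈ Set.Icc 0 1) : realMap f x ∈ Set.Icc 0 1 := by
  have : ∀ j, 0 ≤ realMap f x j ∧ realMap f x j ≤ 1 := by
    intro j
    rcases hf.coord j with ⟨ε, h⟩ | ⟨i, h⟩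
    · rw [realMap_of_const h]
      cases ε <;> simp
    · rw [realMap_of_proj h]
      exact ⟨hx.1 i, hx.2 i⟩
  exact ⟨fun j ↦ (this j).1, fun j ↦ (this j).2⟩

/-- A box map changes the sum of the coordinates by a constant. -/
theorem sum_realMap {m n : ℕ} {f : (Fin m → Bool) → (Fin n → Bool)} (hf : IsBoxMap f)
    (x y : Fin m → ℝ) :
    ∑ j, realMap f x j - ∑ j, realMap f y j = ∑ i, x i - ∑ i, y i := by
  induction hf with
  | id n => simp only [realMap_id]
  | coface i ε =>
    simp only [realMap_coface, Fin.sum_univ_succAbove _ i, Fin.insertNth_apply_same,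
      Fin.insertNth_apply_succAbove]
    ring
  | comp hf hg ihf ihg =>
    simp only [realMap_comp hf hg]
    rw [ihg, ihf]

/-- The category of precubical sets: presheaves on the box category. -/
abbrev PrecubicalSet := Boxᵒᵖ ⥤ Type

/-! ### Natural paths in cubes -/

/-- The tame natural `d`-paths of length `ℓ` from the vertex `α` to the vertex `β` of the
topological cube `[0,1]ⁿ`, with the compact-open topology. The coordinates are nondecreasing and
their sum increases with speed one. -/
def NatPath (n : ℕ) (α β : Fin n → Bool) (ℓ : ℕ) : Set C(Set.Icc (0 : ℝ) ℓ, Fin n → ℝ) :=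
  {γ | 0 < ℓ ∧ (∀ t, γ t ∈ Set.Icc 0 1) ∧ Monotone γ ∧
    γ ⟨0, le_rfl, Nat.cast_nonneg ℓ⟩ = realVertex α ∧
    γ ⟨ℓ, Nat.cast_nonneg ℓ, le_rfl⟩ = realVertex β ∧
    ∀ t, ∑ i, γ t i = ∑ i, realVertex α i + t}

theorem convex_natPath (n : ℕ) (α β : Fin n → Bool) (ℓ : ℕ) : Convex ℝ (NatPath n α β ℓ) := by
  rintro γ ⟨h0, h1, h2, h3, h4, h5⟩ γ' ⟨-, h1', h2', h3', h4', h5'⟩ a b ha hb hab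
  refine ⟨h0, fun t ↦ ?_, fun s t hst ↦ ?_, ?_, ?_, fun t ↦ ?_⟩
  · exact convex_Icc 0 1 (h1 t) (h1' t) ha hb hab
  · exact add_le_add (smul_le_smul_of_nonneg_left (h2 hst) ha)
      (smul_le_smul_of_nonneg_left (h2' hst) hb)
  · simp only [ContinuousMap.add_apply, ContinuousMap.smul_apply, h3, h3']
    rw [← add_smul, hab, one_smul]
  · simp only [ContinuousMap.add_apply, ContinuousMap.smul_apply, h4, h4']
    rw [← add_smul, hab, one_smul]
  · simp only [ContinuousMap.add_apply, ContinuousMap.smul_apply, Pi.add_apply, Pi.smul_apply,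
      smul_eq_mul, Finset.sum_add_distrib, ← Finset.mul_sum, h5, h5']
    rw [← add_mul, hab, one_mul]

instance (n : ℕ) (α β : Fin n → Bool) (ℓ : ℕ) : DeltaGeneratedSpace (NatPath n α β ℓ) :=
  deltaGeneratedSpace_of_convex (convex_natPath n α β ℓ)

namespace NatPath

theorem ext {n : ℕ} {α β : Fin n → Bool} {ℓ : ℕ} {γ γ' : NatPath n α β ℓ}
    (h : ∀ t, γ.1 t = γ'.1 t) : γ = γ' := Subtype.ext (ContinuousMap.ext h)

/-- The image of a natural path under a box map. -/
noncomputable def push {m n : ℕ} {f : (Fin m → Bool) → (Fin n → Bool)} (hf : IsBoxMap f)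
    {α β : Fin m → Bool} {α' β' : Fin n → Bool} {ℓ : ℕ} (hα : f α = α') (hβ : f β = β')
    (γ : NatPath m α β ℓ) : NatPath n α' β' ℓ :=
  ⟨⟨fun t ↦ realMap f (γ.1 t), (continuous_realMap hf).comp γ.1.continuous⟩, γ.2.1,
    fun t ↦ realMap_mem_Icc hf (γ.2.2.1 t), fun s t hst ↦ monotone_realMap hf (γ.2.2.2.1 hst),
    by simp only [ContinuousMap.coe_mk, γ.2.2.2.2.1, realMap_realVertex hf, hα],
    by simp only [ContinuousMap.coe_mk, γ.2.2.2.2.2.1, realMap_realVertex hf, hβ],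
    fun t ↦ by
      have h := sum_realMap hf (γ.1 t) (realVertex α)
      rw [γ.2.2.2.2.2.2 t, realMap_realVertex hf, hα] at h
      simp only [ContinuousMap.coe_mk]
      linarith⟩

theorem continuous_push {m n : ℕ} {f : (Fin m → Bool) → (Fin n → Bool)} (hf : IsBoxMap f)
    {α β : Fin m → Bool} {α' β' : Fin n → Bool} {ℓ : ℕ} (hα : f α = α') (hβ : f β = β') :
    Continuous (push hf hα hβ : NatPath m α β ℓ → NatPath n α' β' ℓ) :=
  Continuous.subtype_mk ((ContinuousMap.continuous_postcomp
    (⟨realMap f, continuous_realMap hf⟩ : C(Fin m → ℝ, Fin n → ℝ))).comp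
      continuous_subtype_val) _

/-- The Moore composition of two paths, as a function of a real parameter. -/
noncomputable def mooreFun {n ℓ₁ ℓ₂ : ℕ} (γ₁ : C(Set.Icc (0 : ℝ) ℓ₁, Fin n → ℝ))
    (γ₂ : C(Set.Icc (0 : ℝ) ℓ₂, Fin n → ℝ)) (t : ℝ) : Fin n → ℝ :=
  if t ≤ ℓ₁ then γ₁ (Set.projIcc (0 : ℝ) ℓ₁ (Nat.cast_nonneg ℓ₁) t)
  else γ₂ (Set.projIcc (0 : ℝ) ℓ₂ (Nat.cast_nonneg ℓ₂) (t - ℓ₁))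

theorem continuous_mooreFun {A : Type*} [TopologicalSpace A] {n ℓ₁ ℓ₂ : ℕ} {α β β' δ : Fin n → Bool}
    (hβ : β = β') {γ₁ : A → NatPath n α β ℓ₁} {γ₂ : A → NatPath n β' δ ℓ₂} {t : A → ℝ}
    (h₁ : Continuous γ₁) (h₂ : Continuous γ₂) (ht : Continuous t) :
    Continuous (fun a ↦ mooreFun (γ₁ a).1 (γ₂ a).1 (t a)) := by
  subst hβ
  unfold mooreFun
  refine Continuous.if_le (by fun_prop) (by fun_prop) ht continuous_const ?_
  intro a ha
  rw [ha, sub_self, Set.projIcc_right, Set.projIcc_left]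
  exact (γ₁ a).2.2.2.2.2.1.trans (γ₂ a).2.2.2.2.1.symm

theorem mooreFun_of_le {n ℓ₁ ℓ₂ : ℕ} (γ₁ : C(Set.Icc (0 : ℝ) ℓ₁, Fin n → ℝ))
    (γ₂ : C(Set.Icc (0 : ℝ) ℓ₂, Fin n → ℝ)) {t : ℝ} (h : t ≤ ℓ₁) :
    mooreFun γ₁ γ₂ t = γ₁ (Set.projIcc (0 : ℝ) ℓ₁ (Nat.cast_nonneg ℓ₁) t) := if_pos h

theorem mooreFun_of_lt {n ℓ₁ ℓ₂ : ℕ} (γ₁ : C(Set.Icc (0 : ℝ) ℓ₁, Fin n → ℝ))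
    (γ₂ : C(Set.Icc (0 : ℝ) ℓ₂, Fin n → ℝ)) {t : ℝ} (h : ℓ₁ < t) :
    mooreFun γ₁ γ₂ t = γ₂ (Set.projIcc (0 : ℝ) ℓ₂ (Nat.cast_nonneg ℓ₂) (t - ℓ₁)) := if_neg h.not_ge

/-- The Moore composition of natural paths. -/
noncomputable def moore {n : ℕ} {α β β' δ : Fin n → Bool} {ℓ₁ ℓ₂ ℓ : ℕ} (hβ : β = β')
    (hℓ : ℓ₁ + ℓ₂ = ℓ)
    (γ₁ : NatPath n α β ℓ₁) (γ₂ : NatPath n β' δ ℓ₂) : NatPath n α δ ℓ :=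
  ⟨⟨fun t ↦ mooreFun γ₁.1 γ₂.1 t, continuous_mooreFun (A := Set.Icc (0 : ℝ) ℓ) hβ
      (γ₁ := fun _ ↦ γ₁) (γ₂ := fun _ ↦ γ₂) continuous_const continuous_const
      continuous_subtype_val⟩, by
    subst hβ hℓ
    have hp₁ : (0 : ℝ) < ℓ₁ := Nat.cast_pos.2 γ₁.2.1
    have hp₂ : (0 : ℝ) < ℓ₂ := Nat.cast_pos.2 γ₂.2.1
    have hend := γ₁.2.2.2.2.2.1
    have hsum : ∑ i, realVertex β i = ∑ i, realVertex α i + ℓ₁ := by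
      have := γ₁.2.2.2.2.2.2 ⟨ℓ₁, Nat.cast_nonneg ℓ₁, le_rfl⟩
      rwa [hend] at this
    refine ⟨Nat.add_pos_left γ₁.2.1 _, fun t ↦ ?_, fun s t hst ↦ ?_, ?_, ?_, fun t ↦ ?_⟩
    · simp only [ContinuousMap.coe_mk, mooreFun]
      split_ifs
      · exact γ₁.2.2.1 _
      · exact γ₂.2.2.1 _
    · have hst' : (s : ℝ) ≤ t := hst
      simp only [ContinuousMap.coe_mk]
      rcases le_or_gt (t : ℝ) ℓ₁ with h | h
      · rw [mooreFun_of_le _ _ h, mooreFun_of_le _ _ (hst'.trans h)]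
        exact γ₁.2.2.2.1 (Set.monotone_projIcc _ hst')
      · rw [mooreFun_of_lt _ _ h]
        rcases le_or_gt (s : ℝ) ℓ₁ with h' | h'
        · rw [mooreFun_of_le _ _ h']
          have e₁ : Set.projIcc (0 : ℝ) ℓ₁ (Nat.cast_nonneg ℓ₁) s ≤
              ⟨ℓ₁, Nat.cast_nonneg ℓ₁, le_rfl⟩ :=
            (Set.projIcc (0 : ℝ) ℓ₁ (Nat.cast_nonneg ℓ₁) s).2.2
          have e₂ : (⟨0, le_rfl, Nat.cast_nonneg ℓ₂⟩ : Set.Icc (0 : ℝ) ℓ₂) ≤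
              Set.projIcc (0 : ℝ) ℓ₂ (Nat.cast_nonneg ℓ₂) (t - ℓ₁) :=
            (Set.projIcc (0 : ℝ) ℓ₂ (Nat.cast_nonneg ℓ₂) (t - ℓ₁)).2.1
          refine (γ₁.2.2.2.1 e₁).trans ?_
          rw [hend, ← γ₂.2.2.2.2.1]
          exact γ₂.2.2.2.1 e₂
        · rw [mooreFun_of_lt _ _ h']
          exact γ₂.2.2.2.1 (Set.monotone_projIcc _ (by linarith))
    · simp only [ContinuousMap.coe_mk]
      rw [mooreFun_of_le _ _ hp₁.le, Set.projIcc_left]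
      exact γ₁.2.2.2.2.1
    · simp only [ContinuousMap.coe_mk]
      rw [mooreFun_of_lt _ _ (by push_cast; linarith)]
      have : ((ℓ₁ + ℓ₂ : ℕ) : ℝ) - ℓ₁ = ℓ₂ := by push_cast; ring
      rw [this, Set.projIcc_right]
      exact γ₂.2.2.2.2.2.1
    · simp only [ContinuousMap.coe_mk]
      have ht := t.2
      push_cast at ht
      rcases le_or_gt (t : ℝ) ℓ₁ with h | h
      · rw [mooreFun_of_le _ _ h, Set.projIcc_of_mem _ ⟨ht.1, h⟩]
        exact γ₁.2.2.2.2.2.2 _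
      · rw [mooreFun_of_lt _ _ h, Set.projIcc_of_mem _
          (⟨by linarith, by linarith [ht.2]⟩ : (t : ℝ) - ℓ₁ ∈ Set.Icc (0 : ℝ) ℓ₂)]
        rw [γ₂.2.2.2.2.2.2, hsum]
        ring⟩

theorem moore_apply {n : ℕ} {α β β' δ : Fin n → Bool} {ℓ₁ ℓ₂ ℓ : ℕ} (hβ : β = β')
    (hℓ : ℓ₁ + ℓ₂ = ℓ)
    (γ₁ : NatPath n α β ℓ₁) (γ₂ : NatPath n β' δ ℓ₂) (t : Set.Icc (0 : ℝ) ℓ) :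
    (moore hβ hℓ γ₁ γ₂).1 t = mooreFun γ₁.1 γ₂.1 t := rfl

theorem continuous_moore {n : ℕ} {α β β' δ : Fin n → Bool} {ℓ₁ ℓ₂ ℓ : ℕ} (hβ : β = β')
    (hℓ : ℓ₁ + ℓ₂ = ℓ) :
    Continuous (fun p : NatPath n α β ℓ₁ × NatPath n β' δ ℓ₂ ↦ moore hβ hℓ p.1 p.2) := by
  refine Continuous.subtype_mk ?_ _
  refine ContinuousMap.continuous_of_continuous_uncurry _ ?_
  exact continuous_mooreFun (A := (NatPath n α β ℓ₁ × NatPath n β' δ ℓ₂) × Set.Icc (0 : ℝ) ℓ)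
    hβ (γ₁ := fun a ↦ a.1.1) (γ₂ := fun a ↦ a.1.2) (by fun_prop) (by fun_prop) (by fun_prop)

theorem moore_projIcc {n : ℕ} {α β β' δ : Fin n → Bool} {ℓ₁ ℓ₂ ℓ : ℕ} (hβ : β = β')
    (hℓ : ℓ₁ + ℓ₂ = ℓ) (γ₁ : NatPath n α β ℓ₁) (γ₂ : NatPath n β' δ ℓ₂) {t : ℝ} (h0 : 0 ≤ t)
    (h1 : t ≤ ℓ) :
    (moore hβ hℓ γ₁ γ₂).1 (Set.projIcc (0 : ℝ) ℓ (Nat.cast_nonneg ℓ) t) =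
      mooreFun γ₁.1 γ₂.1 t := by
  rw [Set.projIcc_of_mem _ ⟨h0, h1⟩]
  rfl

theorem mooreFun_assoc {n : ℕ} {α₁ β₁ α₂ β₂ α₃ β₃ : Fin n → Bool} {ℓ₁ ℓ₂ ℓ₃ ℓ₁₂ ℓ₂₃ : ℕ}
    (h₁₂ : β₁ = α₂) (h₂₃ : β₂ = α₃) (hℓ₁₂ : ℓ₁ + ℓ₂ = ℓ₁₂) (hℓ₂₃ : ℓ₂ + ℓ₃ = ℓ₂₃)
    (γ₁ : NatPath n α₁ β₁ ℓ₁) (γ₂ : NatPath n α₂ β₂ ℓ₂) (γ₃ : NatPath n α₃ β₃ ℓ₃)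
    {t : ℝ} (h0 : 0 ≤ t) (h1 : t ≤ ℓ₁ + ℓ₂ + ℓ₃) :
    mooreFun (moore h₁₂ hℓ₁₂ γ₁ γ₂).1 γ₃.1 t = mooreFun γ₁.1 (moore h₂₃ hℓ₂₃ γ₂ γ₃).1 t := by
  have e₁₂ : (ℓ₁₂ : ℝ) = ℓ₁ + ℓ₂ := by rw [← hℓ₁₂]; push_cast; ring
  have e₂₃ : (ℓ₂₃ : ℝ) = ℓ₂ + ℓ₃ := by rw [← hℓ₂₃]; push_cast; ring
  have hp₂ : (0 : ℝ) ≤ ℓ₂ := Nat.cast_nonneg ℓ₂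
  rcases le_or_gt t ℓ₁ with h | h
  · rw [mooreFun_of_le _ _ (by linarith), moore_projIcc _ _ _ _ h0 (by linarith),
      mooreFun_of_le _ _ h, mooreFun_of_le _ _ h]
  · rw [mooreFun_of_lt _ (moore h₂₃ hℓ₂₃ γ₂ γ₃).1 h,
      moore_projIcc _ _ _ _ (by linarith) (by linarith)]
    rcases le_or_gt t ℓ₁₂ with h' | h'
    · rw [mooreFun_of_le _ _ h', moore_projIcc _ _ _ _ h0 (by linarith), mooreFun_of_lt _ _ h,
        mooreFun_of_le _ _ (by linarith)]
    · rw [mooreFun_of_lt _ _ h', mooreFun_of_lt _ _ (by linarith), e₁₂, sub_sub]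

end NatPath

/-- A map from a Euclidean space to the pairs of points of two disjoint unions satisfying a
condition on indices takes its values in one pair of components. -/
theorem exists_lift_sigma_pair {k : ℕ} {I : Type} {X : I → Type} [∀ i, TopologicalSpace (X i)]
    (R : I → I → Prop)
    (f : C(Fin k → ℝ, {p : (Σ i, X i) × (Σ i, X i) // R p.1.1 p.2.1})) :
    ∃ (i j : I) (h : R i j) (f₁ : C(Fin k → ℝ, X i)) (f₂ : C(Fin k → ℝ, X j)),
      ∀ t, f t = ⟨(⟨i, f₁ t⟩, ⟨j, f₂ t⟩), h⟩ := by
  obtain ⟨i, f₁, hf₁⟩ := (⟨fun t ↦ (f t).1.1, by fun_prop⟩ :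
    C(Fin k → ℝ, Σ i, X i)).exists_lift_sigma
  obtain ⟨j, f₂, hf₂⟩ := (⟨fun t ↦ (f t).1.2, by fun_prop⟩ :
    C(Fin k → ℝ, Σ i, X i)).exists_lift_sigma
  have h₁ : ∀ t, (f t).1.1 = ⟨i, f₁ t⟩ := fun t ↦ congrArg (fun g ↦ g t) hf₁
  have h₂ : ∀ t, (f t).1.2 = ⟨j, f₂ t⟩ := fun t ↦ congrArg (fun g ↦ g t) hf₂
  have h : R i j := by
    have := (f 0).2
    rw [h₁, h₂] at this
    exact this
  exact ⟨i, j, h, f₁, f₂, fun t ↦ Subtype.ext (Prod.ext (h₁ t) (h₂ t))⟩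

/-! ### The natural realization -/

/-- The execution paths of the natural `n`-cube: the disjoint union of the spaces of natural
`d`-paths between two vertices. The space of paths from `α` to `β` of length `ℓ` is empty unless
`α < β` and `ℓ` is the number `m` of coordinates in which `α` and `β` differ, and in this case it is
the copy of the space `N_m` in the `m`-dimensional subcube from `α` to `β`. -/
abbrev CubePath (n : ℕ) := Σ p : ((Fin n → Bool) × (Fin n → Bool)) × ℕ, NatPath n p.1.1 p.1.2 p.2

namespace CubePath

theorem ext {n : ℕ} {x y : CubePath n} (h₁ : x.1 = y.1)
    (h₂ : ∀ (t : ℝ) (ht : t ∈ Set.Icc (0 : ℝ) x.1.2) (ht' : t ∈ Set.Icc (0 : ℝ) y.1.2),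
      x.2.1 ⟨t, ht⟩ = y.2.1 ⟨t, ht'⟩) : x = y := by
  obtain ⟨p, γ⟩ := x
  obtain ⟨q, γ'⟩ := y
  obtain rfl : p = q := h₁
  congr 1
  exact NatPath.ext fun t ↦ h₂ t.1 t.2 t.2

/-- Moore composition of execution paths. -/
noncomputable def comp {n : ℕ} (x y : CubePath n) (h : x.1.1.2 = y.1.1.1) : CubePath n :=
  ⟨((x.1.1.1, y.1.1.2), x.1.2 + y.1.2), NatPath.moore h rfl x.2 y.2⟩

theorem comp_cont {n : ℕ} : DeltaContinuous
    (fun p : {p : CubePath n × CubePath n // p.1.1.1.2 = p.2.1.1.1} ↦ comp p.1.1 p.1.2 p.2) := by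
  intro k f
  obtain ⟨i, j, h, f₁, f₂, hf⟩ := exists_lift_sigma_pair (X := fun
    p : ((Fin n → Bool) × (Fin n → Bool)) × ℕ ↦ NatPath n p.1.1 p.1.2 p.2)
    (fun p q ↦ p.1.2 = q.1.1) f
  have e : (fun p : {p : CubePath n × CubePath n // p.1.1.1.2 = p.2.1.1.1} ↦
      comp p.1.1 p.1.2 p.2) ∘ f = fun t ↦ (⟨((i.1.1, j.1.2), i.2 + j.2),
        NatPath.moore h rfl (f₁ t) (f₂ t)⟩ : CubePath n) := by
    funext t
    simp only [Function.comp_apply, hf t]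
    rfl
  rw [e]
  have h₁ : Continuous (fun t ↦ NatPath.moore h rfl (f₁ t) (f₂ t)) :=
    (NatPath.continuous_moore h rfl).comp (f₁.continuous.prodMk f₂.continuous)
  exact (continuous_sigmaMk (σ := fun p : ((Fin n → Bool) × (Fin n → Bool)) × ℕ ↦
    NatPath n p.1.1 p.1.2 p.2) (i := ((i.1.1, j.1.2), i.2 + j.2))).comp h₁

theorem isLocallyConstant_fst {I : Type} {X : I → Type} [∀ i, TopologicalSpace (X i)] :
    IsLocallyConstant (fun x : Σ i, X i ↦ x.1) := by
  intro s
  rw [isOpen_sigma_iff]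
  intro i
  by_cases h : i ∈ s
  · convert isOpen_univ
    ext x
    simp [h]
  · convert isOpen_empty
    ext x
    simp [h]

/-- The image of an execution path under a box map. -/
noncomputable def map {m n : ℕ} {f : (Fin m → Bool) → (Fin n → Bool)} (hf : IsBoxMap f)
    (x : CubePath m) : CubePath n :=
  ⟨((f x.1.1.1, f x.1.1.2), x.1.2), NatPath.push hf rfl rfl x.2⟩

theorem continuous_map {m n : ℕ} {f : (Fin m → Bool) → (Fin n → Bool)} (hf : IsBoxMap f) :
    Continuous (map hf) := by
  rw [continuous_sigma_iff]
  intro i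
  exact (continuous_sigmaMk (σ := fun p : ((Fin n → Bool) × (Fin n → Bool)) × ℕ ↦
    NatPath n p.1.1 p.1.2 p.2) (i := ((f i.1.1, f i.1.2), i.2))).comp
      (NatPath.continuous_push hf rfl rfl)

theorem map_comp {m n : ℕ} {f : (Fin m → Bool) → (Fin n → Bool)} (hf : IsBoxMap f)
    (x y : CubePath m) (h : x.1.1.2 = y.1.1.1) :
    map hf (comp x y h) = comp (map hf x) (map hf y) (congrArg f h) := by
  refine ext rfl fun t ht ht' ↦ ?_
  change realMap f (NatPath.mooreFun x.2.1 y.2.1 t) = NatPath.mooreFun _ _ t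
  rcases le_or_gt t (x.1.2 : ℝ) with h' | h'
  · rw [NatPath.mooreFun_of_le _ _ h', NatPath.mooreFun_of_le _ _ (show t ≤ ((map hf x).1.2 : ℝ) from h')]
    rfl
  · rw [NatPath.mooreFun_of_lt _ _ h', NatPath.mooreFun_of_lt _ _ (show ((map hf x).1.2 : ℝ) < t from h')]
    rfl

end CubePath

/-- The natural `n`-cube. -/
noncomputable def natCubeFlow (c : SpaceKind) (n : ℕ) : Flow c where
  State := Fin n → Bool
  Path := Space.of (CubePath n) (isSpace_sigma fun _ ↦ isSpace_of_t2 c)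
  src x := x.1.1.1
  tgt x := x.1.1.2
  src_loc := (CubePath.isLocallyConstant_fst (X := fun
    p : ((Fin n → Bool) × (Fin n → Bool)) × ℕ ↦ NatPath n p.1.1 p.1.2 p.2)).comp (fun p ↦ p.1.1)
  tgt_loc := (CubePath.isLocallyConstant_fst (X := fun
    p : ((Fin n → Bool) × (Fin n → Bool)) × ℕ ↦ NatPath n p.1.1 p.1.2 p.2)).comp (fun p ↦ p.1.2)
  comp x y h := CubePath.comp x y h
  comp_cont := CubePath.comp_cont
  src_comp _ _ _ := rfl
  tgt_comp _ _ _ := rfl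
  assoc x y z hxy hyz := by
    refine CubePath.ext (Prod.ext rfl (Nat.add_assoc _ _ _)) fun t ht ht' ↦ ?_
    refine NatPath.mooreFun_assoc hxy hyz rfl rfl x.2 y.2 z.2 ht.1 ?_
    have := ht.2
    simp only [CubePath.comp] at this
    push_cast at this
    exact this

/-- The cocubical flow of natural cubes. -/
noncomputable def natCube (c : SpaceKind) : Box ⥤ Flow c where
  obj X := natCubeFlow c X.dim
  map f :=
    { state := Box.app f
      path := CubePath.map (Box.app_isBoxMap f)
      path_cont := CubePath.continuous_map _
      src_path := fun _ ↦ rfl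
      tgt_path := fun _ ↦ rfl
      path_comp := CubePath.map_comp _ }
  map_id X := Flow.hom_ext (fun _ ↦ rfl) fun x ↦
    CubePath.ext rfl fun t ht ht' ↦ realMap_id _
  map_comp f g := Flow.hom_ext (fun _ ↦ rfl) fun x ↦
    CubePath.ext rfl fun t ht ht' ↦ realMap_comp (Box.app_isBoxMap f) (Box.app_isBoxMap g) _

/-- The natural realization functor: its value at a precubical set `K` is the colimit of the flows
`natCube c [n]` over the category of the maps `□[n] ⟶ K`. -/
noncomputable def naturalRealization (c : SpaceKind) : PrecubicalSet ⥤ Flow c :=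
  (yoneda (C := Box)).pointwiseLeftKanExtension (natCube c)

/-! ### Cube chains -/

/-- A map that keeps the coordinates of the source in order and adds constant coordinates is a
composite of coface maps. -/
theorem isBoxMap_of_orderEmbedding {n : ℕ} : ∀ {m : ℕ} (f : (Fin m → Bool) → (Fin n → Bool))
    (e : Fin m ↪o Fin n) (ε : Fin n → Bool) (_ : ∀ v i, f v (e i) = v i)
    (_ : ∀ v j, j ∉ Set.range e → f v j = ε j), IsBoxMap f := by
  induction n with
  | zero =>
    intro m f e ε h₁ h₂
    have hm : m = 0 := by
      have := Fintype.card_le_of_embedding e.toEmbedding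
      simpa using this
    subst hm
    have : f = fun v ↦ v := by
      funext v j
      exact j.elim0
    rw [this]
    exact .id 0
  | succ n ih =>
    intro m f e ε h₁ h₂
    by_cases hsurj : ∀ j, j ∈ Set.range e
    · have hm : m = n + 1 := by
        have := Fintype.card_of_bijective (f := e) ⟨e.injective, hsurj⟩
        simpa using this
      subst hm
      have he : ∀ j, e j = j := fun j ↦ congrArg (fun r ↦ r j)
        (Subsingleton.elim (RelIso.ofSurjective e hsurj) (OrderIso.refl _))
      have : f = fun v ↦ v := by
        funext v j
        have := h₁ v j
        rwa [he j] at this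
      rw [this]
      exact .id _
    · push Not at hsurj
      obtain ⟨j, hj⟩ := hsurj
      have hex : ∀ i, ∃ k, j.succAbove k = e i := fun i ↦
        Fin.exists_succAbove_eq (fun h ↦ hj ⟨i, h⟩)
      choose e' he' using hex
      have hmono : StrictMono e' := by
        intro a b hab
        rw [← (Fin.strictMono_succAbove j).lt_iff_lt, he', he']
        exact e.strictMono hab
      have hg := ih (fun v k ↦ f v (j.succAbove k)) (OrderEmbedding.ofStrictMono e' hmono)
        (fun k ↦ ε (j.succAbove k)) (fun v i ↦ by
          simp only [OrderEmbedding.coe_ofStrictMono, he', h₁]) (fun v k hk ↦ h₂ v _ (by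
          rintro ⟨i, hi⟩
          apply hk
          refine ⟨i, ?_⟩
          rw [← he'] at hi
          exact Fin.succAbove_right_injective hi))
      have hf : f = fun v ↦ (j.insertNth (ε j) (fun k ↦ f v (j.succAbove k)) :
          Fin (n + 1) → Bool) := by
        funext v k
        rcases eq_or_ne k j with rfl | hk
        · simp [h₂ v k hj]
        · obtain ⟨k', rfl⟩ := Fin.exists_succAbove_eq hk
          simp
      rw [hf]
      exact .comp hg (.coface j (ε j))

/-- The inclusion of a vertex in a cube. -/
def vertexMap (n : ℕ) (v : Fin n → Bool) : (⟨0⟩ : Box) ⟶ ⟨n⟩ :=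
  ⟨fun _ ↦ v, isBoxMap_of_orderEmbedding _
    (OrderEmbedding.ofStrictMono (fun i : Fin 0 ↦ i.elim0) (fun i ↦ i.elim0)) v
    (fun _ i ↦ i.elim0) (fun _ _ _ ↦ rfl)⟩

theorem vertexMap_comp {m n : ℕ} (v : Fin m → Bool) (f : (⟨m⟩ : Box) ⟶ ⟨n⟩) :
    vertexMap m v ≫ f = vertexMap n (Box.app f v) := rfl

/-- The face of the `k`-cube whose coordinates in `A` are free and whose other coordinates are all
equal to `ε`. -/
def faceMap {k : ℕ} (A : Finset (Fin k)) (ε : Bool) : (⟨A.card⟩ : Box) ⟶ ⟨k⟩ :=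
  ⟨fun v j ↦ if h : j ∈ A then v ((A.orderIsoOfFin rfl).symm ⟨j, h⟩) else ε,
    isBoxMap_of_orderEmbedding _ (A.orderEmbOfFin rfl) (fun _ ↦ ε)
      (fun v i ↦ by
        rw [dif_pos (A.orderEmbOfFin_mem rfl i)]
        congr 1
        rw [OrderIso.symm_apply_eq]
        rfl)
      (fun v j hj ↦ by
        rw [Finset.range_orderEmbOfFin] at hj
        exact dif_neg hj)⟩

theorem app_faceMap_const {k : ℕ} (A : Finset (Fin k)) (ε ε' : Bool) :
    Box.app (faceMap A ε) (fun _ ↦ ε') = fun j ↦ if j ∈ A then ε' else ε := by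
  funext j
  change (if h : j ∈ A then ε' else ε) = _
  simp

/-- A precubical set with an initial and a final vertex. -/
structure Bipointed where
  obj : PrecubicalSet
  ini : yoneda.obj (⟨0⟩ : Box) ⟶ obj
  fin : yoneda.obj (⟨0⟩ : Box) ⟶ obj

/-- The precubical set `□[n]` with the vertices `0ₙ` and `1ₙ`. -/
def cube (n : ℕ) : Bipointed where
  obj := yoneda.obj ⟨n⟩
  ini := yoneda.map (vertexMap n fun _ ↦ false)
  fin := yoneda.map (vertexMap n fun _ ↦ true)

/-- `X * Y`: the final vertex of `X` is identified with the initial vertex of `Y`. -/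
noncomputable def glue (X Y : Bipointed) : Bipointed where
  obj := pushout X.fin Y.ini
  ini := X.ini ≫ pushout.inl _ _
  fin := Y.fin ≫ pushout.inr _ _

/-- The precubical set `□[n₁] * ⋯ * □[nₚ]`; the last factor is followed by a point `□[0]`, which
has no effect. -/
noncomputable def wedge : List ℕ → Bipointed
  | [] => ⟨yoneda.obj ⟨0⟩, 𝟙 _, 𝟙 _⟩
  | n :: l => glue (cube n) (wedge l)

/-- The inclusion of the first cube. -/
noncomputable abbrev wedgeInl (n : ℕ) (l : List ℕ) : (cube n).obj ⟶ (wedge (n :: l)).obj :=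
  pushout.inl (cube n).fin (wedge l).ini

/-- The inclusion of the other cubes. -/
noncomputable abbrev wedgeInr (n : ℕ) (l : List ℕ) : (wedge l).obj ⟶ (wedge (n :: l)).obj :=
  pushout.inr (cube n).fin (wedge l).ini

/-- A map out of `□[n₁] * ⋯ * □[nₚ]`, from its values on the first cube and on the other ones. -/
noncomputable abbrev wedgeDesc {n : ℕ} {l : List ℕ} {K : PrecubicalSet} (f : (cube n).obj ⟶ K)
    (g : (wedge l).obj ⟶ K) (h : (cube n).fin ≫ f = (wedge l).ini ≫ g) :
    (wedge (n :: l)).obj ⟶ K :=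
  pushout.desc f g h

theorem wedge_condition (n : ℕ) (l : List ℕ) :
    (cube n).fin ≫ wedgeInl n l = (wedge l).ini ≫ wedgeInr n l := pushout.condition

theorem wedge_ini (n : ℕ) (l : List ℕ) :
    (wedge (n :: l)).ini = (cube n).ini ≫ wedgeInl n l := rfl

theorem wedge_fin (n : ℕ) (l : List ℕ) :
    (wedge (n :: l)).fin = (wedge l).fin ≫ wedgeInr n l := rfl

theorem wedgeInl_desc {n : ℕ} {l : List ℕ} {K : PrecubicalSet} (f : (cube n).obj ⟶ K)
    (g : (wedge l).obj ⟶ K) (h : (cube n).fin ≫ f = (wedge l).ini ≫ g) :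
    wedgeInl n l ≫ wedgeDesc f g h = f := pushout.inl_desc _ _ _

theorem wedgeInr_desc {n : ℕ} {l : List ℕ} {K : PrecubicalSet} (f : (cube n).obj ⟶ K)
    (g : (wedge l).obj ⟶ K) (h : (cube n).fin ≫ f = (wedge l).ini ≫ g) :
    wedgeInr n l ≫ wedgeDesc f g h = g := pushout.inr_desc _ _ _

theorem wedgeInl_desc_assoc {n : ℕ} {l : List ℕ} {K L : PrecubicalSet} (f : (cube n).obj ⟶ K)
    (g : (wedge l).obj ⟶ K) (h : (cube n).fin ≫ f = (wedge l).ini ≫ g) (φ : K ⟶ L) :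
    wedgeInl n l ≫ wedgeDesc f g h ≫ φ = f ≫ φ := by
  rw [← Category.assoc, wedgeInl_desc]

theorem wedgeInr_desc_assoc {n : ℕ} {l : List ℕ} {K L : PrecubicalSet} (f : (cube n).obj ⟶ K)
    (g : (wedge l).obj ⟶ K) (h : (cube n).fin ≫ f = (wedge l).ini ≫ g) (φ : K ⟶ L) :
    wedgeInr n l ≫ wedgeDesc f g h ≫ φ = g ≫ φ := by
  rw [← Category.assoc, wedgeInr_desc]

theorem wedge_hom_ext {n : ℕ} {l : List ℕ} {K : PrecubicalSet} {f g : (wedge (n :: l)).obj ⟶ K}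
    (h₁ : wedgeInl n l ≫ f = wedgeInl n l ≫ g) (h₂ : wedgeInr n l ≫ f = wedgeInr n l ≫ g) :
    f = g := pushout.hom_ext h₁ h₂

/-- The elementary refinements: for a partition `A ⊔ B = {1, …, k}` in two nonempty sets, one entry
`k` of a sequence is replaced by the two entries `card A`, `card B`. -/
inductive Step : List ℕ → List ℕ → Type
  | split {k : ℕ} (A : Finset (Fin k)) (hA : A.Nonempty) (hB : Aᶜ.Nonempty) (l : List ℕ) :
      Step (A.card :: Aᶜ.card :: l) (k :: l)
  | cons (n : ℕ) {l l' : List ℕ} (s : Step l l') : Step (n :: l) (n :: l')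

/-- The inclusion of a face, as a map of precubical sets. -/
def faceHom {k : ℕ} (A : Finset (Fin k)) (ε : Bool) : (cube A.card).obj ⟶ (cube k).obj :=
  yoneda.map (faceMap A ε)

theorem ini_faceHom {k : ℕ} (A : Finset (Fin k)) (ε : Bool) :
    (cube A.card).ini ≫ faceHom A ε =
      yoneda.map (vertexMap k fun j ↦ if j ∈ A then false else ε) := by
  rw [← app_faceMap_const A ε false, ← vertexMap_comp, Functor.map_comp]
  rfl

theorem fin_faceHom {k : ℕ} (A : Finset (Fin k)) (ε : Bool) :
    (cube A.card).fin ≫ faceHom A ε =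
      yoneda.map (vertexMap k fun j ↦ if j ∈ A then true else ε) := by
  rw [← app_faceMap_const A ε true, ← vertexMap_comp, Functor.map_comp]
  rfl

theorem ini_faceHom_false {k : ℕ} (A : Finset (Fin k)) :
    (cube A.card).ini ≫ faceHom A false = (cube k).ini := by
  rw [ini_faceHom]
  simp [cube]

theorem fin_faceHom_true {k : ℕ} (A : Finset (Fin k)) :
    (cube A.card).fin ≫ faceHom A true = (cube k).fin := by
  rw [fin_faceHom]
  simp [cube]

theorem fin_faceHom_false {k : ℕ} (A : Finset (Fin k)) :
    (cube A.card).fin ≫ faceHom A false = (cube Aᶜ.card).ini ≫ faceHom Aᶜ true := by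
  rw [fin_faceHom, ini_faceHom]
  congr 2
  funext j
  by_cases h : j ∈ A <;> simp [h]

theorem split_condition₁ {k : ℕ} (A : Finset (Fin k)) (l : List ℕ) :
    (cube Aᶜ.card).fin ≫ faceHom Aᶜ true ≫ wedgeInl k l =
      (wedge l).ini ≫ wedgeInr k l := by
  rw [← wedge_condition, ← Category.assoc, fin_faceHom_true]

theorem split_condition₂ {k : ℕ} (A : Finset (Fin k)) (l : List ℕ) :
    (cube A.card).fin ≫ faceHom A false ≫ wedgeInl k l =
      (wedge (Aᶜ.card :: l)).ini ≫
        wedgeDesc (faceHom Aᶜ true ≫ wedgeInl k l) (wedgeInr k l)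
          (split_condition₁ A l) := by
  rw [wedge_ini, Category.assoc, wedgeInl_desc, ← Category.assoc, ← Category.assoc,
    fin_faceHom_false]

/-- The map `φ_{A,B} * id : □[card A] * □[card B] * □[l] ⟶ □[k] * □[l]` with `B` the complement of
`A`: the first cube is sent to the face of `□[k]` on which the coordinates in `B` are `0`, the
second one to the face on which the coordinates in `A` are `1`. -/
noncomputable def splitMap {k : ℕ} (A : Finset (Fin k)) (l : List ℕ) :
    (wedge (A.card :: Aᶜ.card :: l)).obj ⟶ (wedge (k :: l)).obj :=
  wedgeDesc (faceHom A false ≫ wedgeInl k l)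
    (wedgeDesc (faceHom Aᶜ true ≫ wedgeInl k l) (wedgeInr k l)
      (split_condition₁ A l))
    (split_condition₂ A l)

/-- The map `id * f : □[n] * □[l] ⟶ □[n] * □[l']`. -/
noncomputable def consMap (n : ℕ) {l l' : List ℕ} (f : (wedge l).obj ⟶ (wedge l').obj)
    (hf : (wedge l).ini ≫ f = (wedge l').ini) :
    (wedge (n :: l)).obj ⟶ (wedge (n :: l')).obj :=
  wedgeDesc (wedgeInl n l') (f ≫ wedgeInr n l') (by
    rw [← Category.assoc, hf, wedge_condition])

/-- The map of precubical sets `δ_{i,A,B} = id * ⋯ * id * φ_{A,B} * id * ⋯ * id`. -/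
noncomputable def stepMapAux : ∀ {l l' : List ℕ}, Step l l' →
    {f : (wedge l).obj ⟶ (wedge l').obj // (wedge l).ini ≫ f = (wedge l').ini}
  | _, _, .split A _ _ l => ⟨splitMap A l, by
      rw [splitMap, wedge_ini, Category.assoc, wedgeInl_desc, wedge_ini, ← Category.assoc,
        ini_faceHom_false]⟩
  | _, _, .cons n s => ⟨consMap n (stepMapAux s).1 (stepMapAux s).2, by
      rw [consMap, wedge_ini, Category.assoc, wedgeInl_desc, wedge_ini]⟩

/-- The map of precubical sets `δ_{i,A,B} = id * ⋯ * id * φ_{A,B} * id * ⋯ * id`. -/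
noncomputable def stepMap {l l' : List ℕ} (s : Step l l') :
    (wedge l).obj ⟶ (wedge l').obj := (stepMapAux s).1

/-- The composites of maps of the form `δ_{i,A,B}`. -/
inductive IsRefinement : ∀ {l l' : List ℕ}, ((wedge l).obj ⟶ (wedge l').obj) → Prop
  | id (l : List ℕ) : IsRefinement (𝟙 (wedge l).obj)
  | step {l l' : List ℕ} (s : Step l l') : IsRefinement (stepMap s)
  | comp {l l' l'' : List ℕ} {f : (wedge l).obj ⟶ (wedge l').obj}
      {g : (wedge l').obj ⟶ (wedge l'').obj} :
      IsRefinement f → IsRefinement g → IsRefinement (f ≫ g)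

/-- The vertices of a precubical set. -/
abbrev vertices (K : PrecubicalSet) : Type := K.obj (op ⟨0⟩)

/-- A cube chain of length `n` from `α` to `β` in `K`: a map `□[n₁] * ⋯ * □[nₚ] ⟶ K` with
`nᵢ > 0` and `n₁ + ⋯ + nₚ = n` which sends the initial vertex to `α` and the final vertex to `β`. -/
structure Chain (K : PrecubicalSet) (α β : vertices K) (n : ℕ) where
  blocks : List ℕ
  pos : ∀ k ∈ blocks, 0 < k
  sum : blocks.sum = n
  map : (wedge blocks).obj ⟶ K
  ini : yonedaEquiv ((wedge blocks).ini ≫ map) = α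
  fin : yonedaEquiv ((wedge blocks).fin ≫ map) = β

namespace Chain

variable {K : PrecubicalSet} {α β : vertices K} {n : ℕ}

/-- A morphism of cube chains. -/
@[ext]
structure Hom (a b : Chain K α β n) where
  map : (wedge a.blocks).obj ⟶ (wedge b.blocks).obj
  isRefinement : IsRefinement map
  w : map ≫ b.map = a.map

/-- The category `Ch_{α,β}(K,n)`. -/
noncomputable instance : SmallCategory (Chain K α β n) where
  Hom := Hom
  id a := ⟨𝟙 _, .id _, Category.id_comp _⟩
  comp f g := ⟨f.map ≫ g.map, .comp f.isRefinement g.isRefinement, by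
    rw [Category.assoc, g.w, f.w]⟩

end Chain

/-! ### The diagram of spaces of a category of cube chains -/

/-- The space `Nₙ` of tame natural `d`-paths of `[0,1]ⁿ` from `0ₙ` to `1ₙ`. -/
def natSpace (c : SpaceKind) (n : ℕ) : Space c :=
  Space.of (NatPath n (fun _ ↦ false) (fun _ ↦ true) n) (isSpace_of_t2 c)

/-- The product `N_{n₁} × ⋯ × N_{nₚ}`. -/
def chainSpace (c : SpaceKind) : List ℕ → Space c
  | [] => Space.of PUnit (isSpace_of_t2 c)
  | n :: l => Space.prod (natSpace c n) (chainSpace c l)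

/-- The copy of `N_{card A}` in the face of the `k`-cube on which the coordinates outside `A` are
`0`. -/
noncomputable def lowerPath {c : SpaceKind} {k : ℕ} (A : Finset (Fin k)) (x : natSpace c A.card) :
    NatPath k (fun _ ↦ false) (fun j ↦ decide (j ∈ A)) A.card :=
  NatPath.push (Box.app_isBoxMap (faceMap A false))
    (by rw [app_faceMap_const]; simp)
    (by rw [app_faceMap_const]; funext j; by_cases h : j ∈ A <;> simp [h]) x

/-- The copy of `N_{card B}`, with `B` the complement of `A`, in the face of the `k`-cube on which
the coordinates in `A` are `1`. -/
noncomputable def upperPath {c : SpaceKind} {k : ℕ} (A : Finset (Fin k))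
    (y : natSpace c Aᶜ.card) : NatPath k (fun j ↦ decide (j ∈ A)) (fun _ ↦ true) Aᶜ.card :=
  NatPath.push (Box.app_isBoxMap (faceMap Aᶜ true))
    (by rw [app_faceMap_const]; funext j; by_cases h : j ∈ A <;> simp [h])
    (by rw [app_faceMap_const]; simp) y

theorem card_add_card_compl' {k : ℕ} (A : Finset (Fin k)) : A.card + Aᶜ.card = k := by
  rw [Finset.card_add_card_compl, Fintype.card_fin]

/-- The map `N_{card A} × N_{card B} → N_k`, with `B` the complement of `A`: the first path is
viewed as a path in the face of the `k`-cube on which the coordinates in `B` are `0`, the second one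
as a path in the face on which the coordinates in `A` are `1`, and they are composed. -/
noncomputable def splitPath {c : SpaceKind} {k : ℕ} (A : Finset (Fin k))
    (x : natSpace c A.card) (y : natSpace c Aᶜ.card) : natSpace c k :=
  NatPath.moore rfl (card_add_card_compl' A) (lowerPath A x) (upperPath A y)

theorem continuous_splitPath {c : SpaceKind} {k : ℕ} (A : Finset (Fin k)) {T : Type}
    [TopologicalSpace T] {f : T → natSpace c A.card} {g : T → natSpace c Aᶜ.card}
    (hf : Continuous f) (hg : Continuous g) : Continuous (fun t ↦ splitPath A (f t) (g t)) := by
  have h₁ : Continuous (fun t ↦ lowerPath A (f t)) := (NatPath.continuous_push _ _ _).comp hf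
  have h₂ : Continuous (fun t ↦ upperPath A (g t)) := (NatPath.continuous_push _ _ _).comp hg
  exact (NatPath.continuous_moore rfl (card_add_card_compl' A)).comp (h₁.prodMk h₂)

/-- The map of products of spaces of natural `d`-paths associated with `δ_{i,A,B}`. -/
noncomputable def stepPath (c : SpaceKind) : ∀ {l l' : List ℕ}, Step l l' →
    (chainSpace c l ⟶ chainSpace c l')
  | _, _, .split A _ _ l => Space.mkHom
      (X := Space.prod (natSpace c A.card) (Space.prod (natSpace c Aᶜ.card) (chainSpace c l)))
      (fun p ↦ Space.pair (splitPath A (Space.fst p) (Space.fst (Space.snd p)))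
        (Space.snd (Space.snd p)))
      (Space.continuous_pair
        (continuous_splitPath A Space.continuous_fst
          (Space.continuous_fst.comp Space.continuous_snd))
        (Space.continuous_snd.comp Space.continuous_snd))
  | _, _, .cons (l := l) n s => Space.mkHom
      (X := Space.prod (natSpace c n) (chainSpace c l))
      (fun p ↦ Space.pair (Space.fst p) (Space.fn (stepPath c s) (Space.snd p)))
      (Space.continuous_pair Space.continuous_fst
        ((Space.continuous_fn (stepPath c s)).comp Space.continuous_snd))

/-- `Induces c f g`: the map `g` of products of spaces of natural `d`-paths is a composite of the
maps associated with elementary refinements whose composite is `f`. -/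
inductive Induces (c : SpaceKind) : ∀ {l l' : List ℕ}, ((wedge l).obj ⟶ (wedge l').obj) →
    (chainSpace c l ⟶ chainSpace c l') → Prop
  | id (l : List ℕ) : Induces c (𝟙 (wedge l).obj) (𝟙 (chainSpace c l))
  | step {l l' : List ℕ} (s : Step l l') : Induces c (stepMap s) (stepPath c s)
  | comp {l l' l'' : List ℕ} {f : (wedge l).obj ⟶ (wedge l').obj}
      {g : (wedge l').obj ⟶ (wedge l'').obj} {f' : chainSpace c l ⟶ chainSpace c l'}
      {g' : chainSpace c l' ⟶ chainSpace c l''} :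
      Induces c f f' → Induces c g g' → Induces c (f ≫ g) (f' ≫ g')

theorem IsRefinement.exists_induces {l l' : List ℕ} {f : (wedge l).obj ⟶ (wedge l').obj}
    (hf : IsRefinement f) (c : SpaceKind) : ∃ g, Induces c f g := by
  induction hf with
  | id l => exact ⟨_, .id l⟩
  | step s => exact ⟨_, .step s⟩
  | comp _ _ ihf ihg =>
    obtain ⟨f', hf'⟩ := ihf
    obtain ⟨g', hg'⟩ := ihg
    exact ⟨_, .comp hf' hg'⟩

/-- The precubical set of real functions on cubes. -/
noncomputable def funSet : PrecubicalSet where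
  obj X := (Fin X.unop.dim → ℝ) → ℝ
  map f := ↾fun h x ↦ h (realMap (Box.app f.unop) x)
  map_id X := by
    ext h x
    exact congrArg h (realMap_id x)
  map_comp f g := by
    ext h x
    exact congrArg h (realMap_comp (Box.app_isBoxMap g.unop) (Box.app_isBoxMap f.unop) x)

/-- The real function on the `n`-cube that corresponds to a map of precubical sets. -/
noncomputable def cubeFun {n : ℕ} (h : (cube n).obj ⟶ funSet) : (Fin n → ℝ) → ℝ :=
  yonedaEquiv (X := (⟨n⟩ : Box)) h

theorem cubeFun_comp {m n : ℕ} (f : (⟨m⟩ : Box) ⟶ ⟨n⟩) (h : (cube n).obj ⟶ funSet) :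
    cubeFun (n := m) (yoneda.map f ≫ h) = fun x ↦ cubeFun h (realMap (Box.app f) x) :=
  (yonedaEquiv_naturality h f).symm

/-- The value of a function on the path in `□[n₁] * ⋯ * □[nₚ]` given by a point of
`N_{n₁} × ⋯ × N_{nₚ}`, at a positive time. -/
noncomputable def evalChain (c : SpaceKind) : ∀ (l : List ℕ),
    chainSpace c l → ((wedge l).obj ⟶ funSet) → ℝ → ℝ
  | [], _, _, _ => 0
  | n :: l, p, h, t =>
    if t ≤ n then cubeFun (wedgeInl n l ≫ h) ((Space.fst (X := natSpace c n) p).1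
      (Set.projIcc (0 : ℝ) n (Nat.cast_nonneg n) t))
    else evalChain c l (Space.snd (X := natSpace c n) p) (wedgeInr n l ≫ h) (t - n)

theorem evalChain_of_le (c : SpaceKind) {n : ℕ} {l : List ℕ} (p : chainSpace c (n :: l))
    (h : (wedge (n :: l)).obj ⟶ funSet) {t : ℝ} (ht : t ≤ n) :
    evalChain c (n :: l) p h t = cubeFun (wedgeInl n l ≫ h) ((Space.fst (X := natSpace c n) p).1
      (Set.projIcc (0 : ℝ) n (Nat.cast_nonneg n) t)) := if_pos ht

theorem evalChain_of_lt (c : SpaceKind) {n : ℕ} {l : List ℕ} (p : chainSpace c (n :: l))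
    (h : (wedge (n :: l)).obj ⟶ funSet) {t : ℝ} (ht : n < t) :
    evalChain c (n :: l) p h t =
      evalChain c l (Space.snd (X := natSpace c n) p) (wedgeInr n l ≫ h) (t - n) :=
  if_neg ht.not_ge

theorem evalChain_step (c : SpaceKind) {l l' : List ℕ} (s : Step l l') :
    ∀ (x : chainSpace c l) (h : (wedge l').obj ⟶ funSet) (t : ℝ), 0 < t →
      evalChain c l' (Space.fn (stepPath c s) x) h t = evalChain c l x (stepMap s ≫ h) t := by
  induction s with
  | @split k A hA hB l =>
    intro x h t ht
    have hk : (A.card : ℝ) + Aᶜ.card = k := by exact_mod_cast card_add_card_compl' A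
    have hb : (0 : ℝ) ≤ Aᶜ.card := Nat.cast_nonneg _
    have e₁ : wedgeInl A.card (Aᶜ.card :: l) ≫ stepMap (.split A hA hB l) ≫ h =
        yoneda.map (faceMap A false) ≫ wedgeInl k l ≫ h :=
      (wedgeInl_desc_assoc _ _ _ _).trans (Category.assoc _ _ _)
    have e₂ : wedgeInr A.card (Aᶜ.card :: l) ≫ stepMap (.split A hA hB l) ≫ h =
        wedgeDesc (faceHom Aᶜ true ≫ wedgeInl k l) (wedgeInr k l) (split_condition₁ A l) ≫ h :=
      wedgeInr_desc_assoc _ _ _ _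
    rcases le_or_gt t A.card with h₁ | h₁
    · rw [evalChain_of_le c (n := k) _ _ (by linarith), evalChain_of_le c _ _ h₁, e₁]
      refine Eq.trans ?_ (congrFun (cubeFun_comp (faceMap A false) (wedgeInl k l ≫ h)) _).symm
      congr 1
      refine (NatPath.moore_projIcc rfl (card_add_card_compl' A) _ _ ht.le (by linarith)).trans ?_
      rw [NatPath.mooreFun_of_le _ _ h₁]
      rfl
    · rw [evalChain_of_lt c x _ h₁, e₂]
      rcases le_or_gt (t - A.card) Aᶜ.card with h₂ | h₂
      · rw [evalChain_of_le c (n := k) _ _ (by linarith), evalChain_of_le c _ _ h₂,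
          wedgeInl_desc_assoc, Category.assoc]
        refine Eq.trans ?_ (congrFun (cubeFun_comp (faceMap Aᶜ true) (wedgeInl k l ≫ h)) _).symm
        congr 1
        refine (NatPath.moore_projIcc rfl (card_add_card_compl' A) _ _ ht.le (by linarith)).trans ?_
        rw [NatPath.mooreFun_of_lt _ _ h₁]
        rfl
      · rw [evalChain_of_lt c (n := k) _ _ (by linarith), evalChain_of_lt c _ _ h₂,
          wedgeInr_desc_assoc, show t - A.card - Aᶜ.card = t - k by rw [← hk]; ring]
        rfl
  | @cons n l l' s ih =>
    intro x h t ht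
    have e₁ : wedgeInl n l ≫ stepMap (.cons n s) ≫ h = wedgeInl n l' ≫ h :=
      wedgeInl_desc_assoc _ _ _ _
    have e₂ : wedgeInr n l ≫ stepMap (.cons n s) ≫ h = stepMap s ≫ wedgeInr n l' ≫ h :=
      (wedgeInr_desc_assoc _ _ _ _).trans (Category.assoc _ _ _)
    rcases le_or_gt t n with h₁ | h₁
    · rw [evalChain_of_le c _ _ h₁, evalChain_of_le c _ _ h₁, e₁]
      rfl
    · rw [evalChain_of_lt c _ _ h₁, evalChain_of_lt c _ _ h₁, e₂]
      exact ih _ _ _ (by linarith)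

theorem Induces.evalChain {c : SpaceKind} {l l' : List ℕ}
    {f : (wedge l).obj ⟶ (wedge l').obj} {g : chainSpace c l ⟶ chainSpace c l'}
    (hfg : Induces c f g) : ∀ (x : chainSpace c l) (h : (wedge l').obj ⟶ funSet) (t : ℝ), 0 < t →
      evalChain c l' (Space.fn g x) h t = evalChain c l x (f ≫ h) t := by
  induction hfg with
  | id l =>
    intro x h t ht
    rw [Category.id_comp]
    rfl
  | step s => exact evalChain_step c s
  | comp _ _ ih₁ ih₂ =>
    intro x h t ht
    rw [Space.fn_comp, ih₂ _ _ _ ht, ih₁ _ _ _ ht, Category.assoc]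

/-- The constant function. -/
noncomputable def constFun (L : PrecubicalSet) (r : ℝ) : L ⟶ funSet where
  app _ := ↾fun _ _ ↦ r

theorem cubeFun_constFun (n : ℕ) (r : ℝ) : cubeFun (constFun (cube n).obj r) = fun _ ↦ r := rfl

/-- The `j`-th coordinate function. -/
noncomputable def coordFun {n : ℕ} (j : Fin n) : (cube n).obj ⟶ funSet :=
  (yonedaEquiv (X := (⟨n⟩ : Box)) (F := funSet)).symm (fun x : Fin n → ℝ ↦ x j)

theorem cubeFun_coordFun {n : ℕ} (j : Fin n) : cubeFun (coordFun j) = fun x ↦ x j :=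
  (yonedaEquiv (X := (⟨n⟩ : Box)) (F := funSet)).apply_symm_apply _

theorem point_ext {f g : yoneda.obj (⟨0⟩ : Box) ⟶ funSet}
    (h : cubeFun (n := 0) f 0 = cubeFun (n := 0) g 0) : f = g := by
  apply (yonedaEquiv (X := (⟨0⟩ : Box)) (F := funSet)).injective
  change cubeFun (n := 0) f = cubeFun (n := 0) g
  funext x
  rw [Subsingleton.elim x 0, h]

theorem evalChain_injective (c : SpaceKind) : ∀ (l : List ℕ) (x y : chainSpace c l),
    (∀ h t, 0 < t → evalChain c l x h t = evalChain c l y h t) → x = y := by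
  intro l
  induction l with
  | nil => exact fun _ _ _ ↦ rfl
  | cons n l ih =>
    intro x y hxy
    refine Prod.ext (NatPath.ext fun t ↦ ?_) (ih _ _ fun h t ht ↦ ?_)
    · rcases t.2.1.eq_or_lt with h₀ | h₀
      · obtain rfl : t = ⟨0, le_rfl, Nat.cast_nonneg n⟩ := Subtype.ext h₀.symm
        exact (Space.fst (X := natSpace c n) x).2.2.2.2.1.trans
          (Space.fst (X := natSpace c n) y).2.2.2.2.1.symm
      · funext j
        have hc : (cube n).fin ≫ coordFun j = (wedge l).ini ≫ constFun _ 1 := by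
          apply point_ext
          refine (congrFun (cubeFun_comp (vertexMap n fun _ ↦ true) (coordFun j)) 0).trans ?_
          rw [cubeFun_coordFun]
          exact (realMap_of_const (ε := true) (fun _ ↦ rfl) _).trans (if_pos rfl)
        have := hxy (wedgeDesc (coordFun j) (constFun _ 1) hc) t h₀
        rw [evalChain_of_le c _ _ t.2.2, evalChain_of_le c _ _ t.2.2, wedgeInl_desc,
          cubeFun_coordFun, Set.projIcc_of_mem _ t.2] at this
        exact this
    · have hc : (cube n).fin ≫ constFun _ (cubeFun (n := 0) ((wedge l).ini ≫ h) 0) =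
          (wedge l).ini ≫ h := point_ext rfl
      have := hxy (wedgeDesc (constFun _ _) h hc) (t + n) (by positivity)
      rw [evalChain_of_lt c _ _ (by linarith), evalChain_of_lt c _ _ (by linarith),
        wedgeInr_desc, add_sub_cancel_right] at this
      exact this

/-- A composite of elementary refinements induces only one map of products of spaces of natural
`d`-paths. -/
theorem Induces.unique {c : SpaceKind} {l l' : List ℕ}
    {f : (wedge l).obj ⟶ (wedge l').obj} {g g' : chainSpace c l ⟶ chainSpace c l'}
    (hg : Induces c f g) (hg' : Induces c f g') : g = g' :=
  Space.hom_ext fun x ↦ evalChain_injective c _ _ _ fun h t ht ↦ by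
    rw [hg.evalChain x h t ht, hg'.evalChain x h t ht]

/-- The diagram `D_{α,β}(K,n)`. -/
noncomputable def chainDiagram (c : SpaceKind) (K : PrecubicalSet) (α β : vertices K) (n : ℕ) :
    Chain K α β n ⥤ Space c where
  obj a := chainSpace c a.blocks
  map f := ((Chain.Hom.isRefinement f).exists_induces c).choose
  map_id a := Induces.unique (Exists.choose_spec _) (.id _)
  map_comp f g := Induces.unique (Exists.choose_spec _)
    (.comp (Exists.choose_spec _) (Exists.choose_spec _))

theorem induces_chainDiagram {c : SpaceKind} {K : PrecubicalSet} {α β : vertices K} {n : ℕ}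
    {a b : Chain K α β n} (f : a ⟶ b) :
    Induces c (Chain.Hom.map f) ((chainDiagram c K α β n).map f) :=
  Exists.choose_spec ((Chain.Hom.isRefinement f).exists_induces c)

/-! ### Concatenation of cube chains -/

/-- The map `□[l₁] * □[l₂] ⟶ K` given by two maps which agree on the common vertex. -/
noncomputable def joinAux {K : PrecubicalSet} : ∀ (l₁ l₂ : List ℕ) (f : (wedge l₁).obj ⟶ K)
    (g : (wedge l₂).obj ⟶ K), (wedge l₁).fin ≫ f = (wedge l₂).ini ≫ g →
    {u : (wedge (l₁ ++ l₂)).obj ⟶ K // (wedge (l₁ ++ l₂)).ini ≫ u = (wedge l₁).ini ≫ f}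
  | [], _, _, g, h => ⟨g, h.symm⟩
  | n :: l, l₂, f, g, h =>
    ⟨wedgeDesc (l := l ++ l₂) (wedgeInl n l ≫ f)
      (joinAux l l₂ (wedgeInr n l ≫ f) g ((Category.assoc _ _ _).symm.trans h)).1
      (by rw [(joinAux l l₂ (wedgeInr n l ≫ f) g _).2, ← Category.assoc, wedge_condition,
        Category.assoc]), by
      change ((cube n).ini ≫ wedgeInl n (l ++ l₂)) ≫ wedgeDesc _ _ _ =
        ((cube n).ini ≫ wedgeInl n l) ≫ f
      rw [Category.assoc, wedgeInl_desc, Category.assoc]⟩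

/-- The map `□[l₁] * □[l₂] ⟶ K` given by two maps which agree on the common vertex. -/
noncomputable def join {K : PrecubicalSet} {l₁ l₂ : List ℕ} (f : (wedge l₁).obj ⟶ K)
    (g : (wedge l₂).obj ⟶ K) (h : (wedge l₁).fin ≫ f = (wedge l₂).ini ≫ g) :
    (wedge (l₁ ++ l₂)).obj ⟶ K := (joinAux l₁ l₂ f g h).1

theorem ini_join {K : PrecubicalSet} {l₁ l₂ : List ℕ} (f : (wedge l₁).obj ⟶ K)
    (g : (wedge l₂).obj ⟶ K) (h : (wedge l₁).fin ≫ f = (wedge l₂).ini ≫ g) :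
    (wedge (l₁ ++ l₂)).ini ≫ join f g h = (wedge l₁).ini ≫ f := (joinAux l₁ l₂ f g h).2

theorem wedgeInl_join {K : PrecubicalSet} {n : ℕ} {l₁ l₂ : List ℕ} (f : (wedge (n :: l₁)).obj ⟶ K)
    (g : (wedge l₂).obj ⟶ K) (h : (wedge (n :: l₁)).fin ≫ f = (wedge l₂).ini ≫ g) :
    wedgeInl n (l₁ ++ l₂) ≫ join f g h = wedgeInl n l₁ ≫ f :=
  wedgeInl_desc _ _ _

theorem wedgeInr_join {K : PrecubicalSet} {n : ℕ} {l₁ l₂ : List ℕ} (f : (wedge (n :: l₁)).obj ⟶ K)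
    (g : (wedge l₂).obj ⟶ K) (h : (wedge (n :: l₁)).fin ≫ f = (wedge l₂).ini ≫ g) :
    wedgeInr n (l₁ ++ l₂) ≫ join f g h =
      join (wedgeInr n l₁ ≫ f) g ((Category.assoc _ _ _).symm.trans h) :=
  wedgeInr_desc _ _ _

theorem fin_join {K : PrecubicalSet} {l₁ l₂ : List ℕ} (f : (wedge l₁).obj ⟶ K)
    (g : (wedge l₂).obj ⟶ K) (h : (wedge l₁).fin ≫ f = (wedge l₂).ini ≫ g) :
    (wedge (l₁ ++ l₂)).fin ≫ join f g h = (wedge l₂).fin ≫ g := by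
  induction l₁ with
  | nil => rfl
  | cons n l ih =>
    change ((wedge (l ++ l₂)).fin ≫ wedgeInr n (l ++ l₂)) ≫ join f g h = _
    rw [Category.assoc, wedgeInr_join, ih]

theorem join_congr {K : PrecubicalSet} {l₁ l₂ : List ℕ} {f f' : (wedge l₁).obj ⟶ K}
    {g g' : (wedge l₂).obj ⟶ K} (hf : f = f') (hg : g = g')
    (h : (wedge l₁).fin ≫ f = (wedge l₂).ini ≫ g) :
    join f g h = join f' g' (by rw [← hf, ← hg, h]) := by
  subst hf hg
  rfl

theorem join_comp {K L : PrecubicalSet} (φ : K ⟶ L) {l₁ l₂ : List ℕ} (f : (wedge l₁).obj ⟶ K)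
    (g : (wedge l₂).obj ⟶ K) (h : (wedge l₁).fin ≫ f = (wedge l₂).ini ≫ g) :
    join f g h ≫ φ = join (f ≫ φ) (g ≫ φ) (by
      rw [← Category.assoc, h, Category.assoc]) := by
  induction l₁ with
  | nil => rfl
  | cons n l ih =>
    apply wedge_hom_ext (l := l ++ l₂)
    · refine Eq.trans ?_ (wedgeInl_join (f ≫ φ) (g ≫ φ) _).symm
      rw [← Category.assoc, ← Category.assoc]
      exact congrArg (· ≫ φ) (wedgeInl_join f g h)
    · refine Eq.trans ?_ (wedgeInr_join (f ≫ φ) (g ≫ φ) _).symm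
      rw [← Category.assoc]
      refine (congrArg (· ≫ φ) (wedgeInr_join f g h)).trans ?_
      rw [ih]
      exact join_congr (Category.assoc _ _ _) rfl _

theorem wedgeDesc_heq {n : ℕ} {l l' : List ℕ} {K : PrecubicalSet} (hl : l = l')
    (f : (cube n).obj ⟶ K) {g : (wedge l).obj ⟶ K} {g' : (wedge l').obj ⟶ K} (hg : g ≍ g')
    (h : (cube n).fin ≫ f = (wedge l).ini ≫ g) (h' : (cube n).fin ≫ f = (wedge l').ini ≫ g') :
    wedgeDesc f g h ≍ wedgeDesc f g' h' := by
  subst hl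
  obtain rfl := eq_of_heq hg
  rfl

theorem join_assoc {K : PrecubicalSet} {l₁ l₂ l₃ : List ℕ} (f : (wedge l₁).obj ⟶ K)
    (g : (wedge l₂).obj ⟶ K) (k : (wedge l₃).obj ⟶ K)
    (h : (wedge l₁).fin ≫ f = (wedge l₂).ini ≫ g) (h' : (wedge l₂).fin ≫ g = (wedge l₃).ini ≫ k) :
    join (join f g h) k (by rw [fin_join, h']) ≍ join f (join g k h') (by rw [ini_join, h]) := by
  induction l₁ with
  | nil => exact HEq.rfl
  | cons n l ih =>
    have e := ih (wedgeInr n l ≫ f) ((Category.assoc _ _ _).symm.trans h)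
    have e₁ : join (join f g h) k (by rw [fin_join, h']) =
        wedgeDesc (l := l ++ l₂ ++ l₃) (wedgeInl n l ≫ f)
          (join (join (wedgeInr n l ≫ f) g ((Category.assoc _ _ _).symm.trans h)) k
            (by rw [fin_join, h'])) (by
          rw [ini_join, ini_join, ← Category.assoc, wedge_condition, Category.assoc]) := by
      apply wedge_hom_ext
      · rw [wedgeInl_desc]
        exact (wedgeInl_join (join f g h) k _).trans (wedgeInl_join f g h)
      · rw [wedgeInr_desc]
        exact (wedgeInr_join (join f g h) k _).trans (join_congr (wedgeInr_join f g h) rfl _)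
    rw [e₁]
    exact wedgeDesc_heq (List.append_assoc _ _ _) _ e _ _

/-- The concatenation of tuples of paths. -/
def appendPoint {c : SpaceKind} : ∀ {l₁ l₂ : List ℕ}, chainSpace c l₁ → chainSpace c l₂ →
    chainSpace c (l₁ ++ l₂)
  | [], _, _, y => y
  | n :: l, l₂, x, y => Space.pair (X := natSpace c n) (Y := chainSpace c (l ++ l₂))
      (Space.fst (X := natSpace c n) x) (appendPoint (l₁ := l) (Space.snd (X := natSpace c n) x) y)

theorem continuous_appendPoint {c : SpaceKind} {T : Type} [TopologicalSpace T]
    [DeltaGeneratedSpace T] {l₁ l₂ : List ℕ} {f : T → chainSpace c l₁} {g : T → chainSpace c l₂}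
    (hf : Continuous f) (hg : Continuous g) : Continuous (fun t ↦ appendPoint (f t) (g t)) := by
  induction l₁ with
  | nil => exact hg
  | cons n l ih =>
    exact Space.continuous_pair (Space.continuous_fst.comp hf)
      (ih (Space.continuous_snd.comp hf))

theorem deltaContinuous_appendPoint {c : SpaceKind} (l₁ l₂ : List ℕ) :
    DeltaContinuous (fun p : chainSpace c l₁ × chainSpace c l₂ ↦ appendPoint p.1 p.2) :=
  fun _ f ↦ continuous_appendPoint (continuous_fst.comp f.continuous)
    (continuous_snd.comp f.continuous)

theorem pair_heq {c : SpaceKind} {n : ℕ} {l l' : List ℕ} (hl : l = l') (x : natSpace c n)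
    {y : chainSpace c l} {y' : chainSpace c l'} (hy : y ≍ y') :
    Space.pair x y ≍ Space.pair x y' := by
  subst hl
  obtain rfl := eq_of_heq hy
  rfl

theorem appendPoint_assoc {c : SpaceKind} {l₁ l₂ l₃ : List ℕ} (x : chainSpace c l₁)
    (y : chainSpace c l₂) (z : chainSpace c l₃) :
    appendPoint (appendPoint x y) z ≍ appendPoint x (appendPoint y z) := by
  induction l₁ with
  | nil => exact HEq.rfl
  | cons n l ih => exact pair_heq (List.append_assoc _ _ _) _ (ih _)

/-- The refinement `s * id`. -/
def Step.append : ∀ {l l' : List ℕ}, Step l l' → (l₂ : List ℕ) → Step (l ++ l₂) (l' ++ l₂)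
  | _, _, .split A hA hB l, l₂ => .split A hA hB (l ++ l₂)
  | _, _, .cons n s, l₂ => .cons n (s.append l₂)

/-- The refinement `id * s`. -/
def Step.prepend {l l' : List ℕ} (s : Step l l') : ∀ l₁ : List ℕ, Step (l₁ ++ l) (l₁ ++ l')
  | [] => s
  | n :: l₁ => .cons n (s.prepend l₁)

theorem wedgeInl_stepMap_split {k : ℕ} (A : Finset (Fin k)) (hA hB) (l : List ℕ) :
    wedgeInl A.card (Aᶜ.card :: l) ≫ stepMap (.split A hA hB l) =
      faceHom A false ≫ wedgeInl k l :=
  wedgeInl_desc _ _ _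

theorem wedgeInr_stepMap_split {k : ℕ} (A : Finset (Fin k)) (hA hB) (l : List ℕ) :
    wedgeInr A.card (Aᶜ.card :: l) ≫ stepMap (.split A hA hB l) =
      wedgeDesc (faceHom Aᶜ true ≫ wedgeInl k l) (wedgeInr k l) (split_condition₁ A l) :=
  wedgeInr_desc _ _ _

theorem wedgeInl_stepMap_cons (n : ℕ) {l l' : List ℕ} (s : Step l l') :
    wedgeInl n l ≫ stepMap (.cons n s) = wedgeInl n l' :=
  wedgeInl_desc _ _ _

theorem wedgeInr_stepMap_cons (n : ℕ) {l l' : List ℕ} (s : Step l l') :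
    wedgeInr n l ≫ stepMap (.cons n s) = stepMap s ≫ wedgeInr n l' :=
  wedgeInr_desc _ _ _

theorem ini_stepMap {l l' : List ℕ} (s : Step l l') :
    (wedge l).ini ≫ stepMap s = (wedge l').ini := (stepMapAux s).2

theorem fin_stepMap {l l' : List ℕ} (s : Step l l') :
    (wedge l).fin ≫ stepMap s = (wedge l').fin := by
  induction s with
  | split A hA hB l =>
    rw [wedge_fin, wedge_fin, Category.assoc, Category.assoc, wedgeInr_stepMap_split,
      wedgeInr_desc, wedge_fin]
  | cons n s ih =>
    rw [wedge_fin, Category.assoc, wedgeInr_stepMap_cons, ← Category.assoc, ih, wedge_fin]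

theorem Induces.isRefinement {c : SpaceKind} {l l' : List ℕ}
    {f : (wedge l).obj ⟶ (wedge l').obj} {g : chainSpace c l ⟶ chainSpace c l'}
    (h : Induces c f g) : IsRefinement f := by
  induction h with
  | id l => exact .id l
  | step s => exact .step s
  | comp _ _ ih₁ ih₂ => exact .comp ih₁ ih₂

theorem IsRefinement.ini {l l' : List ℕ} {f : (wedge l).obj ⟶ (wedge l').obj}
    (h : IsRefinement f) : (wedge l).ini ≫ f = (wedge l').ini := by
  induction h with
  | id l => exact Category.comp_id _
  | step s => exact ini_stepMap s
  | comp _ _ ih₁ ih₂ => rw [← Category.assoc, ih₁, ih₂]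

theorem IsRefinement.fin {l l' : List ℕ} {f : (wedge l).obj ⟶ (wedge l').obj}
    (h : IsRefinement f) : (wedge l).fin ≫ f = (wedge l').fin := by
  induction h with
  | id l => exact Category.comp_id _
  | step s => exact fin_stepMap s
  | comp _ _ ih₁ ih₂ => rw [← Category.assoc, ih₁, ih₂]

theorem stepMap_append_join {l l' : List ℕ} (s : Step l l') {l₂ : List ℕ} {K : PrecubicalSet}
    (f : (wedge l').obj ⟶ K) (g : (wedge l₂).obj ⟶ K)
    (h : (wedge l').fin ≫ f = (wedge l₂).ini ≫ g) :
    stepMap (s.append l₂) ≫ join f g h =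
      join (stepMap s ≫ f) g (by rw [← Category.assoc, fin_stepMap, h]) := by
  induction s with
  | split A hA hB l =>
    apply wedge_hom_ext (l := Aᶜ.card :: (l ++ l₂))
    · refine Eq.trans ?_ (wedgeInl_join (stepMap (.split A hA hB l) ≫ f) g _).symm
      rw [← Category.assoc, ← Category.assoc, wedgeInl_stepMap_split]
      refine (congrArg (· ≫ join f g h) (wedgeInl_stepMap_split A hA hB (l ++ l₂))).trans ?_
      rw [Category.assoc, wedgeInl_join, Category.assoc]
    · refine Eq.trans ?_ (wedgeInr_join (stepMap (.split A hA hB l) ≫ f) g _).symm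
      rw [← Category.assoc]
      refine (congrArg (· ≫ join f g h) (wedgeInr_stepMap_split A hA hB (l ++ l₂))).trans ?_
      have e : wedgeInr A.card (Aᶜ.card :: l) ≫ stepMap (.split A hA hB l) ≫ f = _ :=
        (Category.assoc _ _ _).symm.trans
          (congrArg (· ≫ f) (wedgeInr_stepMap_split A hA hB l))
      refine Eq.trans ?_ (join_congr e rfl _).symm
      apply wedge_hom_ext (l := l ++ l₂)
      · refine Eq.trans ?_ (wedgeInl_join _ _ _).symm
        rw [wedgeInl_desc_assoc, wedgeInl_desc_assoc, Category.assoc, wedgeInl_join,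
          Category.assoc]
      · refine Eq.trans ?_ (wedgeInr_join _ _ _).symm
        rw [wedgeInr_desc_assoc, wedgeInr_join]
        exact join_congr (wedgeInr_desc_assoc _ _ _ _).symm rfl _
  | @cons n l l' s ih =>
    apply wedge_hom_ext (l := l ++ l₂)
    · refine Eq.trans ?_ (wedgeInl_join (stepMap (.cons n s) ≫ f) g _).symm
      rw [← Category.assoc, ← Category.assoc, wedgeInl_stepMap_cons]
      refine (congrArg (· ≫ join f g h) (wedgeInl_stepMap_cons n (s.append l₂))).trans ?_
      exact wedgeInl_join _ _ _
    · refine Eq.trans ?_ (wedgeInr_join (stepMap (.cons n s) ≫ f) g _).symm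
      rw [← Category.assoc]
      refine (congrArg (· ≫ join f g h) (wedgeInr_stepMap_cons n (s.append l₂))).trans ?_
      rw [Category.assoc, wedgeInr_join, ih]
      refine join_congr ?_ rfl _
      rw [← Category.assoc, ← Category.assoc, wedgeInr_stepMap_cons]

theorem stepMap_prepend_join {l l' : List ℕ} (s : Step l l') {l₁ : List ℕ} {K : PrecubicalSet}
    (f : (wedge l₁).obj ⟶ K) (g : (wedge l').obj ⟶ K)
    (h : (wedge l₁).fin ≫ f = (wedge l').ini ≫ g) :
    stepMap (s.prepend l₁) ≫ join f g h =
      join f (stepMap s ≫ g) (by rw [← Category.assoc, ini_stepMap, h]) := by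
  induction l₁ with
  | nil => rfl
  | cons n l₁ ih =>
    apply wedge_hom_ext (l := l₁ ++ l)
    · refine Eq.trans ?_ (wedgeInl_join f (stepMap s ≫ g) _).symm
      rw [← Category.assoc]
      refine (congrArg (· ≫ join f g h) (wedgeInl_stepMap_cons n (s.prepend l₁))).trans ?_
      exact wedgeInl_join _ _ _
    · refine Eq.trans ?_ (wedgeInr_join f (stepMap s ≫ g) _).symm
      rw [← Category.assoc]
      refine (congrArg (· ≫ join f g h) (wedgeInr_stepMap_cons n (s.prepend l₁))).trans ?_
      rw [Category.assoc, wedgeInr_join, ih]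

theorem stepPath_append {c : SpaceKind} {l l' : List ℕ} (s : Step l l') {l₂ : List ℕ}
    (x : chainSpace c l) (y : chainSpace c l₂) :
    Space.fn (stepPath c (s.append l₂)) (appendPoint x y) =
      appendPoint (Space.fn (stepPath c s) x) y := by
  induction s with
  | split A hA hB l => rfl
  | @cons n l l' s ih => exact congrArg (Space.pair _) (ih (Space.snd (X := natSpace c n) x))

theorem stepPath_prepend {c : SpaceKind} {l l' : List ℕ} (s : Step l l') {l₁ : List ℕ}
    (x : chainSpace c l₁) (y : chainSpace c l) :
    Space.fn (stepPath c (s.prepend l₁)) (appendPoint x y) =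
      appendPoint x (Space.fn (stepPath c s) y) := by
  induction l₁ with
  | nil => rfl
  | cons n l ih => exact congrArg (Space.pair _) (ih (Space.snd (X := natSpace c n) x))

theorem Induces.append {c : SpaceKind} {l l' : List ℕ} {f : (wedge l).obj ⟶ (wedge l').obj}
    {g : chainSpace c l ⟶ chainSpace c l'} (hfg : Induces c f g) (l₂ : List ℕ) :
    ∃ (F : (wedge (l ++ l₂)).obj ⟶ (wedge (l' ++ l₂)).obj)
      (G : chainSpace c (l ++ l₂) ⟶ chainSpace c (l' ++ l₂)), Induces c F G ∧
      (∀ (K : PrecubicalSet) (u : (wedge l').obj ⟶ K) (v : (wedge l₂).obj ⟶ K) h h',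
        F ≫ join u v h = join (f ≫ u) v h') ∧
      ∀ x y, Space.fn G (appendPoint x y) = appendPoint (Space.fn g x) y := by
  induction hfg with
  | id l =>
    refine ⟨_, _, .id _, fun K u v h h' ↦ ?_, fun x y ↦ rfl⟩
    rw [Category.id_comp]
    exact join_congr (Category.id_comp _).symm rfl _
  | step s =>
    exact ⟨_, _, .step (s.append l₂), fun K u v h h' ↦ stepMap_append_join s u v h,
      stepPath_append s⟩
  | comp h₁ h₂ ih₁ ih₂ =>
    obtain ⟨F₁, G₁, i₁, j₁, k₁⟩ := ih₁
    obtain ⟨F₂, G₂, i₂, j₂, k₂⟩ := ih₂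
    refine ⟨_, _, .comp i₁ i₂, fun K u v h h' ↦ ?_, fun x y ↦ ?_⟩
    · rw [Category.assoc, j₂ K u v h (by rw [← Category.assoc, h₂.isRefinement.fin, h]),
        j₁ K _ v _ ((congrArg _ (Category.assoc _ _ _).symm).trans h')]
      exact join_congr (Category.assoc _ _ _).symm rfl _
    · rw [Space.fn_comp, k₁, k₂, Space.fn_comp]

theorem Induces.prepend {c : SpaceKind} {l l' : List ℕ} {f : (wedge l).obj ⟶ (wedge l').obj}
    {g : chainSpace c l ⟶ chainSpace c l'} (hfg : Induces c f g) (l₁ : List ℕ) :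
    ∃ (F : (wedge (l₁ ++ l)).obj ⟶ (wedge (l₁ ++ l')).obj)
      (G : chainSpace c (l₁ ++ l) ⟶ chainSpace c (l₁ ++ l')), Induces c F G ∧
      (∀ (K : PrecubicalSet) (u : (wedge l₁).obj ⟶ K) (v : (wedge l').obj ⟶ K) h h',
        F ≫ join u v h = join u (f ≫ v) h') ∧
      ∀ x y, Space.fn G (appendPoint x y) = appendPoint x (Space.fn g y) := by
  induction hfg with
  | id l =>
    refine ⟨_, _, .id _, fun K u v h h' ↦ ?_, fun x y ↦ rfl⟩
    rw [Category.id_comp]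
    exact join_congr rfl (Category.id_comp _).symm _
  | step s =>
    exact ⟨_, _, .step (s.prepend l₁), fun K u v h h' ↦ stepMap_prepend_join s u v h,
      stepPath_prepend s⟩
  | comp h₁ h₂ ih₁ ih₂ =>
    obtain ⟨F₁, G₁, i₁, j₁, k₁⟩ := ih₁
    obtain ⟨F₂, G₂, i₂, j₂, k₂⟩ := ih₂
    refine ⟨_, _, .comp i₁ i₂, fun K u v h h' ↦ ?_, fun x y ↦ ?_⟩
    · rw [Category.assoc, j₂ K u v h (by rw [← Category.assoc, h₂.isRefinement.ini, h]),
        j₁ K u _ _ (h'.trans (congrArg _ (Category.assoc _ _ _)))]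
      exact join_congr rfl (Category.assoc _ _ _).symm _
    · rw [Space.fn_comp, k₁, k₂, Space.fn_comp]

namespace Chain

variable {K L : PrecubicalSet}

theorem map_congr {α β : vertices K} {n : ℕ} (a : Chain K α β n) {β' γ : vertices K} {n' : ℕ}
    (b : Chain K β' γ n') (hβ : β = β') :
    (wedge a.blocks).fin ≫ a.map = (wedge b.blocks).ini ≫ b.map :=
  yonedaEquiv.injective (a.fin.trans (hβ.trans b.ini.symm))

/-- The concatenation of two cube chains. -/
noncomputable def append {α β β' γ : vertices K} {m n N : ℕ} (hβ : β = β') (hN : m + n = N)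
    (a : Chain K α β m) (b : Chain K β' γ n) : Chain K α γ N where
  blocks := a.blocks ++ b.blocks
  pos k hk := (List.mem_append.1 hk).elim (a.pos k) (b.pos k)
  sum := by rw [List.sum_append, a.sum, b.sum, hN]
  map := join a.map b.map (map_congr a b hβ)
  ini := by rw [ini_join, a.ini]
  fin := by rw [fin_join, b.fin]

/-- The image of a cube chain under a map of precubical sets. -/
noncomputable def push (φ : K ⟶ L) {α β : vertices K} {n : ℕ} (a : Chain K α β n) :
    Chain L (φ.app _ α) (φ.app _ β) n where
  blocks := a.blocks
  pos := a.pos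
  sum := a.sum
  map := a.map ≫ φ
  ini := by rw [← Category.assoc, yonedaEquiv_comp, a.ini]
  fin := by rw [← Category.assoc, yonedaEquiv_comp, a.fin]

/-- The image of a morphism of cube chains under a map of precubical sets. -/
noncomputable def pushHom (φ : K ⟶ L) {α β : vertices K} {n : ℕ} {a b : Chain K α β n}
    (f : a ⟶ b) : a.push φ ⟶ b.push φ :=
  Hom.mk (a := a.push φ) (b := b.push φ) (Hom.map (a := a) (b := b) f)
    (Hom.isRefinement (a := a) (b := b) f)
    ((Category.assoc _ _ _).symm.trans (congrArg (· ≫ φ) (Hom.w (a := a) (b := b) f)))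

end Chain

/-! ### The realization by cube chains -/

variable (c : SpaceKind) (K : PrecubicalSet)

/-- The colimit of the diagram `D_{α,β}(K,n)`. -/
noncomputable abbrev chainColimit (α β : vertices K) (n : ℕ) : Space c :=
  colimit (chainDiagram c K α β n)

variable {K}

/-- The point of the colimit given by a cube chain and a tuple of paths. -/
noncomputable abbrev chainPoint {α β : vertices K} {n : ℕ} (a : Chain K α β n)
    (x : chainSpace c a.blocks) : chainColimit c K α β n :=
  Space.fn (colimit.ι (chainDiagram c K α β n) a) x

theorem chainPoint_eq {α β : vertices K} {n : ℕ} {a b : Chain K α β n}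
    {f : (wedge a.blocks).obj ⟶ (wedge b.blocks).obj}
    {g : chainSpace c a.blocks ⟶ chainSpace c b.blocks} (hfg : Induces c f g)
    (hw : f ≫ b.map = a.map) (x : chainSpace c a.blocks) :
    chainPoint c b (Space.fn g x) = chainPoint c a x := by
  let F : a ⟶ b := Chain.Hom.mk f hfg.isRefinement hw
  have e : (chainDiagram c K α β n).map F = g := (induces_chainDiagram F).unique hfg
  have := Space.fn_colimit_w (chainDiagram c K α β n) F x
  rwa [e] at this

theorem exists_chainMul {α β β' γ : vertices K} {m n N : ℕ} (hβ : β = β') (hN : m + n = N) :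
    ∃ μ : (chainColimit c K α β m).obj → (chainColimit c K β' γ n).obj →
        chainColimit c K α γ N,
      DeltaContinuous (fun p : (chainColimit c K α β m).obj × (chainColimit c K β' γ n).obj ↦
        μ p.1 p.2) ∧
      ∀ (a : Chain K α β m) (b : Chain K β' γ n) x y,
        μ (chainPoint c a x) (chainPoint c b y) = chainPoint c (a.append hβ hN b)
          (appendPoint x y) :=
  Space.exists_extension₂ (chainDiagram c K α β m) (chainDiagram c K β' γ n)
    (chainColimit c K α γ N)
    (fun a b x y ↦ chainPoint c (a.append hβ hN b) (appendPoint (l₁ := a.blocks)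
      (l₂ := b.blocks) x y))
    (fun a b ↦ (Space.continuous_fn _).continuousGeneratedBy.comp
      (deltaContinuous_appendPoint a.blocks b.blocks))
    (fun {a a'} f b x y ↦ by
      obtain ⟨F, G, h₁, h₂, h₃⟩ := (induces_chainDiagram (c := c) f).append b.blocks
      refine (congrArg (chainPoint c (a'.append hβ hN b)) (h₃ x y)).symm.trans
        (chainPoint_eq c (a := a.append hβ hN b) (b := a'.append hβ hN b) h₁ ?_ _)
      have e : Chain.Hom.map f ≫ a'.map = a.map := Chain.Hom.w f
      refine (h₂ K a'.map b.map _ ?_).trans (join_congr e rfl _)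
      rw [e]
      exact Chain.map_congr a b hβ)
    (fun a b b' f x y ↦ by
      obtain ⟨F, G, h₁, h₂, h₃⟩ := (induces_chainDiagram (c := c) f).prepend a.blocks
      refine (congrArg (chainPoint c (a.append hβ hN b')) (h₃ x y)).symm.trans
        (chainPoint_eq c (a := a.append hβ hN b) (b := a.append hβ hN b') h₁ ?_ _)
      have e : Chain.Hom.map f ≫ b'.map = b.map := Chain.Hom.w f
      refine (h₂ K a.map b'.map _ ?_).trans (join_congr rfl e _)
      rw [e]
      exact Chain.map_congr a b hβ)

/-- The map `colim D_{α,β}(K,m) × colim D_{β,γ}(K,n) → colim D_{α,γ}(K,m+n)` induced by the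
concatenation of tuples. -/
noncomputable def chainMul {α β β' γ : vertices K} {m n N : ℕ} (hβ : β = β') (hN : m + n = N) :
    (chainColimit c K α β m).obj → (chainColimit c K β' γ n).obj → chainColimit c K α γ N :=
  (exists_chainMul c hβ hN).choose

theorem deltaContinuous_chainMul {α β β' γ : vertices K} {m n N : ℕ} (hβ : β = β')
    (hN : m + n = N) : DeltaContinuous
      (fun p : (chainColimit c K α β m).obj × (chainColimit c K β' γ n).obj ↦
        chainMul c hβ hN p.1 p.2) := (exists_chainMul c hβ hN).choose_spec.1

theorem chainMul_point {α β β' γ : vertices K} {m n N : ℕ} (hβ : β = β') (hN : m + n = N)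
    (a : Chain K α β m) (b : Chain K β' γ n) (x : chainSpace c a.blocks)
    (y : chainSpace c b.blocks) :
    chainMul c hβ hN (chainPoint c a x) (chainPoint c b y) =
      chainPoint c (a.append hβ hN b) (appendPoint x y) :=
  (exists_chainMul c hβ hN).choose_spec.2 a b x y

variable (K)

/-- The space of execution paths of the realization by cube chains, as a set: the disjoint union
over the vertices `α`, `β` and the integers `n ≥ 1` of the colimits of the diagrams
`D_{α,β}(K,n)`. -/
abbrev ChainPath := Σ p : (vertices K × vertices K) × ℕ+, chainColimit c K p.1.1 p.1.2 p.2

variable {K}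

namespace ChainPath

/-- The execution path given by a cube chain and a tuple of paths. -/
noncomputable def mk {α β : vertices K} {n : ℕ+} (a : Chain K α β n)
    (x : chainSpace c a.blocks) : ChainPath c K := ⟨((α, β), n), chainPoint c a x⟩

theorem exists_mk (x : ChainPath c K) :
    ∃ (α β : vertices K) (n : ℕ+) (a : Chain K α β n) (p : chainSpace c a.blocks),
      x = mk c a p := by
  obtain ⟨⟨⟨α, β⟩, n⟩, u⟩ := x
  obtain ⟨a, p, rfl⟩ := Space.exists_rep _ u
  exact ⟨α, β, n, a, p, rfl⟩

theorem mk_eq {α α' β β' : vertices K} {n n' : ℕ+} (hα : α = α') (hβ : β = β') (hn : n = n')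
    (a : Chain K α β n) (a' : Chain K α' β' n') {x : chainSpace c a.blocks}
    {x' : chainSpace c a'.blocks} (hb : a.blocks = a'.blocks) (hm : a.map ≍ a'.map)
    (hx : x ≍ x') : mk c a x = mk c a' x' := by
  subst hα hβ hn
  obtain ⟨l, _, _, f, _, _⟩ := a
  obtain ⟨l', _, _, f', _, _⟩ := a'
  obtain rfl : l = l' := hb
  obtain rfl := eq_of_heq hm
  obtain rfl := eq_of_heq hx
  rfl

/-- Composition of execution paths. -/
noncomputable def comp (x y : ChainPath c K) (h : x.1.1.2 = y.1.1.1) : ChainPath c K :=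
  ⟨((x.1.1.1, y.1.1.2), x.1.2 + y.1.2), chainMul c h (PNat.add_coe _ _).symm x.2 y.2⟩

theorem comp_mk {α β β' γ : vertices K} {m n : ℕ+} (h : β = β') (a : Chain K α β m)
    (b : Chain K β' γ n) (x : chainSpace c a.blocks) (y : chainSpace c b.blocks) :
    comp c (mk c a x) (mk c b y) h =
      mk c (n := m + n) (a.append h (PNat.add_coe _ _).symm b) (appendPoint x y) := by
  unfold comp mk
  congr 1
  exact chainMul_point c h _ a b x y

theorem comp_cont : DeltaContinuous
    (fun p : {p : ChainPath c K × ChainPath c K // p.1.1.1.2 = p.2.1.1.1} ↦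
      comp c p.1.1 p.1.2 p.2) := by
  intro k f
  obtain ⟨i, j, h, f₁, f₂, hf⟩ := exists_lift_sigma_pair (X := fun
    p : (vertices K × vertices K) × ℕ+ ↦ (chainColimit c K p.1.1 p.1.2 p.2).obj)
    (fun p q ↦ p.1.2 = q.1.1) f
  have e : (fun p : {p : ChainPath c K × ChainPath c K // p.1.1.1.2 = p.2.1.1.1} ↦
      comp c p.1.1 p.1.2 p.2) ∘ f = fun t ↦ (⟨((i.1.1, j.1.2), i.2 + j.2),
        chainMul c h (PNat.add_coe _ _).symm (f₁ t) (f₂ t)⟩ : ChainPath c K) := by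
    funext t
    simp only [Function.comp_apply, hf t]
    rfl
  rw [e]
  have h₁ : Continuous (fun t ↦ chainMul c h (PNat.add_coe i.2 j.2).symm (f₁ t) (f₂ t)) :=
    deltaContinuous_chainMul c h (PNat.add_coe i.2 j.2).symm (f₁.prodMk f₂)
  exact (continuous_sigmaMk (σ := fun p : (vertices K × vertices K) × ℕ+ ↦
    (chainColimit c K p.1.1 p.1.2 p.2).obj) (i := ((i.1.1, j.1.2), i.2 + j.2))).comp h₁

theorem assoc (x y z : ChainPath c K) (hxy : x.1.1.2 = y.1.1.1) (hyz : y.1.1.2 = z.1.1.1) :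
    comp c (comp c x y hxy) z hyz = comp c x (comp c y z hyz) hxy := by
  obtain ⟨⟨⟨α, β⟩, m⟩, x⟩ := x
  obtain ⟨⟨⟨β', γ⟩, n⟩, y⟩ := y
  obtain ⟨⟨⟨γ', δ⟩, p⟩, z⟩ := z
  obtain ⟨a, x, rfl⟩ := Space.exists_rep _ x
  obtain ⟨b, y, rfl⟩ := Space.exists_rep _ y
  obtain ⟨d, z, rfl⟩ := Space.exists_rep _ z
  change comp c (comp c (mk c a x) (mk c b y) hxy) (mk c d z) hyz =
    comp c (mk c a x) (comp c (mk c b y) (mk c d z) hyz) hxy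
  have e₁ := comp_mk c hxy a b x y
  have e₂ := comp_mk c hyz b d y z
  have e₃ := comp_mk c hyz (a.append hxy (PNat.add_coe m n).symm b) d (appendPoint x y) z
  have e₄ := comp_mk c hxy a (b.append hyz (PNat.add_coe n p).symm d) x (appendPoint y z)
  simp only [e₁, e₂]
  refine e₃.trans (Eq.trans ?_ e₄.symm)
  exact mk_eq c rfl rfl (add_assoc _ _ _) _ _ (List.append_assoc _ _ _)
    (join_assoc _ _ _ _ _) (appendPoint_assoc _ _ _)

end ChainPath

variable (K)

/-- The flow `‖K‖`. -/
noncomputable def chainFlow : Flow c where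
  State := vertices K
  Path := Space.of (ChainPath c K)
    (isSpace_sigma fun p ↦ (chainColimit c K p.1.1 p.1.2 p.2).property)
  src x := x.1.1.1
  tgt x := x.1.1.2
  src_loc := (CubePath.isLocallyConstant_fst (X := fun
    p : (vertices K × vertices K) × ℕ+ ↦ (chainColimit c K p.1.1 p.1.2 p.2).obj)).comp
      (fun p ↦ p.1.1)
  tgt_loc := (CubePath.isLocallyConstant_fst (X := fun
    p : (vertices K × vertices K) × ℕ+ ↦ (chainColimit c K p.1.1 p.1.2 p.2).obj)).comp
      (fun p ↦ p.1.2)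
  comp x y h := ChainPath.comp c x y h
  comp_cont := ChainPath.comp_cont c
  src_comp _ _ _ := rfl
  tgt_comp _ _ _ := rfl
  assoc x y z hxy hyz := ChainPath.assoc c x y z hxy hyz

variable {K} {L M : PrecubicalSet}

/-- The map of colimits induced by a map of precubical sets. -/
noncomputable def chainColimitMap (φ : K ⟶ L) (α β : vertices K) (n : ℕ) :
    chainColimit c K α β n ⟶ chainColimit c L (φ.app _ α) (φ.app _ β) n :=
  colimit.desc (chainDiagram c K α β n)
    { pt := chainColimit c L (φ.app _ α) (φ.app _ β) n
      ι :=
        { app := fun a ↦ colimit.ι (chainDiagram c L (φ.app _ α) (φ.app _ β) n) (a.push φ)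
          naturality := fun a b f ↦ (colimit.w (chainDiagram c L (φ.app _ α) (φ.app _ β) n)
            (Chain.pushHom φ f)).trans (Category.comp_id _).symm } }

theorem chainColimitMap_point (φ : K ⟶ L) {α β : vertices K} {n : ℕ} (a : Chain K α β n)
    (x : chainSpace c a.blocks) :
    Space.fn (chainColimitMap c φ α β n) (chainPoint c a x) = chainPoint c (a.push φ) x :=
  Space.fn_colimit_desc (chainDiagram c K α β n) _ a x

namespace ChainPath

/-- The image of an execution path under a map of precubical sets. -/
noncomputable def map (φ : K ⟶ L) (x : ChainPath c K) : ChainPath c L :=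
  ⟨((φ.app _ x.1.1.1, φ.app _ x.1.1.2), x.1.2), Space.fn (chainColimitMap c φ _ _ _) x.2⟩

theorem map_mk (φ : K ⟶ L) {α β : vertices K} {n : ℕ+} (a : Chain K α β n)
    (x : chainSpace c a.blocks) : map c φ (mk c a x) = mk c (a.push φ) x := by
  unfold map mk
  congr 1
  exact chainColimitMap_point c φ a x

theorem continuous_map (φ : K ⟶ L) : Continuous (map c φ) := by
  rw [continuous_sigma_iff]
  intro i
  exact (continuous_sigmaMk (σ := fun p : (vertices L × vertices L) × ℕ+ ↦
    (chainColimit c L p.1.1 p.1.2 p.2).obj) (i := ((φ.app _ i.1.1, φ.app _ i.1.2), i.2))).comp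
      (Space.continuous_fn (chainColimitMap c φ i.1.1 i.1.2 i.2))

theorem map_comp (φ : K ⟶ L) (x y : ChainPath c K) (h : x.1.1.2 = y.1.1.1) :
    map c φ (comp c x y h) = comp c (map c φ x) (map c φ y) (congrArg (φ.app _) h) := by
  obtain ⟨⟨⟨α, β⟩, m⟩, x⟩ := x
  obtain ⟨⟨⟨β', γ⟩, n⟩, y⟩ := y
  obtain ⟨a, x, rfl⟩ := Space.exists_rep _ x
  obtain ⟨b, y, rfl⟩ := Space.exists_rep _ y
  change map c φ (comp c (mk c a x) (mk c b y) h) =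
    comp c (map c φ (mk c a x)) (map c φ (mk c b y)) (congrArg (φ.app _) h)
  have e₁ := comp_mk c h a b x y
  have e₂ := map_mk c φ (a.append h (PNat.add_coe m n).symm b) (appendPoint x y)
  have e₃ := map_mk c φ a x
  have e₄ := map_mk c φ b y
  have e₅ := comp_mk c (congrArg (φ.app _) h) (a.push φ) (b.push φ) x y
  simp only [e₁, e₃, e₄]
  refine e₂.trans (Eq.trans ?_ e₅.symm)
  exact mk_eq c rfl rfl rfl _ _ rfl (heq_of_eq (join_comp φ _ _ _)) HEq.rfl

end ChainPath

/-- The functor `‖-‖` from precubical sets to flows. -/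
noncomputable def cubeChainRealization : PrecubicalSet ⥤ Flow c where
  obj K := chainFlow c K
  map φ :=
    { state := φ.app _
      path := ChainPath.map c φ
      path_cont := ChainPath.continuous_map c φ
      src_path := fun _ ↦ rfl
      tgt_path := fun _ ↦ rfl
      path_comp := ChainPath.map_comp c φ }
  map_id K := Flow.hom_ext (fun _ ↦ rfl) fun x ↦ by
    obtain ⟨α, β, n, a, p, rfl⟩ := ChainPath.exists_mk c x
    exact (ChainPath.map_mk c (𝟙 K) a p).trans (ChainPath.mk_eq c rfl rfl rfl _ _ rfl
      (heq_of_eq (Category.comp_id _)) HEq.rfl)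
  map_comp φ ψ := Flow.hom_ext (fun _ ↦ rfl) fun x ↦ by
    obtain ⟨α, β, n, a, p, rfl⟩ := ChainPath.exists_mk c x
    refine (ChainPath.map_mk c (φ ≫ ψ) a p).trans (Eq.trans ?_ (Eq.trans
      (ChainPath.map_mk c ψ (a.push φ) p).symm
      (congrArg (ChainPath.map c ψ) (ChainPath.map_mk c φ a p).symm)))
    exact ChainPath.mk_eq c rfl rfl rfl _ _ rfl
      (heq_of_eq (Category.assoc _ _ _).symm) HEq.rfl

end PrecubicalFlow

/-! The functor `naturalRealization` is by definition a pointwise left Kan extension of `natCube`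
along the Yoneda embedding. It is therefore enough to equip `cubeChainRealization` with a natural
transformation `cubeUnit` from `natCube` and to check that it is a pointwise left Kan extension too:
for every precubical set K, the flow ‖K‖ is a colimit of the natural cubes over the cubes of K. The
isomorphism, together with its naturality in K, then follows from the uniqueness of left Kan
extensions. No explicit description of a colimit of flows is needed, because the universal property
is checked directly on ‖K‖.

The unit. A natural path from α to β in an n-cube stays in the face spanned by α and β, and the
dimension of that face is the length of the path. So the path is the image of a unique diagonal path
γ under a unique face f (`CubePath.exists_map_diag`, `CubePath.map_diag_injective`), and it is sent
to the class of the chain consisting of the single cube f, with the tuple (γ). This depends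
continuously on the path, because the face is constant on each component and γ is obtained by
forgetting the constant coordinates. It respects composition for the following reason. Two
composable faces are complementary faces of a third one (`exists_split`), along a partition of its
coordinates into A and its complement. The refinement given by this partition is a morphism of cube
chains. In the colimit it identifies the Moore composite in the large face with the pair of paths in
the two small faces, that is, with their composite in ‖K‖ (`ChainPath.single_splitPath`,
`CubePath.toChainPath_comp`).

Existence of the induced map. Given a compatible family of morphisms from the natural cubes of K to
a flow X, a tuple of paths over a cube chain is sent to the composite in X of the values of its
entries (`CubeCocone.eval`). An elementary refinement replaces two consecutive entries by their
Moore composite in one cube. The result in X does not change, because the family consists of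
morphisms of flows (`CubeCocone.value_splitPath`) and because composition in X is associative
(`CubeCocone.eval_stepPath`). Hence the assignment passes to the colimits over the categories of
cube chains. Associativity also shows that concatenation is sent to composition
(`CubeCocone.eval_appendPoint`).

Uniqueness. Every execution path of ‖K‖ is a finite composite of paths given by single cubes
(`ChainPath.mk_singleton`, `ChainPath.exists_mk_cons`), and each of those comes from a natural cube
through the unit. Two morphisms out of ‖K‖ that agree on the natural cubes are therefore equal
(`CubeCocone.hom_path_mk`, `CubeCocone.uniq`). -/

namespace PrecubicalFlow

/-! ### Faces of cubes -/

/-- A box map keeps the coordinates of the source in order and adds constant coordinates. -/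
theorem IsBoxMap.exists_orderEmbedding {m n : ℕ} {f : (Fin m → Bool) → (Fin n → Bool)}
    (hf : IsBoxMap f) : ∃ e : Fin m ↪o Fin n, (∀ v i, f v (e i) = v i) ∧
      ∀ j, j ∉ Set.range e → ∀ v w, f v j = f w j := by
  induction hf with
  | id n => exact ⟨RelEmbedding.refl _, fun _ _ ↦ rfl, fun j hj ↦ (hj ⟨j, rfl⟩).elim⟩
  | coface i ε =>
    refine ⟨Fin.succAboveOrderEmb i, fun v j ↦ by simp, fun j hj v w ↦ ?_⟩
    have hji : j = i := by
      by_contra h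
      exact hj (Fin.exists_succAbove_eq h)
    subst hji
    simp
  | comp _ _ ihf ihg =>
    obtain ⟨e, he, he'⟩ := ihf
    obtain ⟨d, hd, hd'⟩ := ihg
    refine ⟨e.trans d, fun v i ↦ (hd _ _).trans (he _ _), fun j hj v w ↦ ?_⟩
    by_cases h : j ∈ Set.range d
    · obtain ⟨k, rfl⟩ := h
      refine (hd _ _).trans (Eq.trans ?_ (hd _ _).symm)
      exact he' k (fun ⟨i, hi⟩ ↦ hj ⟨i, congrArg d hi⟩) v w
    · exact hd' j h _ _

/-- The free coordinates of a face, in terms of its two extremal vertices. -/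
theorem mem_range_iff_of_orderEmbedding {m n : ℕ} {f : (Fin m → Bool) → (Fin n → Bool)}
    {e : Fin m ↪o Fin n} (h : ∀ v i, f v (e i) = v i)
    (h' : ∀ j, j ∉ Set.range e → ∀ v w, f v j = f w j) (j : Fin n) :
    j ∈ Set.range e ↔ f (fun _ ↦ false) j ≠ f (fun _ ↦ true) j := by
  constructor
  · rintro ⟨i, rfl⟩
    simp [h]
  · intro hj
    by_contra hcon
    exact hj (h' j hcon _ _)

/-- A box map is determined by its values on the two extremal vertices. -/
theorem Box.hom_ext_extremal {m n : ℕ} {f g : (⟨m⟩ : Box) ⟶ ⟨n⟩}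
    (h₀ : Box.app f (fun _ ↦ false) = Box.app g (fun _ ↦ false))
    (h₁ : Box.app f (fun _ ↦ true) = Box.app g (fun _ ↦ true)) : f = g := by
  obtain ⟨e, he, he'⟩ := (Box.app_isBoxMap f).exists_orderEmbedding
  obtain ⟨d, hd, hd'⟩ := (Box.app_isBoxMap g).exists_orderEmbedding
  -- An order embedding between finite chains is determined by its range, and here the range is the
  -- set of coordinates in which the two extremal vertices differ.
  obtain rfl : e = d := OrderEmbedding.range_inj.1 (Set.ext fun j ↦ by
    rw [mem_range_iff_of_orderEmbedding he he', mem_range_iff_of_orderEmbedding hd hd', h₀, h₁])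
  refine Box.hom_ext fun v ↦ funext fun j ↦ ?_
  by_cases h : j ∈ Set.range e
  · obtain ⟨i, rfl⟩ := h
    rw [he, hd]
  · rw [he' j h v fun _ ↦ false, hd' j h v fun _ ↦ false, h₀]

/-- The dimension of a face is the number of coordinates in which its extremal vertices differ. -/
theorem card_ne_extremal {m n : ℕ} (f : (⟨m⟩ : Box) ⟶ ⟨n⟩) :
    (Finset.univ.filter fun j ↦
      Box.app f (fun _ ↦ false) j ≠ Box.app f (fun _ ↦ true) j).card = m := by
  obtain ⟨e, he, he'⟩ := (Box.app_isBoxMap f).exists_orderEmbedding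
  have : (Finset.univ.filter fun j ↦
      Box.app f (fun _ ↦ false) j ≠ Box.app f (fun _ ↦ true) j) =
      Finset.univ.map e.toEmbedding := by
    ext j
    have := mem_range_iff_of_orderEmbedding he he' j
    simp only [Finset.mem_filter, Finset.mem_univ, true_and, Finset.mem_map]
    exact this.symm
  rw [this, Finset.card_map, Finset.card_univ, Fintype.card_fin]

theorem extremal_le {m n : ℕ} (f : (⟨m⟩ : Box) ⟶ ⟨n⟩) :
    Box.app f (fun _ ↦ false) ≤ Box.app f (fun _ ↦ true) := by
  obtain ⟨e, he, he'⟩ := (Box.app_isBoxMap f).exists_orderEmbedding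
  intro j
  by_cases h : j ∈ Set.range e
  · obtain ⟨i, rfl⟩ := h
    rw [he, he]
    exact Bool.false_le _
  · exact (he' j h _ _).le

/-- The face of a cube with given extremal vertices. -/
theorem exists_face {m n : ℕ} {α β : Fin n → Bool} (h : α ≤ β)
    (hm : (Finset.univ.filter fun j ↦ α j ≠ β j).card = m) :
    ∃ f : (⟨m⟩ : Box) ⟶ ⟨n⟩, Box.app f (fun _ ↦ false) = α ∧ Box.app f (fun _ ↦ true) = β := by
  let D := Finset.univ.filter fun j ↦ α j ≠ β j
  have hD : ∀ j, j ∈ D ↔ α j ≠ β j := fun j ↦ by simp [D]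
  -- The free coordinates of the face are those in `D`, listed in increasing order; the other ones
  -- are frozen at their value in `α`, which is also their value in `β`.
  refine ⟨⟨fun v j ↦ if hj : j ∈ D then v ((D.orderIsoOfFin hm).symm ⟨j, hj⟩) else α j,
    isBoxMap_of_orderEmbedding _ (D.orderEmbOfFin hm) α (fun v i ↦ ?_) (fun v j hj ↦ ?_)⟩, ?_, ?_⟩
  · rw [dif_pos (D.orderEmbOfFin_mem hm i)]
    congr 1
    rw [OrderIso.symm_apply_eq]
    rfl
  · rw [Finset.range_orderEmbOfFin] at hj
    exact dif_neg hj
  · funext j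
    change (if hj : j ∈ D then false else α j) = α j
    have h1 := h j
    have h2 := hD j
    by_cases hj : j ∈ D
    · rw [dif_pos hj]
      -- On `D` the condition `α ≤ β` leaves only the values `α j = false` and `β j = true`.
      rw [h2] at hj
      revert h1 hj
      cases α j <;> cases β j <;> simp
    · rw [dif_neg hj]
  · funext j
    change (if hj : j ∈ D then true else α j) = β j
    have h1 := h j
    have h2 := hD j
    by_cases hj : j ∈ D
    · rw [dif_pos hj]
      rw [h2] at hj
      revert h1 hj
      cases α j <;> cases β j <;> simp
    · rw [dif_neg hj]
      exact not_not.1 (fun hne ↦ hj (h2.2 hne))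

/-- Two faces of a cube such that the final vertex of the first one is the initial vertex of the
second one are the two parts of a partition of the coordinates of a third face. -/
theorem exists_split {l m n : ℕ} (f : (⟨l⟩ : Box) ⟶ ⟨n⟩) (g : (⟨m⟩ : Box) ⟶ ⟨n⟩)
    (hfg : Box.app f (fun _ ↦ true) = Box.app g (fun _ ↦ false)) :
    ∃ (k : ℕ) (A : Finset (Fin k)) (h : (⟨k⟩ : Box) ⟶ ⟨n⟩), A.card = l ∧ Aᶜ.card = m ∧
      Box.app h (fun _ ↦ false) = Box.app f (fun _ ↦ false) ∧
      Box.app h (fun j ↦ decide (j ∈ A)) = Box.app f (fun _ ↦ true) ∧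
      Box.app h (fun _ ↦ true) = Box.app g (fun _ ↦ true) := by
  have hf := extremal_le f
  have hg := extremal_le g
  have cf := card_ne_extremal f
  have cg := card_ne_extremal g
  rw [hfg] at hf cf ⊢
  generalize Box.app f (fun _ ↦ false) = α at *
  generalize Box.app g (fun _ ↦ false) = β at *
  generalize Box.app g (fun _ ↦ true) = δ at *
  -- Since `α ≤ β ≤ δ`, each coordinate switches at most once. The coordinates that switch between
  -- `α` and `δ` are thus the disjoint union of those of the first face and those of the second one.
  have hc : (Finset.univ.filter fun j ↦ α j ≠ δ j).card = l + m := by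
    rw [← cf, ← cg, ← Finset.card_union_of_disjoint]
    · congr 1
      ext j
      have h1 := hf j
      have h2 := hg j
      simp only [Finset.mem_filter, Finset.mem_univ, true_and, Finset.mem_union]
      revert h1 h2
      cases α j <;> cases β j <;> cases δ j <;> simp
    · rw [Finset.disjoint_left]
      intro j
      have h1 := hf j
      have h2 := hg j
      simp only [Finset.mem_filter, Finset.mem_univ, true_and]
      revert h1 h2
      cases α j <;> cases β j <;> cases δ j <;> simp
  obtain ⟨h, h₀, h₁⟩ := exists_face (hf.trans hg) hc
  obtain ⟨e, he, he'⟩ := (Box.app_isBoxMap h).exists_orderEmbedding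
  -- Among the free coordinates of the large face, `A` collects those that have already switched at
  -- the middle vertex `β`, which are the free coordinates of `f`.
  let A : Finset (Fin (l + m)) := Finset.univ.filter fun i ↦ β (e i) = true
  have hA : ∀ i, i ∈ A ↔ β (e i) = true := fun i ↦ by simp [A]
  have hαe : ∀ i, α (e i) = false := fun i ↦ by rw [← h₀, he]
  have hcA : A.card = l := by
    refine (Finset.card_map e.toEmbedding).symm.trans (Eq.trans (congrArg Finset.card ?_) cf)
    ext j
    simp only [Finset.mem_filter, Finset.mem_univ, true_and, Finset.mem_map, hA]
    constructor
    · rintro ⟨i, hi, rfl⟩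
      change α (e i) ≠ β (e i)
      rw [hαe, hi]
      exact Bool.false_ne_true
    · intro hj
      have h1 := hf j
      have h2 := hg j
      have hj' : j ∈ Set.range e := by
        rw [mem_range_iff_of_orderEmbedding he he', h₀, h₁]
        revert h1 h2 hj
        cases α j <;> cases β j <;> cases δ j <;> simp
      obtain ⟨i, rfl⟩ := hj'
      refine ⟨i, ?_, rfl⟩
      rw [hαe] at hj
      simpa using hj.symm
  refine ⟨l + m, A, h, hcA, ?_, h₀, ?_, h₁⟩
  · have := card_add_card_compl' A
    omega
  · funext j
    by_cases hj : j ∈ Set.range e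
    · obtain ⟨i, rfl⟩ := hj
      rw [he]
      by_cases hi : i ∈ A
      · rw [decide_eq_true hi, (hA i).1 hi]
      · rw [decide_eq_false hi]
        have := mt (hA i).2 hi
        simpa using this
    -- Off the free coordinates of the large face, `α` and `δ` coincide, and `β` is squeezed between
    -- them.
    · have e₀ := he' j hj (fun j ↦ decide (j ∈ A)) fun _ ↦ false
      have e₁ := he' j hj (fun j ↦ decide (j ∈ A)) fun _ ↦ true
      have h1 := hf j
      have h2 := hg j
      rw [h₀] at e₀
      rw [h₁] at e₁
      rw [e₀]
      rw [e₀] at e₁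
      rw [← e₁] at h2
      exact le_antisymm h1 h2

/-! ### Natural paths and the face spanned by their end points -/

namespace NatPath

/-- Monotonicity of the path compares its two end points coordinatewise, and the order on real
vertices reflects the order on Boolean vertices. -/
theorem vertex_le {n : ℕ} {α β : Fin n → Bool} {ℓ : ℕ} (γ : NatPath n α β ℓ) : α ≤ β := by
  intro j
  have h : realVertex α j ≤ realVertex β j := by
    rw [← γ.2.2.2.2.1, ← γ.2.2.2.2.2.1]
    exact γ.2.2.2.1 (show (0 : ℝ) ≤ ℓ from Nat.cast_nonneg ℓ) j
  revert h
  unfold realVertex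
  cases α j <;> cases β j <;> norm_num

/-- The sum of the coordinates grows with speed one, so `ℓ` is the difference of the sums at the two
ends. As `α ≤ β`, each coordinate contributes 1 to this difference if it switches and 0 otherwise.
The length of a path is thus the dimension of the face spanned by its ends. -/
theorem card_ne {n : ℕ} {α β : Fin n → Bool} {ℓ : ℕ} (γ : NatPath n α β ℓ) :
    (Finset.univ.filter fun j ↦ α j ≠ β j).card = ℓ := by
  have h := γ.2.2.2.2.2.2 ⟨ℓ, Nat.cast_nonneg ℓ, le_rfl⟩
  rw [γ.2.2.2.2.2.1] at h
  have h' : ((Finset.univ.filter fun j ↦ α j ≠ β j).card : ℝ) =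
      ∑ j, (realVertex β j - realVertex α j) := by
    rw [Finset.card_filter]
    push_cast
    refine Finset.sum_congr rfl fun j _ ↦ ?_
    have hj := vertex_le γ j
    revert hj
    unfold realVertex
    cases α j <;> cases β j <;> simp
  rw [Finset.sum_sub_distrib, h] at h'
  have : ((Finset.univ.filter fun j ↦ α j ≠ β j).card : ℝ) = ℓ := by
    rw [h']
    ring
  exact_mod_cast this

/-- The `i`-th coordinate of the original path can be read off as the coordinate `e i` of its image.
-/
theorem push_injective {m n : ℕ} {f : (Fin m → Bool) → (Fin n → Bool)} (hf : IsBoxMap f)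
    {α β : Fin m → Bool} {α' β' : Fin n → Bool} {ℓ : ℕ} (hα : f α = α') (hβ : f β = β') :
    Function.Injective (push hf hα hβ : NatPath m α β ℓ → NatPath n α' β' ℓ) := by
  intro γ γ' h
  obtain ⟨e, he, -⟩ := hf.exists_orderEmbedding
  refine ext fun t ↦ funext fun i ↦ ?_
  have h₁ : realMap f (γ.1 t) (e i) = realMap f (γ'.1 t) (e i) :=
    congrArg (fun δ : NatPath n α' β' ℓ ↦ δ.1 t (e i)) h
  rwa [realMap_of_proj (fun v ↦ he v i), realMap_of_proj (fun v ↦ he v i)] at h₁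

/-- The paths between the extremal vertices of a face are paths in this face. -/
theorem exists_continuous_section {m n : ℕ} {f : (Fin m → Bool) → (Fin n → Bool)}
    (hf : IsBoxMap f) {α β : Fin n → Bool} {ℓ : ℕ} (hα : f (fun _ ↦ false) = α)
    (hβ : f (fun _ ↦ true) = β) :
    ∃ r : NatPath n α β ℓ → NatPath m (fun _ ↦ false) (fun _ ↦ true) ℓ,
      Continuous r ∧ ∀ γ, push hf hα hβ (r γ) = γ := by
  subst hα hβ
  obtain ⟨e, he, he'⟩ := hf.exists_orderEmbedding
  have key : ∀ (γ : NatPath n (f fun _ ↦ false) (f fun _ ↦ true) ℓ) (t),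
      realMap f (fun i ↦ γ.1 t (e i)) = γ.1 t := by
    intro γ t
    funext j
    by_cases h : j ∈ Set.range e
    · obtain ⟨i, rfl⟩ := h
      exact realMap_of_proj (fun v ↦ he v i) _
    · rw [realMap_of_const (ε := f (fun _ ↦ false) j) (fun v ↦ he' j h _ _)]
      -- A coordinate that is constant on the face has the same value at both ends of `γ`, so
      -- monotonicity keeps it at this value for all times.
      have h₀ : realVertex (f fun _ ↦ false) j ≤ γ.1 t j := by
        rw [← γ.2.2.2.2.1]
        exact γ.2.2.2.1 (show (0 : ℝ) ≤ t from t.2.1) j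
      have h₁ : γ.1 t j ≤ realVertex (f fun _ ↦ true) j := by
        rw [← γ.2.2.2.2.2.1]
        exact γ.2.2.2.1 (show (t : ℝ) ≤ ℓ from t.2.2) j
      unfold realVertex at h₀ h₁
      rw [he' j h (fun _ ↦ true) fun _ ↦ false] at h₁
      exact le_antisymm h₀ h₁
  -- The section is postcomposition with the projection onto the free coordinates, whence its
  -- continuity for the compact-open topologies.
  let q : C(Fin n → ℝ, Fin m → ℝ) := ⟨fun x i ↦ x (e i), by fun_prop⟩
  have hq : ∀ v : Fin m → Bool, q (realVertex (f v)) = realVertex v := by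
    intro v
    funext i
    change realVertex (f v) (e i) = realVertex v i
    unfold realVertex
    rw [he]
  refine ⟨fun γ ↦ ⟨q.comp γ.1, γ.2.1, fun t ↦ ?_, fun s t hst i ↦ γ.2.2.2.1 hst _, ?_, ?_,
    fun t ↦ ?_⟩, ?_, fun γ ↦ ext fun t ↦ key γ t⟩
  · exact ⟨fun i ↦ (γ.2.2.1 t).1 _, fun i ↦ (γ.2.2.1 t).2 _⟩
  · rw [ContinuousMap.comp_apply, γ.2.2.2.2.1, hq]
  · rw [ContinuousMap.comp_apply, γ.2.2.2.2.2.1, hq]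
  -- A box map changes the sum of the coordinates by a constant only, so unit speed in the large
  -- cube gives unit speed in the face.
  · have h₁ := sum_realMap hf (q (γ.1 t)) (realVertex fun _ ↦ false)
    have h₂ : realMap f (q (γ.1 t)) = γ.1 t := key γ t
    rw [realMap_realVertex hf, h₂, γ.2.2.2.2.2.2 t] at h₁
    rw [ContinuousMap.comp_apply]
    linarith
  · exact Continuous.subtype_mk ((ContinuousMap.continuous_postcomp q).comp
      continuous_subtype_val) _

end NatPath

/-! ### Execution paths in one cube -/

/-- The map `□[n] ⟶ K`, as a map from a sequence of length one. -/
noncomputable def singleMap {K : PrecubicalSet} {n : ℕ} (φ : (cube n).obj ⟶ K) :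
    (wedge [n]).obj ⟶ K :=
  wedgeDesc (l := []) φ ((cube n).fin ≫ φ) (Category.id_comp _).symm

theorem wedgeInl_singleMap {K : PrecubicalSet} {n : ℕ} (φ : (cube n).obj ⟶ K) :
    wedgeInl n [] ≫ singleMap φ = φ := wedgeInl_desc _ _ _

theorem ini_singleMap {K : PrecubicalSet} {n : ℕ} (φ : (cube n).obj ⟶ K) :
    (wedge [n]).ini ≫ singleMap φ = (cube n).ini ≫ φ := by
  rw [wedge_ini, Category.assoc, wedgeInl_singleMap]

/-- The second leg of `wedge [n]` is the trailing point, which the gluing identifies with the final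
vertex of the cube. A map out of `wedge [n]` is therefore determined by its restriction to the cube.
-/
theorem wedgeInr_nil_comp {K : PrecubicalSet} {n : ℕ} (f : (wedge [n]).obj ⟶ K) :
    wedgeInr n [] ≫ f = (cube n).fin ≫ wedgeInl n [] ≫ f := by
  rw [← Category.assoc, wedge_condition, Category.assoc]
  exact (Category.id_comp _).symm

theorem wedge_singleton_hom_ext {K : PrecubicalSet} {n : ℕ} {f g : (wedge [n]).obj ⟶ K}
    (h : wedgeInl n [] ≫ f = wedgeInl n [] ≫ g) : f = g :=
  wedge_hom_ext h (by rw [wedgeInr_nil_comp, wedgeInr_nil_comp, h])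

theorem fin_singleton_comp {K : PrecubicalSet} {n : ℕ} (f : (wedge [n]).obj ⟶ K) :
    (wedge [n]).fin ≫ f = (cube n).fin ≫ wedgeInl n [] ≫ f := by
  rw [← wedgeInr_nil_comp, wedge_fin, Category.assoc]
  exact Category.id_comp _

theorem fin_singleMap {K : PrecubicalSet} {n : ℕ} (φ : (cube n).obj ⟶ K) :
    (wedge [n]).fin ≫ singleMap φ = (cube n).fin ≫ φ := by
  rw [fin_singleton_comp, wedgeInl_singleMap]

theorem singleMap_comp {K L : PrecubicalSet} {n : ℕ} (φ : (cube n).obj ⟶ K) (ψ : K ⟶ L) :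
    singleMap φ ≫ ψ = singleMap (φ ≫ ψ) :=
  wedge_singleton_hom_ext (by rw [← Category.assoc, wedgeInl_singleMap, wedgeInl_singleMap])

/-- The cube chain which consists of one cube. -/
noncomputable def Chain.single {K : PrecubicalSet} {n : ℕ} (φ : (cube n).obj ⟶ K) (hn : 0 < n) :
    Chain K (yonedaEquiv ((cube n).ini ≫ φ)) (yonedaEquiv ((cube n).fin ≫ φ)) n where
  blocks := [n]
  pos k hk := by
    rw [List.mem_singleton.1 hk]
    exact hn
  sum := List.sum_singleton
  map := singleMap φ
  ini := congrArg _ (ini_singleMap φ)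
  fin := congrArg _ (fin_singleMap φ)

namespace ChainPath

variable {c : SpaceKind}

/-- The execution path given by a cube and a natural path in it. -/
noncomputable def single {K : PrecubicalSet} {n : ℕ} (φ : (cube n).obj ⟶ K)
    (γ : natSpace c n) : ChainPath c K :=
  -- Positivity of `n` is supplied by the path: membership in `NatPath` includes that the length is
  -- positive.
  mk c (n := ⟨n, γ.2.1⟩) (Chain.single φ γ.2.1)
    (Space.pair (X := natSpace c n) (Y := chainSpace c []) γ PUnit.unit)

theorem src_single {K : PrecubicalSet} {n : ℕ} (φ : (cube n).obj ⟶ K) (γ : natSpace c n) :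
    (single φ γ).1.1.1 = yonedaEquiv ((cube n).ini ≫ φ) := rfl

theorem tgt_single {K : PrecubicalSet} {n : ℕ} (φ : (cube n).obj ⟶ K) (γ : natSpace c n) :
    (single φ γ).1.1.2 = yonedaEquiv ((cube n).fin ≫ φ) := rfl

theorem continuous_single {K : PrecubicalSet} {n : ℕ} (φ : (cube n).obj ⟶ K) :
    Continuous (single φ : natSpace c n → ChainPath c K) := by
  -- The chain exists only for positive `n`; for `n = 0` the space of natural paths is empty.
  by_cases hn : 0 < n
  · have h₁ : Continuous (fun γ : natSpace c n ↦
        (Space.pair γ PUnit.unit : Space.prod (natSpace c n) (chainSpace c []))) :=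
      Space.continuous_pair continuous_id continuous_const
    have h₂ : Continuous (fun γ : natSpace c n ↦ chainPoint c (Chain.single φ hn)
        (Space.pair (X := natSpace c n) (Y := chainSpace c []) γ PUnit.unit)) :=
      (Space.continuous_fn (colimit.ι (chainDiagram c K _ _ n) (Chain.single φ hn))).comp h₁
    exact (continuous_sigmaMk (σ := fun p : (vertices K × vertices K) × ℕ+ ↦
      (chainColimit c K p.1.1 p.1.2 p.2).obj) (i := ((_, _), ⟨n, hn⟩))).comp h₂
  · exact continuous_iff_continuousAt.2 fun γ ↦ (hn γ.2.1).elim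

theorem map_single {K L : PrecubicalSet} (ψ : K ⟶ L) {n : ℕ} (φ : (cube n).obj ⟶ K)
    (γ : natSpace c n) : map c ψ (single φ γ) = single (φ ≫ ψ) γ := by
  refine (map_mk c ψ _ _).trans (mk_eq c ?_ ?_ rfl _ _ rfl (heq_of_eq (singleMap_comp φ ψ))
    HEq.rfl)
  · exact (yonedaEquiv_comp _ _).symm.trans (congrArg _ (Category.assoc _ _ _))
  · exact (yonedaEquiv_comp _ _).symm.trans (congrArg _ (Category.assoc _ _ _))

/-- The relation imposed by a morphism of cube chains in the colimit, in a form that allows the ends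
and the lengths of the two chains to be only propositionally equal. This is needed to compare a
concatenation with a single cube. -/
theorem mk_eq_of_induces {K : PrecubicalSet} {α α' β β' : vertices K} {n n' : ℕ+}
    (hα : α = α') (hβ : β = β') (hn : n = n') (a : Chain K α β n) (b : Chain K α' β' n')
    {f : (wedge a.blocks).obj ⟶ (wedge b.blocks).obj}
    {g : chainSpace c a.blocks ⟶ chainSpace c b.blocks} (hfg : Induces c f g)
    (hw : f ≫ b.map = a.map) (x : chainSpace c a.blocks) :
    mk c b (Space.fn g x) = mk c a x := by
  subst hα hβ hn
  unfold mk
  congr 1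
  exact chainPoint_eq c hfg hw x

theorem split_condition {K : PrecubicalSet} {k : ℕ} (A : Finset (Fin k))
    (φ : (cube k).obj ⟶ K) :
    yonedaEquiv ((cube A.card).fin ≫ faceHom A false ≫ φ) =
      yonedaEquiv ((cube Aᶜ.card).ini ≫ faceHom Aᶜ true ≫ φ) := by
  rw [← Category.assoc, fin_faceHom_false, Category.assoc]

/-- Both sides restrict to the same face of `φ` on each of the two cubes. This is the commutation
that makes the elementary refinement a morphism from the chain of the two faces to the chain of the
whole cube. -/
theorem stepMap_split_singleMap {K : PrecubicalSet} {k : ℕ} (A : Finset (Fin k)) (hA hB)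
    (φ : (cube k).obj ⟶ K) (h : (wedge [A.card]).fin ≫ singleMap (faceHom A false ≫ φ) =
      (wedge [Aᶜ.card]).ini ≫ singleMap (faceHom Aᶜ true ≫ φ)) :
    stepMap (.split A hA hB []) ≫ singleMap φ =
      join (singleMap (faceHom A false ≫ φ)) (singleMap (faceHom Aᶜ true ≫ φ)) h := by
  refine wedge_hom_ext (n := A.card) (l := [Aᶜ.card]) ?_ (wedge_singleton_hom_ext ?_)
  · refine Eq.trans ?_ ((wedgeInl_join (singleMap _) _ _).trans (wedgeInl_singleMap _)).symm
    rw [← Category.assoc, wedgeInl_stepMap_split, Category.assoc, wedgeInl_singleMap]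
  · refine Eq.trans ?_ ((congrArg _ (wedgeInr_join (singleMap _) _ _)).trans
      (wedgeInl_singleMap _)).symm
    rw [← Category.assoc (wedgeInr _ _), wedgeInr_stepMap_split, wedgeInl_desc_assoc,
      Category.assoc, wedgeInl_singleMap]

/-- A Moore composition of paths in two faces of a cube is a composition of execution paths. -/
theorem single_splitPath {K : PrecubicalSet} {k : ℕ} (A : Finset (Fin k))
    (φ : (cube k).obj ⟶ K) (x : natSpace c A.card) (y : natSpace c Aᶜ.card) :
    single φ (splitPath A x y) = comp c (single (faceHom A false ≫ φ) x)
      (single (faceHom Aᶜ true ≫ φ) y) (split_condition A φ) := by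
  have e := comp_mk c (m := ⟨A.card, x.2.1⟩) (n := ⟨Aᶜ.card, y.2.1⟩) (split_condition A φ)
    (Chain.single (faceHom A false ≫ φ) x.2.1) (Chain.single (faceHom Aᶜ true ≫ φ) y.2.1)
    (Space.pair (X := natSpace c A.card) (Y := chainSpace c []) x PUnit.unit)
    (Space.pair (X := natSpace c Aᶜ.card) (Y := chainSpace c []) y PUnit.unit)
  refine Eq.trans ?_ e.symm
  have hα : yonedaEquiv ((cube A.card).ini ≫ faceHom A false ≫ φ) =
      yonedaEquiv ((cube k).ini ≫ φ) := by
    rw [← Category.assoc, ini_faceHom_false]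
  have hβ : yonedaEquiv ((cube Aᶜ.card).fin ≫ faceHom Aᶜ true ≫ φ) =
      yonedaEquiv ((cube k).fin ≫ φ) := by
    rw [← Category.assoc, fin_faceHom_true]
  -- An elementary refinement requires both parts to be nonempty; this holds because the paths `x`
  -- and `y` have positive length.
  have hA : A.Nonempty := Finset.card_pos.1 x.2.1
  have hB : Aᶜ.Nonempty := Finset.card_pos.1 y.2.1
  let a := (Chain.single (faceHom A false ≫ φ) x.2.1).append (split_condition A φ)
    (PNat.add_coe ⟨A.card, x.2.1⟩ ⟨Aᶜ.card, y.2.1⟩).symm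
    (Chain.single (faceHom Aᶜ true ≫ φ) y.2.1)
  have hn : (⟨A.card, x.2.1⟩ + ⟨Aᶜ.card, y.2.1⟩ : ℕ+) = ⟨k, (splitPath A x y).2.1⟩ :=
    PNat.eq (card_add_card_compl' A)
  -- The refinement along `A` and its complement is a morphism from `a` to the one-cube chain `φ`,
  -- and the map that it induces on tuples sends `(x, y)` to `splitPath A x y`. The two points are
  -- therefore equal in the colimit.
  exact mk_eq_of_induces (c := c) hα hβ hn a (Chain.single φ (splitPath A x y).2.1)
    (Induces.step (.split A hA hB [])) (stepMap_split_singleMap A hA hB φ (Chain.map_congr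
      (Chain.single (faceHom A false ≫ φ) x.2.1) (Chain.single (faceHom Aᶜ true ≫ φ) y.2.1)
      (split_condition A φ)))
    (Space.pair (X := natSpace c A.card) (Y := chainSpace c [Aᶜ.card]) x
      (Space.pair (X := natSpace c Aᶜ.card) (Y := chainSpace c []) y PUnit.unit))

end ChainPath

/-! ### The map from the natural cube -/

/-- A morphism of the box category, as a map of precubical sets. -/
def cubeHom {m n : ℕ} (f : (⟨m⟩ : Box) ⟶ ⟨n⟩) : (cube m).obj ⟶ (cube n).obj := yoneda.map f

theorem cubeHom_comp {l m n : ℕ} (f : (⟨l⟩ : Box) ⟶ ⟨m⟩) (g : (⟨m⟩ : Box) ⟶ ⟨n⟩) :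
    cubeHom (f ≫ g) = cubeHom f ≫ cubeHom g := Functor.map_comp _ _ _

theorem yonedaEquiv_ini_cubeHom {m n : ℕ} (f : (⟨m⟩ : Box) ⟶ ⟨n⟩) :
    yonedaEquiv ((cube m).ini ≫ cubeHom f) = vertexMap n (Box.app f fun _ ↦ false) := by
  refine (congrArg yonedaEquiv (Functor.map_comp yoneda (vertexMap m _) f).symm).trans ?_
  exact yonedaEquiv_yoneda_map _

theorem yonedaEquiv_fin_cubeHom {m n : ℕ} (f : (⟨m⟩ : Box) ⟶ ⟨n⟩) :
    yonedaEquiv ((cube m).fin ≫ cubeHom f) = vertexMap n (Box.app f fun _ ↦ true) := by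
  refine (congrArg yonedaEquiv (Functor.map_comp yoneda (vertexMap m _) f).symm).trans ?_
  exact yonedaEquiv_yoneda_map _

namespace CubePath

variable {c : SpaceKind}

/-- A natural path between the extremal vertices of a cube. -/
abbrev diag {n : ℕ} (γ : natSpace c n) : CubePath n := ⟨((fun _ ↦ false, fun _ ↦ true), n), γ⟩

/-- Existence of the normal form of a path in a cube: it stays in the face spanned by its ends, the
dimension of this face is its length, and it joins the extremal vertices of this face. -/
theorem exists_map_diag (c : SpaceKind) {n : ℕ} (x : CubePath n) :
    ∃ (m : ℕ) (f : (⟨m⟩ : Box) ⟶ ⟨n⟩) (γ : natSpace c m),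
      map (Box.app_isBoxMap f) (diag γ) = x := by
  obtain ⟨⟨⟨α, β⟩, ℓ⟩, γ⟩ := x
  change NatPath n α β ℓ at γ
  obtain ⟨f, hα, hβ⟩ := exists_face (NatPath.vertex_le γ) (NatPath.card_ne γ)
  obtain ⟨r, -, hr⟩ := NatPath.exists_continuous_section (Box.app_isBoxMap f) (ℓ := ℓ) hα hβ
  subst hα hβ
  exact ⟨ℓ, f, r γ, congrArg (Sigma.mk _) (hr γ)⟩

/-- Uniqueness of the normal form: the length of the path gives the dimension, its ends are the
extremal vertices and so give the face, and the face map is injective on paths. The conclusion is an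
equality of triples because the types of the face and of the path depend on the dimension. -/
theorem map_diag_injective {n m m' : ℕ} {f : (⟨m⟩ : Box) ⟶ ⟨n⟩} {f' : (⟨m'⟩ : Box) ⟶ ⟨n⟩}
    {γ : natSpace c m} {γ' : natSpace c m'}
    (h : map (Box.app_isBoxMap f) (diag γ) = map (Box.app_isBoxMap f') (diag γ')) :
    (⟨m, f, γ⟩ : Σ m, Σ _ : ((⟨m⟩ : Box) ⟶ ⟨n⟩), natSpace c m) = ⟨m', f', γ'⟩ := by
  have h₁ := congrArg Sigma.fst h
  obtain rfl : m = m' := congrArg Prod.snd h₁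
  obtain rfl : f = f' := Box.hom_ext_extremal (congrArg (fun p ↦ p.1.1) h₁)
    (congrArg (fun p ↦ p.1.2) h₁)
  obtain rfl : γ = γ' := NatPath.push_injective (Box.app_isBoxMap f) rfl rfl
    (eq_of_heq (Sigma.mk.inj h).2)
  rfl

/-- The image of an execution path of the natural cube in the realization by cube chains. -/
noncomputable def toChainPath (c : SpaceKind) {n : ℕ} (x : CubePath n) :
    ChainPath c (cube n).obj :=
  ChainPath.single (c := c) (cubeHom (exists_map_diag c x).choose_spec.choose)
    (exists_map_diag c x).choose_spec.choose_spec.choose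

/-- Uniqueness of the normal form makes the choices in `toChainPath` harmless. The later properties
of `toChainPath` are deduced from this formula. -/
theorem toChainPath_map_diag {m n : ℕ} (f : (⟨m⟩ : Box) ⟶ ⟨n⟩) (γ : natSpace c m) :
    toChainPath c (map (Box.app_isBoxMap f) (diag γ)) = ChainPath.single (cubeHom f) γ :=
  congrArg (fun p : Σ m, Σ _ : ((⟨m⟩ : Box) ⟶ ⟨n⟩), natSpace c m ↦
    (ChainPath.single (cubeHom p.2.1 : (cube p.1).obj ⟶ (cube n).obj) p.2.2 :
      ChainPath c (cube n).obj))
    (map_diag_injective (exists_map_diag c _).choose_spec.choose_spec.choose_spec)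

theorem continuous_toChainPath (n : ℕ) :
    Continuous (toChainPath c : CubePath n → ChainPath c (cube n).obj) := by
  rw [continuous_sigma_iff]
  rintro ⟨⟨α, β⟩, ℓ⟩
  by_cases h : Nonempty (NatPath n α β ℓ)
  · obtain ⟨γ₀⟩ := h
    obtain ⟨f, hα, hβ⟩ := exists_face (NatPath.vertex_le γ₀) (NatPath.card_ne γ₀)
    obtain ⟨r, hc, hr⟩ := NatPath.exists_continuous_section (Box.app_isBoxMap f) (ℓ := ℓ) hα hβ
    subst hα hβ
    -- On a nonempty component the face `f` can be fixed once and for all; only its diagonal path `r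
    -- γ` varies, and it varies continuously.
    have : (fun γ ↦ toChainPath c ⟨((Box.app f fun _ ↦ false, Box.app f fun _ ↦ true), ℓ), γ⟩ :
        NatPath n (Box.app f fun _ ↦ false) (Box.app f fun _ ↦ true) ℓ →
          ChainPath c (cube n).obj) = fun γ ↦ ChainPath.single (cubeHom f) (r γ) := by
      funext γ
      refine Eq.trans ?_ (toChainPath_map_diag f (r γ))
      exact congrArg _ (congrArg (Sigma.mk _) (hr γ).symm)
    rw [this]
    exact (ChainPath.continuous_single _).comp hc
  · exact continuous_iff_continuousAt.2 fun γ ↦ (h ⟨γ⟩).elim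

/-- A face of a face is a face: if `x` has the normal form `(g, γ)`, then its image under `f` has
the normal form `(g ≫ f, γ)`. -/
theorem toChainPath_map {m n : ℕ} (f : (⟨m⟩ : Box) ⟶ ⟨n⟩) (x : CubePath m) :
    toChainPath c (map (Box.app_isBoxMap f) x) =
      ChainPath.map c (cubeHom f) (toChainPath c x) := by
  obtain ⟨k, g, γ, rfl⟩ := exists_map_diag c x
  have e : map (Box.app_isBoxMap f) (map (Box.app_isBoxMap g) (diag γ)) =
      map (Box.app_isBoxMap (g ≫ f)) (diag γ) :=
    ext rfl fun t ht ht' ↦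
      (realMap_comp (Box.app_isBoxMap g) (Box.app_isBoxMap f) _).symm
  rw [e, toChainPath_map_diag, toChainPath_map_diag, cubeHom_comp]
  exact (ChainPath.map_single _ _ _).symm

theorem src_toChainPath {n : ℕ} (x : CubePath n) :
    (toChainPath c x).1.1.1 = vertexMap n x.1.1.1 := by
  obtain ⟨k, g, γ, rfl⟩ := exists_map_diag c x
  rw [toChainPath_map_diag, ChainPath.src_single, yonedaEquiv_ini_cubeHom]
  rfl

theorem tgt_toChainPath {n : ℕ} (x : CubePath n) :
    (toChainPath c x).1.1.2 = vertexMap n x.1.1.2 := by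
  obtain ⟨k, g, γ, rfl⟩ := exists_map_diag c x
  rw [toChainPath_map_diag, ChainPath.tgt_single, yonedaEquiv_fin_cubeHom]
  rfl

/-- The normal form of a composite of paths in two complementary faces of `h`. The two sides agree
before and after the time `A.card`, by functoriality of `realMap`. -/
theorem comp_map_diag {n k : ℕ} (A : Finset (Fin k)) (h : (⟨k⟩ : Box) ⟶ ⟨n⟩)
    (x : natSpace c A.card) (y : natSpace c Aᶜ.card)
    (hxy : (map (Box.app_isBoxMap (faceMap A false ≫ h)) (diag x)).1.1.2 =
      (map (Box.app_isBoxMap (faceMap Aᶜ true ≫ h)) (diag y)).1.1.1) :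
    comp (map (Box.app_isBoxMap (faceMap A false ≫ h)) (diag x))
      (map (Box.app_isBoxMap (faceMap Aᶜ true ≫ h)) (diag y)) hxy =
      map (Box.app_isBoxMap h) (diag (splitPath A x y)) := by
  refine ext (Prod.ext (Prod.ext ?_ ?_) (card_add_card_compl' A)) fun t ht ht' ↦ ?_
  · refine congrArg (Box.app h) ((app_faceMap_const A false false).trans ?_)
    simp
  · refine congrArg (Box.app h) ((app_faceMap_const Aᶜ true true).trans ?_)
    simp
  · change NatPath.mooreFun _ _ t =
      realMap (Box.app h) (NatPath.mooreFun (lowerPath A x).1 (upperPath A y).1 t)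
    rcases le_or_gt t (A.card : ℝ) with h' | h'
    · rw [NatPath.mooreFun_of_le _ _ h']
      refine (NatPath.mooreFun_of_le _ _ h').trans ?_
      exact realMap_comp (Box.app_isBoxMap _) (Box.app_isBoxMap h) _
    · rw [NatPath.mooreFun_of_lt _ _ h']
      refine (NatPath.mooreFun_of_lt _ _ h').trans ?_
      exact realMap_comp (Box.app_isBoxMap _) (Box.app_isBoxMap h) _

/-- The faces of two composable paths are complementary faces of a third face. There the composite
has the normal form given by `splitPath`, and the relation of the colimit in
`ChainPath.single_splitPath` turns it into a composite of chain paths. -/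
theorem toChainPath_comp {n : ℕ} (x y : CubePath n) (h : x.1.1.2 = y.1.1.1) :
    toChainPath c (comp x y h) = ChainPath.comp c (toChainPath c x) (toChainPath c y)
      ((tgt_toChainPath x).trans ((congrArg _ h).trans (src_toChainPath y).symm)) := by
  obtain ⟨l, f, γ, rfl⟩ := exists_map_diag c x
  obtain ⟨m, g, γ', rfl⟩ := exists_map_diag c y
  obtain ⟨k, A, φ, rfl, rfl, h₀, h₁, h₂⟩ := exists_split f g h
  -- Since a face is determined by its extremal vertices, `f` and then `g` are identified with the
  -- two complementary faces of `φ`.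
  obtain rfl : f = faceMap A false ≫ φ := by
    refine Box.hom_ext_extremal ?_ ?_
    · rw [Box.app_comp, app_faceMap_const, ← h₀]
      simp
    · rw [Box.app_comp, app_faceMap_const, ← h₁]
      exact congrArg _ (funext fun j ↦ by by_cases hj : j ∈ A <;> simp [hj])
  obtain rfl : g = faceMap Aᶜ true ≫ φ := by
    refine Box.hom_ext_extremal ?_ ?_
    · rw [Box.app_comp, app_faceMap_const]
      refine (h.symm.trans h₁.symm).trans (congrArg _ (funext fun j ↦ ?_))
      by_cases hj : j ∈ A <;> simp [hj]
    · rw [Box.app_comp, app_faceMap_const, ← h₂]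
      simp
  rw [comp_map_diag, toChainPath_map_diag, ChainPath.single_splitPath]
  have e₁ := toChainPath_map_diag (faceMap A false ≫ φ) γ
  have e₂ := toChainPath_map_diag (faceMap Aᶜ true ≫ φ) γ'
  rw [cubeHom_comp] at e₁ e₂
  simp only [e₁, e₂]
  rfl

end CubePath

/-- The map from the natural `n`-cube to the realization of `□[n]` by cube chains. -/
noncomputable def cubeUnit (c : SpaceKind) : natCube c ⟶ yoneda ⋙ cubeChainRealization c where
  app X :=
    { state := vertexMap X.dim
      path := CubePath.toChainPath c
      path_cont := CubePath.continuous_toChainPath X.dim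
      src_path := CubePath.src_toChainPath
      tgt_path := CubePath.tgt_toChainPath
      path_comp := CubePath.toChainPath_comp }
  naturality X Y f := Flow.hom_ext (fun v ↦ rfl) fun x ↦ CubePath.toChainPath_map f x

theorem cubeHom_id (n : ℕ) : cubeHom (𝟙 (⟨n⟩ : Box)) = 𝟙 (cube n).obj :=
  CategoryTheory.Functor.map_id yoneda _

/-- The face of a diagonal path is the whole cube. Consequently the one-cube paths of ‖K‖ come from
the natural cubes through the unit, which is what the uniqueness argument uses. -/
theorem ChainPath.map_toChainPath_diag {c : SpaceKind} {K : PrecubicalSet} {n : ℕ}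
    (φ : (cube n).obj ⟶ K) (γ : natSpace c n) :
    ChainPath.map c φ (CubePath.toChainPath c (CubePath.diag γ)) = ChainPath.single φ γ := by
  have e : CubePath.diag γ = CubePath.map (Box.app_isBoxMap (𝟙 ⟨n⟩)) (CubePath.diag γ) :=
    CubePath.ext rfl fun t ht ht' ↦ (realMap_id _).symm
  rw [e, CubePath.toChainPath_map_diag, cubeHom_id, ChainPath.map_single, Category.id_comp]

/-! ### The universal property of the realization by cube chains -/

/-- A compatible family of maps from the natural cubes of a precubical set to a flow. -/
structure CubeCocone {c : SpaceKind} (K : PrecubicalSet) (X : Flow c) where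
  app : ∀ {n : ℕ}, ((cube n).obj ⟶ K) → (natCubeFlow c n ⟶ X)
  w : ∀ {m n : ℕ} (f : (⟨m⟩ : Box) ⟶ ⟨n⟩) (φ : (cube n).obj ⟶ K),
    app (cubeHom f ≫ φ) = (natCube c).map f ≫ app φ

namespace CubeCocone

variable {c : SpaceKind} {K : PrecubicalSet} {X : Flow c} (s : CubeCocone K X)

/-! ### States and values of a compatible family -/

theorem state_app_map {m n : ℕ} (f : (⟨m⟩ : Box) ⟶ ⟨n⟩) (φ : (cube n).obj ⟶ K)
    (v : Fin m → Bool) :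
    Flow.Hom.state (s.app (cubeHom f ≫ φ)) v = Flow.Hom.state (s.app φ) (Box.app f v) :=
  congrArg (fun g ↦ Flow.Hom.state g v) (s.w f φ)

theorem path_app_map {m n : ℕ} (f : (⟨m⟩ : Box) ⟶ ⟨n⟩) (φ : (cube n).obj ⟶ K)
    (x : CubePath m) : Flow.Hom.path (s.app (cubeHom f ≫ φ)) x =
      Flow.Hom.path (s.app φ) (CubePath.map (Box.app_isBoxMap f) x) :=
  congrArg (fun g ↦ Flow.Hom.path g x) (s.w f φ)

/-- The state given by a vertex. -/
def state (α : vertices K) : X.State :=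
  Flow.Hom.state (s.app (n := 0) (yonedaEquiv.symm α)) fun _ ↦ false

theorem state_yonedaEquiv (φ : (cube 0).obj ⟶ K) (v : Fin 0 → Bool) :
    s.state (yonedaEquiv φ) = Flow.Hom.state (s.app φ) v := by
  unfold state
  rw [Subsingleton.elim v fun _ ↦ false]
  congr 2
  exact yonedaEquiv.symm_apply_apply φ

/-- Compatibility along the inclusion of the vertex `v` reduces everything to 0-cubes: on states,
the family amounts to one map on the vertices of `K`. -/
theorem state_app {n : ℕ} (φ : (cube n).obj ⟶ K) (v : Fin n → Bool) :
    Flow.Hom.state (s.app φ) v = s.state (yonedaEquiv (cubeHom (vertexMap n v) ≫ φ)) :=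
  ((s.state_yonedaEquiv _ fun _ ↦ false).trans (s.state_app_map (vertexMap n v) φ _)).symm

/-- The value on a natural path in a cube. -/
def value {n : ℕ} (φ : (cube n).obj ⟶ K) (γ : natSpace c n) : X.Path :=
  Flow.Hom.path (s.app φ) (CubePath.diag γ)

theorem src_value {n : ℕ} (φ : (cube n).obj ⟶ K) (γ : natSpace c n) :
    X.src (s.value φ γ) = s.state (yonedaEquiv ((cube n).ini ≫ φ)) :=
  (Flow.Hom.src_path (s.app φ) _).trans (s.state_app φ _)

theorem tgt_value {n : ℕ} (φ : (cube n).obj ⟶ K) (γ : natSpace c n) :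
    X.tgt (s.value φ γ) = s.state (yonedaEquiv ((cube n).fin ≫ φ)) :=
  (Flow.Hom.tgt_path (s.app φ) _).trans (s.state_app φ _)

theorem continuous_value {n : ℕ} (φ : (cube n).obj ⟶ K) :
    Continuous (s.value φ : natSpace c n → X.Path) :=
  (Flow.Hom.path_cont (s.app φ)).comp (continuous_sigmaMk (σ := fun
    p : ((Fin n → Bool) × (Fin n → Bool)) × ℕ ↦ NatPath n p.1.1 p.1.2 p.2)
      (i := ((fun _ ↦ false, fun _ ↦ true), n)))

theorem tgt_value_split {k : ℕ} (A : Finset (Fin k)) (φ : (cube k).obj ⟶ K)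
    (x : natSpace c A.card) (y : natSpace c Aᶜ.card) :
    X.tgt (s.value (faceHom A false ≫ φ) x) = X.src (s.value (faceHom Aᶜ true ≫ φ) y) := by
  rw [tgt_value, src_value, ChainPath.split_condition]

/-- In the natural cube, `splitPath A x y` is the composite of the images of `x` and `y` in two
faces. The morphism of flows attached to `φ` preserves this composite, and compatibility of the
family evaluates it on each face. -/
theorem value_splitPath {k : ℕ} (A : Finset (Fin k)) (φ : (cube k).obj ⟶ K)
    (x : natSpace c A.card) (y : natSpace c Aᶜ.card) :
    s.value φ (splitPath A x y) =
      X.comp (s.value (faceHom A false ≫ φ) x) (s.value (faceHom Aᶜ true ≫ φ) y)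
        (s.tgt_value_split A φ x y) := by
  have hxy : (CubePath.map (Box.app_isBoxMap (faceMap A false)) (CubePath.diag x)).1.1.2 =
      (CubePath.map (Box.app_isBoxMap (faceMap Aᶜ true)) (CubePath.diag y)).1.1.1 := by
    refine (app_faceMap_const A false true).trans (Eq.trans (funext fun j ↦ ?_)
      (app_faceMap_const Aᶜ true false).symm)
    by_cases hj : j ∈ A <;> simp [hj]
  have e : CubePath.diag (splitPath A x y) = CubePath.comp
      (CubePath.map (Box.app_isBoxMap (faceMap A false)) (CubePath.diag x))
      (CubePath.map (Box.app_isBoxMap (faceMap Aᶜ true)) (CubePath.diag y)) hxy := by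
    -- The third face is here the whole cube, hence the identity map.
    refine Eq.trans ?_ (CubePath.comp_map_diag A (𝟙 _) x y hxy).symm
    exact CubePath.ext rfl fun t ht ht' ↦ (realMap_id _).symm
  refine (congrArg (Flow.Hom.path (s.app φ)) e).trans
    ((Flow.Hom.path_comp (s.app φ)
      (CubePath.map (Box.app_isBoxMap (faceMap A false)) (CubePath.diag x))
      (CubePath.map (Box.app_isBoxMap (faceMap Aᶜ true)) (CubePath.diag y)) hxy).trans (Flow.comp_congr ?_ ?_ _))
  · exact (s.path_app_map (faceMap A false) φ _).symm
  · exact (s.path_app_map (faceMap Aᶜ true) φ _).symm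

/-! ### Evaluation of a tuple of paths in a flow -/

theorem fin_eq_ini_comp {n : ℕ} {l : List ℕ} (f : (wedge (n :: l)).obj ⟶ K) :
    (cube n).fin ≫ wedgeInl n l ≫ f = (wedge l).ini ≫ wedgeInr n l ≫ f := by
  rw [← Category.assoc, wedge_condition, Category.assoc]

/-- The composite of the values on the paths of a tuple. -/
noncomputable def eval : ∀ (l : List ℕ) (_ : l ≠ []) (f : (wedge l).obj ⟶ K) (_ : chainSpace c l),
    {x : X.Path // X.src x = s.state (yonedaEquiv ((wedge l).ini ≫ f)) ∧
      X.tgt x = s.state (yonedaEquiv ((wedge l).fin ≫ f))}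
  -- Flows have no identity paths, so an empty tuple has no value, and the recursion has to stop at
  -- one cube. The ends are carried along with the value because each composite needs the source of
  -- the tail.
  | [], h, _, _ => (h rfl).elim
  | [n], _, f, p =>
    ⟨s.value (wedgeInl n [] ≫ f) (Space.fst (X := natSpace c n) p),
      by rw [src_value, wedge_ini, Category.assoc],
      by rw [tgt_value, fin_singleton_comp]⟩
  | n :: m :: l, _, f, p =>
    ⟨X.comp (s.value (wedgeInl n (m :: l) ≫ f) (Space.fst (X := natSpace c n) p))
        (eval (m :: l) (List.cons_ne_nil _ _) (wedgeInr n (m :: l) ≫ f)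
          (Space.snd (X := natSpace c n) p)).1
        (by rw [tgt_value, (eval (m :: l) _ _ _).2.1, fin_eq_ini_comp]),
      by rw [X.src_comp, src_value, wedge_ini n, Category.assoc],
      by rw [X.tgt_comp, (eval (m :: l) _ _ _).2.2, wedge_fin n, Category.assoc]⟩

theorem tgt_value_eval {n : ℕ} {l : List ℕ} (hl : l ≠ []) (f : (wedge (n :: l)).obj ⟶ K)
    (x : natSpace c n) (y : chainSpace c l) : X.tgt (s.value (wedgeInl n l ≫ f) x) =
      X.src (s.eval l hl (wedgeInr n l ≫ f) y).1 := by
  rw [tgt_value, (s.eval l hl _ _).2.1, fin_eq_ini_comp]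

/-- A single recursion formula for a nonempty tail, so that inductions on the list only have to
distinguish whether the tail is empty. -/
theorem eval_cons {n : ℕ} {l : List ℕ} (hl : l ≠ []) (hl' : n :: l ≠ [])
    (f : (wedge (n :: l)).obj ⟶ K) (p : chainSpace c (n :: l)) :
    (s.eval (n :: l) hl' f p).1 =
      X.comp (s.value (wedgeInl n l ≫ f) (Space.fst (X := natSpace c n) p))
        (s.eval l hl (wedgeInr n l ≫ f) (Space.snd (X := natSpace c n) p)).1
        (s.tgt_value_eval hl f _ _) := by
  cases l with
  | nil => exact (hl rfl).elim
  | cons m l => rfl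

theorem eval_congr {l : List ℕ} (hl : l ≠ []) {f f' : (wedge l).obj ⟶ K} (h : f = f')
    (p : chainSpace c l) : (s.eval l hl f p).1 = (s.eval l hl f' p).1 := by
  rw [h]

theorem value_congr {n : ℕ} {φ φ' : (cube n).obj ⟶ K} (h : φ = φ') (γ : natSpace c n) :
    s.value φ γ = s.value φ' γ := by
  rw [h]

theorem continuous_eval (l : List ℕ) (hl : l ≠ []) (f : (wedge l).obj ⟶ K) :
    Continuous (fun p : chainSpace c l ↦ (s.eval l hl f p).1) := by
  induction l with
  | nil => exact (hl rfl).elim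
  | cons n l ih =>
    have h₁ : Continuous (fun p : chainSpace c (n :: l) ↦
        s.value (wedgeInl n l ≫ f) (Space.fst (X := natSpace c n) p)) :=
      (s.continuous_value _).comp Space.continuous_fst
    by_cases h : l = []
    · subst h
      exact h₁
    · have h₂ : Continuous (fun p : chainSpace c (n :: l) ↦
          (s.eval l h (wedgeInr n l ≫ f) (Space.snd (X := natSpace c n) p)).1) :=
        (ih h _).comp Space.continuous_snd
      simp only [s.eval_cons h]
      -- Composition in `X` is only continuous on Euclidean plots of the fibre product. This
      -- suffices because the space of tuples is `Δ`-generated.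
      refine DeltaContinuous.continuous fun k q ↦ ?_
      exact X.comp_cont ⟨fun t ↦ ⟨(_, _), s.tgt_value_eval h f
        (Space.fst (X := natSpace c n) (q t)) (Space.snd (X := natSpace c n) (q t))⟩,
        ((h₁.comp q.continuous).prodMk (h₂.comp q.continuous)).subtype_mk _⟩

/-- Invariance under an elementary refinement: at the refined cube, `value_splitPath` replaces one
value by a composite of two, and associativity in `X` moves the brackets to the tail. -/
theorem eval_stepPath {l l' : List ℕ} (t : Step l l') (hl : l ≠ []) (hl' : l' ≠ [])
    (f : (wedge l').obj ⟶ K) (p : chainSpace c l) :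
    (s.eval l' hl' f (Space.fn (stepPath c t) p)).1 = (s.eval l hl (stepMap t ≫ f) p).1 := by
  induction t with
  | @split k A hA hB l =>
    have e₁ : wedgeInl A.card (Aᶜ.card :: l) ≫ stepMap (.split A hA hB l) ≫ f =
        faceHom A false ≫ wedgeInl k l ≫ f := by
      rw [← Category.assoc, wedgeInl_stepMap_split, Category.assoc]
    have e₂ : wedgeInl Aᶜ.card l ≫ wedgeInr A.card (Aᶜ.card :: l) ≫
        stepMap (.split A hA hB l) ≫ f = faceHom Aᶜ true ≫ wedgeInl k l ≫ f := by
      rw [← Category.assoc (wedgeInr _ _), wedgeInr_stepMap_split, wedgeInl_desc_assoc,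
        Category.assoc]
    have e₃ : wedgeInr Aᶜ.card l ≫ wedgeInr A.card (Aᶜ.card :: l) ≫
        stepMap (.split A hA hB l) ≫ f = wedgeInr k l ≫ f := by
      rw [← Category.assoc (wedgeInr A.card _), wedgeInr_stepMap_split, wedgeInr_desc_assoc]
    have hs := s.value_splitPath A (wedgeInl k l ≫ f) (Space.fst (X := natSpace c A.card) p)
      (Space.fst (X := natSpace c Aᶜ.card) (Space.snd (X := natSpace c A.card) p))
    rw [s.eval_cons (List.cons_ne_nil _ _) hl]
    -- If no cube follows the refined one, there is nothing to rebracket.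
    by_cases h : l = []
    · subst h
      refine hs.trans (Flow.comp_congr ?_ ?_ _)
      · exact s.value_congr e₁.symm _
      · exact s.value_congr e₂.symm _
    · rw [s.eval_cons h]
      refine (Flow.comp_congr hs rfl _).trans ?_
      refine (X.assoc _ _ _ (s.tgt_value_split A _ _ _) ?_).trans
        (Flow.comp_congr (s.value_congr e₁.symm _) ?_ _)
      · rw [tgt_value, (s.eval l h _ _).2.1, ← fin_eq_ini_comp, ← Category.assoc,
          fin_faceHom_true]
      · rw [s.eval_cons h]
        exact Flow.comp_congr (s.value_congr e₂.symm _) (s.eval_congr h e₃.symm _) _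
  | @cons n l l' t ih =>
    -- Both ends of an elementary refinement contain at least one cube, so both tails have a value.
    have hne : l ≠ [] ∧ l' ≠ [] := by cases t <;> simp
    have e₁ : wedgeInl n l ≫ stepMap (.cons n t) ≫ f = wedgeInl n l' ≫ f := by
      rw [← Category.assoc, wedgeInl_stepMap_cons]
    have e₂ : wedgeInr n l ≫ stepMap (.cons n t) ≫ f = stepMap t ≫ wedgeInr n l' ≫ f := by
      rw [← Category.assoc, wedgeInr_stepMap_cons, Category.assoc]
    rw [s.eval_cons hne.1, s.eval_cons hne.2]
    refine Flow.comp_congr (s.value_congr e₁.symm _) ?_ _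
    exact (ih hne.1 hne.2 _ _).trans (s.eval_congr hne.1 e₂.symm _)

/-- Needed for a composite of refinements, where the intermediate sequence must be known to be
nonempty before a tuple over it can be evaluated. -/
theorem _root_.PrecubicalFlow.Induces.ne_nil_iff {l l' : List ℕ}
    {f : (wedge l).obj ⟶ (wedge l').obj} {g : chainSpace c l ⟶ chainSpace c l'}
    (h : Induces c f g) : l ≠ [] ↔ l' ≠ [] := by
  induction h with
  | id l => rfl
  | step t => cases t <;> simp
  | comp _ _ ih₁ ih₂ => exact ih₁.trans ih₂

theorem eval_induces {l l' : List ℕ} {f : (wedge l).obj ⟶ (wedge l').obj}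
    {g : chainSpace c l ⟶ chainSpace c l'} (hfg : Induces c f g) (hl : l ≠ []) (hl' : l' ≠ [])
    (u : (wedge l').obj ⟶ K) (p : chainSpace c l) :
    (s.eval l' hl' u (Space.fn g p)).1 = (s.eval l hl (f ≫ u) p).1 := by
  induction hfg with
  | id l => exact s.eval_congr hl (Category.id_comp u).symm p
  | step t => exact s.eval_stepPath t hl hl' u p
  | comp h₁ h₂ ih₁ ih₂ =>
    have hm := h₁.ne_nil_iff.1 hl
    refine (ih₂ hm hl' u _).trans ((ih₁ hl hm _ p).trans ?_)
    exact s.eval_congr hl (Category.assoc _ _ _).symm p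

theorem tgt_eval_eq {l₁ l₂ : List ℕ} (h₁ : l₁ ≠ []) (h₂ : l₂ ≠ []) (f : (wedge l₁).obj ⟶ K)
    (g : (wedge l₂).obj ⟶ K) (h : (wedge l₁).fin ≫ f = (wedge l₂).ini ≫ g)
    (x : chainSpace c l₁) (y : chainSpace c l₂) :
    X.tgt (s.eval l₁ h₁ f x).1 = X.src (s.eval l₂ h₂ g y).1 := by
  rw [(s.eval l₁ h₁ f x).2.2, (s.eval l₂ h₂ g y).2.1, h]

/-- Generalized associativity: the value of the concatenation is bracketed to the right, and
induction on the first sequence regroups it at the point of concatenation. -/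
theorem eval_appendPoint {l₁ l₂ : List ℕ} (h₁ : l₁ ≠ []) (h₂ : l₂ ≠ []) (h₁₂ : l₁ ++ l₂ ≠ [])
    (f : (wedge l₁).obj ⟶ K) (g : (wedge l₂).obj ⟶ K)
    (h : (wedge l₁).fin ≫ f = (wedge l₂).ini ≫ g) (x : chainSpace c l₁)
    (y : chainSpace c l₂) : (s.eval (l₁ ++ l₂) h₁₂ (join f g h) (appendPoint x y)).1 =
      X.comp (s.eval l₁ h₁ f x).1 (s.eval l₂ h₂ g y).1 (s.tgt_eval_eq h₁ h₂ f g h x y) := by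
  induction l₁ with
  | nil => exact (h₁ rfl).elim
  | cons n l ih =>
    have hne : l ++ l₂ ≠ [] := List.append_ne_nil_of_right_ne_nil _ h₂
    refine (s.eval_cons (l := l ++ l₂) hne _ _ _).trans ?_
    by_cases hl : l = []
    · subst hl
      exact Flow.comp_congr (s.value_congr (wedgeInl_join f g h) _)
        (s.eval_congr h₂ (wedgeInr_join f g h) _) _
    · refine (Flow.comp_congr (s.value_congr (wedgeInl_join f g h) _)
        ((s.eval_congr hne (wedgeInr_join f g h) _).trans (ih hl hne _ _ _)) _).trans ?_
      refine (X.assoc _ _ _ ?_ ?_).symm.trans ?_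
      · exact s.tgt_value_eval hl f _ _
      · exact Flow.comp_congr (s.eval_cons hl h₁ f x).symm rfl _

/-- The restriction to lengths `n ≥ 1` excludes the empty chain, the only one on which `eval` is not
defined. -/
theorem _root_.PrecubicalFlow.Chain.blocks_ne_nil {α β : vertices K} {n : ℕ+}
    (a : Chain K α β n) : a.blocks ≠ [] := by
  intro h
  have := a.sum
  rw [h] at this
  exact n.pos.ne this

/-! ### The induced morphism of flows -/

/-- The map on a space of execution paths of the realization by cube chains. -/
noncomputable def descColimit (α β : vertices K) (n : ℕ+) :
    chainColimit c K α β n ⟶ X.Path :=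
  colimit.desc (chainDiagram c K α β n)
    { pt := X.Path
      ι :=
        { app := fun a ↦ Space.mkHom (X := chainSpace c a.blocks)
            (fun p ↦ (s.eval a.blocks a.blocks_ne_nil a.map p).1) (s.continuous_eval _ _ _)
          naturality := fun a b f ↦ Space.hom_ext fun p ↦
            (s.eval_induces (induces_chainDiagram f) a.blocks_ne_nil b.blocks_ne_nil b.map
              p).trans (s.eval_congr _ (Chain.Hom.w f) p) } }

theorem descColimit_point {α β : vertices K} {n : ℕ+} (a : Chain K α β n)
    (x : chainSpace c a.blocks) : Space.fn (s.descColimit α β n) (chainPoint c a x) =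
      (s.eval a.blocks a.blocks_ne_nil a.map x).1 :=
  Space.fn_colimit_desc (chainDiagram c K α β n) _ a x

/-- The map on execution paths of the realization by cube chains. -/
noncomputable def descPath (x : ChainPath c K) : X.Path :=
  Space.fn (s.descColimit x.1.1.1 x.1.1.2 x.1.2) x.2

theorem descPath_mk {α β : vertices K} {n : ℕ+} (a : Chain K α β n)
    (x : chainSpace c a.blocks) :
    s.descPath (ChainPath.mk c a x) = (s.eval a.blocks a.blocks_ne_nil a.map x).1 :=
  s.descColimit_point a x

theorem src_descPath (x : ChainPath c K) : X.src (s.descPath x) = s.state x.1.1.1 := by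
  obtain ⟨α, β, n, a, p, rfl⟩ := ChainPath.exists_mk c x
  rw [descPath_mk, (s.eval _ _ _ _).2.1, a.ini]
  rfl

theorem tgt_descPath (x : ChainPath c K) : X.tgt (s.descPath x) = s.state x.1.1.2 := by
  obtain ⟨α, β, n, a, p, rfl⟩ := ChainPath.exists_mk c x
  rw [descPath_mk, (s.eval _ _ _ _).2.2, a.fin]
  rfl

theorem descPath_comp (x y : ChainPath c K) (h : x.1.1.2 = y.1.1.1) :
    s.descPath (ChainPath.comp c x y h) = X.comp (s.descPath x) (s.descPath y)
      ((s.tgt_descPath x).trans ((congrArg s.state h).trans (s.src_descPath y).symm)) := by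
  obtain ⟨α, β, m, a, p, rfl⟩ := ChainPath.exists_mk c x
  obtain ⟨β', γ, n, b, q, rfl⟩ := ChainPath.exists_mk c y
  refine (congrArg s.descPath (ChainPath.comp_mk c h a b p q)).trans ?_
  refine (s.descPath_mk (n := m + n) _ _).trans ?_
  refine (s.eval_appendPoint a.blocks_ne_nil b.blocks_ne_nil _ a.map b.map _ p q).trans ?_
  exact Flow.comp_congr (s.descPath_mk a p).symm (s.descPath_mk b q).symm _

/-- The map of flows induced by a compatible family. -/
noncomputable def desc : chainFlow c K ⟶ X where
  state := s.state
  path := s.descPath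
  path_cont := continuous_sigma_iff.2 fun i ↦
    Space.continuous_fn (s.descColimit i.1.1 i.1.2 i.2)
  src_path := s.src_descPath
  tgt_path := s.tgt_descPath
  path_comp := s.descPath_comp

/-! ### Factorization and uniqueness -/

theorem descPath_single {n : ℕ} (φ : (cube n).obj ⟶ K) (γ : natSpace c n) :
    s.descPath (ChainPath.single φ γ) = s.value φ γ :=
  (s.descPath_mk (n := ⟨n, γ.2.1⟩) _ _).trans (s.value_congr (wedgeInl_singleMap φ) γ)

theorem _root_.PrecubicalFlow.app_vertexMap {n : ℕ} (φ : (cube n).obj ⟶ K) (v : Fin n → Bool) :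
    φ.app (op ⟨0⟩) (vertexMap n v) = yonedaEquiv (cubeHom (vertexMap n v) ≫ φ) :=
  Eq.trans (congrArg (φ.app _) (yonedaEquiv_yoneda_map (vertexMap n v)).symm)
    (yonedaEquiv_comp (cubeHom (vertexMap n v)) φ).symm

/-- On paths it is enough to use normal forms: the path of the face `f` given by `γ` becomes the
one-cube path of `cubeHom f ≫ φ`, whose value is prescribed by the compatibility of the family. -/
theorem fac {n : ℕ} (φ : (cube n).obj ⟶ K) :
    (cubeUnit c).app ⟨n⟩ ≫ (cubeChainRealization c).map φ ≫ s.desc = s.app φ := by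
  refine Flow.hom_ext (fun v ↦ ?_) fun x ↦ ?_
  · refine Eq.trans ?_ (s.state_app φ v).symm
    exact congrArg s.state (app_vertexMap φ v)
  · obtain ⟨m, f, γ, rfl⟩ := CubePath.exists_map_diag c x
    refine Eq.trans ?_ (s.path_app_map f φ (CubePath.diag γ))
    refine Eq.trans ?_ (s.descPath_single (cubeHom f ≫ φ) γ)
    refine congrArg s.descPath ?_
    refine (congrArg (ChainPath.map c φ) (CubePath.toChainPath_map_diag f γ)).trans ?_
    exact ChainPath.map_single φ (cubeHom f) γ

/-- The recorded ends and length of a chain are forced by its underlying map, and that map is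
determined by its restriction to the only cube. -/
theorem _root_.PrecubicalFlow.ChainPath.mk_singleton {α β : vertices K} {N : ℕ+} {n : ℕ}
    (hp hs) (f : (wedge [n]).obj ⟶ K) (hi hf) (x : chainSpace c [n]) :
    ChainPath.mk c (⟨[n], hp, hs, f, hi, hf⟩ : Chain K α β N) x =
      ChainPath.single (wedgeInl n [] ≫ f) (Space.fst (X := natSpace c n) x) := by
  refine ChainPath.mk_eq c ?_ ?_ (PNat.eq ?_) _ _ rfl (heq_of_eq ?_) HEq.rfl
  · rw [← hi, wedge_ini, Category.assoc]
  · rw [← hf, fin_singleton_comp]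
  · rw [← hs]
    exact List.sum_singleton
  · exact wedge_singleton_hom_ext (wedgeInl_singleMap _).symm

/-- Concatenating the first cube with the remaining ones gives back the chain. Together with the
case of one cube, this shows that the one-cube paths generate ‖K‖ under composition. The ends and
the length of the tail are read off from its map, hence the existential quantifiers. -/
theorem _root_.PrecubicalFlow.ChainPath.exists_mk_cons {α β : vertices K} {N : ℕ+} {n : ℕ}
    {l : List ℕ} (hl : l ≠ []) (hp hs) (f : (wedge (n :: l)).obj ⟶ K) (hi hf)
    (x : chainSpace c (n :: l)) :
    ∃ (γ δ : vertices K) (M : ℕ+) (hp' : ∀ k ∈ l, 0 < k) (hs' : l.sum = M)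
      (hi' : yonedaEquiv ((wedge l).ini ≫ wedgeInr n l ≫ f) = γ)
      (hf' : yonedaEquiv ((wedge l).fin ≫ wedgeInr n l ≫ f) = δ) (h : _ = _),
      ChainPath.mk c (⟨n :: l, hp, hs, f, hi, hf⟩ : Chain K α β N) x =
        ChainPath.comp c
          (ChainPath.single (wedgeInl n l ≫ f) (Space.fst (X := natSpace c n) x))
          (ChainPath.mk c (⟨l, hp', hs', wedgeInr n l ≫ f, hi', hf'⟩ : Chain K γ δ M)
            (Space.snd (X := natSpace c n) x)) h := by
  have hp' : ∀ k ∈ l, 0 < k := fun k hk ↦ hp k (List.mem_cons_of_mem n hk)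
  -- The tail is a nonempty sequence of positive integers, so its length is an admissible index in
  -- `ℕ+`.
  have hpos : 0 < l.sum := List.sum_pos l hp' hl
  have h := congrArg yonedaEquiv (fin_eq_ini_comp f)
  refine ⟨_, _, ⟨l.sum, hpos⟩, hp', rfl, rfl, rfl, h, ?_⟩
  have e := ChainPath.comp_mk c (m := ⟨n, hp n List.mem_cons_self⟩) (n := ⟨l.sum, hpos⟩) h
    (Chain.single (wedgeInl n l ≫ f) (hp n List.mem_cons_self))
    ⟨l, hp', rfl, wedgeInr n l ≫ f, rfl, rfl⟩
    (Space.pair (X := natSpace c n) (Y := chainSpace c []) (Space.fst (X := natSpace c n) x)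
      PUnit.unit) (Space.snd (X := natSpace c n) x)
  refine Eq.trans ?_ e.symm
  have hj : (wedge [n]).fin ≫ singleMap (wedgeInl n l ≫ f) = (wedge l).ini ≫ wedgeInr n l ≫ f :=
    (fin_singleMap _).trans (fin_eq_ini_comp f)
  refine ChainPath.mk_eq c ?_ ?_ (PNat.eq ?_) _ _ rfl (heq_of_eq ?_) HEq.rfl
  · rw [← hi, wedge_ini, Category.assoc]
  · rw [← hf, wedge_fin, Category.assoc]
  · rw [← hs]
    exact List.sum_cons
  · refine wedge_hom_ext (n := n) (l := l) ?_ ?_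
    · exact ((wedgeInl_join (singleMap (wedgeInl n l ≫ f)) _ hj).trans
        (wedgeInl_singleMap _)).symm
    · exact (wedgeInr_join (singleMap (wedgeInl n l ≫ f)) _ hj).symm

/-- A morphism of flows preserves composites, so its values on one-cube paths determine its values
on all tuples. The ends and the length are quantified inside the induction because they change when
passing to the tail. -/
theorem hom_path_mk (m : chainFlow c K ⟶ X)
    (hm : ∀ {n : ℕ} (φ : (cube n).obj ⟶ K) (γ : natSpace c n),
      Flow.Hom.path m (ChainPath.single φ γ) = s.value φ γ) (l : List ℕ) (hl : l ≠ []) :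
    ∀ {α β : vertices K} {N : ℕ+} (hp hs) (f : (wedge l).obj ⟶ K) (hi hf)
      (x : chainSpace c l),
      Flow.Hom.path m (ChainPath.mk c (⟨l, hp, hs, f, hi, hf⟩ : Chain K α β N) x) =
        (s.eval l hl f x).1 := by
  induction l with
  | nil => exact (hl rfl).elim
  | cons n l ih =>
    intro α β N hp hs f hi hf x
    by_cases h : l = []
    · subst h
      rw [ChainPath.mk_singleton]
      exact hm _ _
    · obtain ⟨γ, δ, M, hp', hs', hi', hf', hc, e⟩ :=
        ChainPath.exists_mk_cons (c := c) h hp hs f hi hf x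
      rw [e]
      refine (Flow.Hom.path_comp m
        (ChainPath.single (wedgeInl n l ≫ f) (Space.fst (X := natSpace c n) x))
        (ChainPath.mk c (⟨l, hp', hs', wedgeInr n l ≫ f, hi', hf'⟩ : Chain K γ δ M)
          (Space.snd (X := natSpace c n) x)) hc).trans ?_
      refine Eq.trans ?_ (s.eval_cons h hl f x).symm
      exact Flow.comp_congr (hm _ _) (ih h hp' hs' _ hi' hf' _) _

theorem uniq (m : chainFlow c K ⟶ X) (hm : ∀ {n : ℕ} (φ : (cube n).obj ⟶ K),
    (cubeUnit c).app ⟨n⟩ ≫ (cubeChainRealization c).map φ ≫ m = s.app φ) : m = s.desc := by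
  refine Flow.hom_ext (fun α ↦ ?_) fun x ↦ ?_
  · refine Eq.trans ?_ (congrArg (fun g ↦ Flow.Hom.state g fun _ ↦ false)
      (hm (n := 0) (yonedaEquiv.symm α)))
    refine congrArg (Flow.Hom.state m) (Eq.trans ?_
      (app_vertexMap (n := 0) (yonedaEquiv.symm α) fun _ ↦ false).symm)
    -- The 0-cube has a single vertex, so the inclusion of this vertex is the identity and the
    -- hypothesis on 0-cubes gives the value of `m` at `α`.
    have e : vertexMap 0 (fun _ ↦ false) = 𝟙 _ :=
      Box.hom_ext fun v ↦ Subsingleton.elim (α := Fin 0 → Bool) _ _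
    rw [e, cubeHom_id]
    exact ((congrArg yonedaEquiv (Category.id_comp _)).trans
      (yonedaEquiv.apply_symm_apply α)).symm
  · obtain ⟨α, β, n, ⟨l, hp, hs, f, hi, hf⟩, p, rfl⟩ := ChainPath.exists_mk c x
    refine Eq.trans ?_ (s.descPath_mk (⟨l, hp, hs, f, hi, hf⟩ : Chain K α β n) p).symm
    refine s.hom_path_mk m (fun φ γ ↦ ?_) l _ hp hs f hi hf p
    -- A one-cube path is the image of a diagonal path under the unit followed by `φ`, and on such
    -- images `m` is prescribed by `hm`.
    refine (congrArg (Flow.Hom.path m) (ChainPath.map_toChainPath_diag φ γ).symm).trans ?_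
    exact congrArg (fun g : natCubeFlow c _ ⟶ X ↦ Flow.Hom.path g (CubePath.diag γ)) (hm φ)

end CubeCocone

/-! ### Left Kan extension along the Yoneda embedding -/

/-- The realization by cube chains, with the maps from the natural cubes. -/
noncomputable abbrev cubeChainExtension (c : SpaceKind) :
    (yoneda (C := Box)).LeftExtension (natCube c) :=
  Functor.LeftExtension.mk (cubeChainRealization c) (cubeUnit c)

/-- A cocone on the natural cubes of a precubical set, as a compatible family. -/
def cubeCoconeOfCocone {c : SpaceKind} {K : PrecubicalSet}
    (t : Cocone (CostructuredArrow.proj yoneda K ⋙ natCube c)) : CubeCocone K t.pt where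
  app {n} φ := t.ι.app (CostructuredArrow.mk (Y := (⟨n⟩ : Box)) φ)
  w {m n} f φ := (t.w (CostructuredArrow.homMk f rfl :
    CostructuredArrow.mk (Y := (⟨m⟩ : Box)) (cubeHom f ≫ φ) ⟶
      CostructuredArrow.mk (Y := (⟨n⟩ : Box)) φ)).symm

/-- The realization by cube chains is the colimit of the natural cubes. -/
noncomputable def cubeChainExtensionIsPointwise (c : SpaceKind) :
    (cubeChainExtension c).IsPointwiseLeftKanExtension := fun K ↦
  { desc := fun t ↦ (cubeCoconeOfCocone t).desc
    fac := fun t j ↦ (Category.assoc _ _ _).trans ((cubeCoconeOfCocone t).fac j.hom)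
    uniq := fun t m hm ↦ (cubeCoconeOfCocone t).uniq m fun {n} φ ↦
      (Category.assoc _ _ _).symm.trans
        (hm (CostructuredArrow.mk (Y := (⟨n⟩ : Box)) φ)) }

end PrecubicalFlow

theorem mainTheorem6 (c : PrecubicalFlow.SpaceKind) :
    Nonempty (PrecubicalFlow.cubeChainRealization c ≅ PrecubicalFlow.naturalRealization c) := by
  have : (PrecubicalFlow.cubeChainRealization c).IsLeftKanExtension
      (PrecubicalFlow.cubeUnit c) :=
    (PrecubicalFlow.cubeChainExtensionIsPointwise c).isLeftKanExtension
  -- Both functors are left Kan extensions of `natCube` along the Yoneda embedding, hence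
  -- canonically isomorphic as functors; naturality in the precubical set is part of this
  -- isomorphism.
  exact ⟨Functor.leftKanExtensionUnique _ (PrecubicalFlow.cubeUnit c)
    ((yoneda (C := PrecubicalFlow.Box)).pointwiseLeftKanExtension (PrecubicalFlow.natCube c))
    (yoneda.pointwiseLeftKanExtensionUnit (PrecubicalFlow.natCube c))⟩
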